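/- Let $\mathbb T^3=\mathbb R^3/\mathbb Z^3$, let $1<\gamma<\tfrac73$, let $q\in(1,4)$ satisfy $\gamma<1+\tfrac{4}{q+2}$, and let $0<T^*<\infty$. Let $(\varrho,v)$, with $\varrho>0$, be a strong solution on $\mathbb T^3\times[0,T^*)$ of the system $$\varrho_t+\operatorname{div}(\varrho v)-\Delta\varrho=0,\qquad \varrho v_t+\varrho(v-\nabla\log\varrho)\cdot\nabla v+\nabla(\varrho^\gamma)=\operatorname{div}(\varrho\nabla v)$$ (the compressible Navier–Stokes–Korteweg system with $\mu(\varrho)=\varrho$, $\lambda(\varrho)=0$, $\kappa(\varrho)=1/\varrho$, $P(\varrho)=\varrho^\gamma$, written in terms of the effective velocity $v=u+\nabla\log\varrho$), that is, the equations hold almost everywhere and, for every $0<T<T^*$, $$\varrho\in C([0,T];H^3)\cap L^2(0,T;H^4),\quad \varrho_t\in C([0,T];H^1)\cap L^2(0,T;H^2),$$ $$v\in C([0,T];H^2)\cap L^2(0,T;H^3),\quad v_t\in L^\infty(0,T;L^2)\cap L^2(0,T;H^1).$$ Write $\varrho_0=\varrho(\cdot,0)$, $v_0=v(\cdot,0)$,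 $u_0=v_0-\nabla\log\varrho_0$ and $$E_0=\int_{\mathbb T^3}\Big(\tfrac12\varrho_0|u_0|^2+\tfrac{1}{\gamma-1}\varrho_0^\gamma+2|\nabla\sqrt{\varrho_0}|^2\Big)dx.$$ Then there is a constant $C>0$, depending only on $T^*$, $q$, $\gamma$, $E_0$, $\|\varrho_0^{1/(q+2)}v_0\|_{L^{q+2}}$ and $\|\varrho_0\|_{L^\infty}$ (in particular not on $T$), such that for every $0<T<T^*$ $$\sup_{0\le t\le T}\|\varrho(\cdot,t)\|_{L^\infty}\le C.$$ -/

import Mathlib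

open MeasureTheory Set
open scoped ENNReal NNReal ContDiff

noncomputable section

namespace NSK

/-- The flat torus `𝕋³ = ℝ³ / ℤ³`, with its Lebesgue (Haar) measure `volume` of total mass `1`. -/
abbrev Torus3 : Type := UnitAddTorus (Fin 3)

/-- Smooth functions on the torus: the `ℤ³`-periodic lift to `ℝ³` is `C^∞`. -/
def IsSmooth (φ : Torus3 → ℝ) : Prop :=
  ContDiff ℝ ∞ (fun x : Fin 3 → ℝ => φ (fun i => (x i : UnitAddCircle)))

/-- The classical partial derivative `∂ᵢ φ` on the torus. -/
def pderiv (i : Fin 3) (φ : Torus3 → ℝ) (y : Torus3) : ℝ :=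
  deriv (fun s : ℝ => φ (y + Pi.single i (s : UnitAddCircle))) 0

/-- `g` is the weak (distributional) partial derivative `∂ᵢ f` on the torus. -/
def IsWeakDeriv (i : Fin 3) (f g : Torus3 → ℝ) : Prop :=
  Integrable f ∧ Integrable g ∧
    ∀ φ : Torus3 → ℝ, IsSmooth φ → (∫ x, f x * pderiv i φ x) = - (∫ x, g x * φ x)

/-- `f` has an integrable weak partial derivative `∂ᵢ f`. -/
def HasWeakDeriv (i : Fin 3) (f : Torus3 → ℝ) : Prop :=
  ∃ g, IsWeakDeriv i f g

open Classical in
/-- The weak partial derivative `∂ᵢ f` (unique up to a null set), and `0` if there is none. -/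
def wderiv (i : Fin 3) (f : Torus3 → ℝ) : Torus3 → ℝ :=
  if h : HasWeakDeriv i f then h.choose else 0

open Classical in
/-- The class of `f` in `L²(𝕋³)`, and `0` if `f` is not square integrable. -/
def toL2 (f : Torus3 → ℝ) : Lp ℝ 2 (volume : Measure Torus3) :=
  if h : MemLp f 2 volume then h.toLp f else 0

/-- `F ∈ C([0,T]; L²)`. -/
def ContL2 (T : ℝ) (F : ℝ → Torus3 → ℝ) : Prop :=
  (∀ t ∈ Icc 0 T, MemLp (F t) 2 volume) ∧ ContinuousOn (fun t => toL2 (F t)) (Icc 0 T)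

/-- `F ∈ C([0,T]; H^k)`: all weak derivatives of `F` of order at most `k` are in `C([0,T]; L²)`. -/
def ContSobolev (T : ℝ) : ℕ → (ℝ → Torus3 → ℝ) → Prop
  | 0, F => ContL2 T F
  | k + 1, F => ContL2 T F ∧ ∀ i : Fin 3,
      (∀ t ∈ Icc 0 T, HasWeakDeriv i (F t)) ∧ ContSobolev T k (fun t => wderiv i (F t))

/-- `F ∈ L^p(0,T; L²)` (Bochner space). -/
def LpL2 (p : ℝ≥0∞) (T : ℝ) (F : ℝ → Torus3 → ℝ) : Prop :=
  (∀ᵐ t ∂(volume.restrict (Ioo 0 T)), MemLp (F t) 2 volume) ∧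
    MemLp (fun t => toL2 (F t)) p (volume.restrict (Ioo 0 T))

/-- `F ∈ L^p(0,T; H^k)`: all weak derivatives of `F` of order at most `k` are in `L^p(0,T; L²)`. -/
def LpSobolev (p : ℝ≥0∞) (T : ℝ) : ℕ → (ℝ → Torus3 → ℝ) → Prop
  | 0, F => LpL2 p T F
  | k + 1, F => LpL2 p T F ∧ ∀ i : Fin 3,
      (∀ᵐ t ∂(volume.restrict (Ioo 0 T)), HasWeakDeriv i (F t)) ∧
        LpSobolev p T k (fun t => wderiv i (F t))

/-- `∂ₜ F = G` on `[0,T]` for curves in `L²`: `F` is the absolutely continuous curve with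
derivative `G`, i.e. `F(t) = F(s) + ∫ₛᵗ G(r) dr` (Bochner integral in `L²`). -/
def IsTimeDeriv (T : ℝ) (F G : ℝ → Torus3 → ℝ) : Prop :=
  IntervalIntegrable (fun r => toL2 (G r)) volume 0 T ∧
    ∀ s ∈ Icc 0 T, ∀ t ∈ Icc 0 T, toL2 (F t) = toL2 (F s) + ∫ r in s..t, toL2 (G r)

/-- `(ρ, v)` is a strong solution on `𝕋³ × [0, Tstar)` of
`ρ_t + div (ρ v) - Δ ρ = 0`,
`ρ v_t + ρ (v - ∇ log ρ) · ∇ v + ∇ (ρ^γ) = div (ρ ∇ v)`,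
with positive density `ρ`; `ρt` and `vt` are the time derivatives of `ρ` and `v`.
For the density, `ρ t` is the continuous representative of its class in `H³`. -/
structure IsStrongSolutionWith (γ Tstar : ℝ)
    (ρ : ℝ → Torus3 → ℝ) (v : ℝ → Torus3 → EuclideanSpace ℝ (Fin 3))
    (ρt : ℝ → Torus3 → ℝ) (vt : ℝ → Torus3 → EuclideanSpace ℝ (Fin 3)) : Prop where
  continuous_density : ∀ t ∈ Ico 0 Tstar, Continuous (ρ t)
  density_pos : ∀ t ∈ Ico 0 Tstar, ∀ x, 0 < ρ t x
  density_regular : ∀ T ∈ Ioo 0 Tstar,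
    ContSobolev T 3 ρ ∧ LpSobolev 2 T 4 ρ
  density_time_regular : ∀ T ∈ Ioo 0 Tstar,
    IsTimeDeriv T ρ ρt ∧ ContSobolev T 1 ρt ∧ LpSobolev 2 T 2 ρt
  velocity_regular : ∀ T ∈ Ioo 0 Tstar, ∀ j : Fin 3,
    ContSobolev T 2 (fun t x => v t x j) ∧ LpSobolev 2 T 3 (fun t x => v t x j)
  velocity_time_regular : ∀ T ∈ Ioo 0 Tstar, ∀ j : Fin 3,
    IsTimeDeriv T (fun t x => v t x j) (fun t x => vt t x j) ∧
      LpSobolev ∞ T 0 (fun t x => vt t x j) ∧ LpSobolev 2 T 1 (fun t x => vt t x j)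
  mass_equation : ∀ᵐ t ∂(volume.restrict (Ioo 0 Tstar)), ∀ᵐ x : Torus3,
    ρt t x + (∑ i, wderiv i (fun y => ρ t y * v t y i) x)
      - (∑ i, wderiv i (wderiv i (ρ t)) x) = 0
  momentum_equation : ∀ᵐ t ∂(volume.restrict (Ioo 0 Tstar)), ∀ᵐ x : Torus3, ∀ j : Fin 3,
    ρ t x * vt t x j
      + (∑ i, ρ t x * (v t x i - wderiv i (fun y => Real.log (ρ t y)) x)
          * wderiv i (fun y => v t y j) x)
      + wderiv j (fun y => ρ t y ^ γ) x
      = ∑ i, wderiv i (fun y => ρ t y * wderiv i (fun z => v t z j) y) x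

/-- `(ρ, v)` is a strong solution on `𝕋³ × [0, Tstar)` with positive density. -/
def IsStrongSolution (γ Tstar : ℝ)
    (ρ : ℝ → Torus3 → ℝ) (v : ℝ → Torus3 → EuclideanSpace ℝ (Fin 3)) : Prop :=
  ∃ ρt vt, IsStrongSolutionWith γ Tstar ρ v ρt vt

/-- The initial energy
`E₀ = ∫ (½ ρ₀ |u₀|² + ρ₀^γ / (γ - 1) + 2 |∇ √ρ₀|²) dx`, where `u₀ = v₀ - ∇ log ρ₀`. -/
def initialEnergy (γ : ℝ) (ρ₀ : Torus3 → ℝ) (v₀ : Torus3 → EuclideanSpace ℝ (Fin 3)) : ℝ :=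
  ∫ x, (1 / 2 * ρ₀ x * (∑ i, (v₀ x i - wderiv i (fun y => Real.log (ρ₀ y)) x) ^ 2)
    + 1 / (γ - 1) * ρ₀ x ^ γ
    + 2 * (∑ i, (wderiv i (fun y => Real.sqrt (ρ₀ y)) x) ^ 2))

end NSK

end

noncomputable section

namespace NSK

open UnitAddTorus (mFourier)
open scoped ComplexConjugate

/-! ## Functions with a continuous gradient on the torus -/

/-! In the effective velocity both equations carry the same flux $\varrho v-\nabla\varrho$. Testing
the mass equation with a function of $|v|$ and the momentum equation with the corresponding multiple
of $v$ therefore cancels all convective terms. Write $D=\int\varrho|\nabla v|^2$, $P=\int\varrho^3$,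
$G=\int\varrho|\nabla\varrho|^2$, $W=\int\varrho^5$ and $Y=\int\varrho|v|^{q+2}$.

The energy $E=\int(\frac12\varrho|v|^2+\frac1{\gamma-1}\varrho^\gamma)$ satisfies $E'\le-D$
(`Snapshot.energy_le`). Testing the mass equation with $\varrho^2$ gives
$P'=-6G-2\int\varrho^3\operatorname{div}v$. The last term is controlled by $W$ and $D$, and
Sobolev's inequality for $\varrho^{3/2}$ gives $W\le(1+P)(2P+216G)$; hence $P'\le-3G+(1+P)(1+216D)$
(`integral_cube_deriv_le`). So $\log(1+P)+216E$ grows at most linearly: $P$ is bounded and the time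
integral of $G$ is paid for.

Testing with $|v|^qv$, the pressure leaves $\varrho^{2\gamma-1}|v|^q$ after Young. The condition on
$\gamma$ and $q$ puts this below $\varrho|v|^{q+2}+1+\varrho^5$, so $Y'\le c(Y+1+W)$
(`velocity_rpow_le`). `LipCurve.bootstrap` combines the three inequalities into a bound for $Y$.

Finally, the bound on $Y$ feeds a Moser iteration from $\int\varrho^n$ to $\int\varrho^{2n}$
(`moser_step`). The bad term is $\int\varrho^{2n}|v|^2$. As $q+2>3$, its part at large $|v|$ is
small enough for Sobolev's inequality to absorb it. The constants grow polynomially in $n$, so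
doubling $n$ repeatedly yields an $L^\infty$ bound depending only on $T^*$ and the data.

To justify these computations, absolutely convergent Fourier series provide continuous
representatives of $H^2$ functions. Almost every time then has a $C^1$ state satisfying the
equations weakly (`exists_snapshot`), and a chain rule along curves that are uniformly continuous in
sup norm and a.e. differentiable in $L^1$ (`RegularCurve.integral_comp`) turns the functionals above
into Lipschitz functions of time. -/

theorem volume_unitAddCircle_eq_haar :
    (volume : Measure UnitAddCircle) = AddCircle.haarAddCircle := by
  rw [AddCircle.volume_eq_smul_haarAddCircle]; simp

instance isProbabilityMeasure_volume_unitAddCircle :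
    IsProbabilityMeasure (volume : Measure UnitAddCircle) := by
  rw [volume_unitAddCircle_eq_haar]; infer_instance

/-- `f` is continuously differentiable on the torus, with partial derivatives `f' i`. -/
structure HasGrad (f : Torus3 → ℝ) (f' : Fin 3 → Torus3 → ℝ) : Prop where
  cont : Continuous f
  cont' : ∀ i, Continuous (f' i)
  deriv : ∀ i y, HasDerivAt (fun s : ℝ => f (y + Pi.single i (s : UnitAddCircle))) (f' i y) 0

theorem continuous_shift (i : Fin 3) :
    Continuous fun s : ℝ => (Pi.single i (s : UnitAddCircle) : Torus3) :=
  (continuous_single i).comp (AddCircle.continuous_mk' 1)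

theorem _root_.Continuous.integrable_torus {E : Type*} [NormedAddCommGroup E]
    [SecondCountableTopologyEither Torus3 E] {f : Torus3 → E} (hf : Continuous f) :
    Integrable f :=
  hf.integrable_of_hasCompactSupport (HasCompactSupport.of_compactSpace f)

theorem exists_bound_of_continuous {f : Torus3 → ℝ} (hf : Continuous f) :
    ∃ C, 0 ≤ C ∧ ∀ x, |f x| ≤ C := by
  obtain ⟨C, hC⟩ := isCompact_univ.exists_bound_of_continuousOn hf.continuousOn
  exact ⟨|C|, abs_nonneg C, fun x => (hC x (mem_univ x)).trans (le_abs_self C)⟩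

namespace HasGrad

variable {f g : Torus3 → ℝ} {f' g' : Fin 3 → Torus3 → ℝ}

theorem hasDerivAt (hf : HasGrad f f') (i : Fin 3) (y : Torus3) (s : ℝ) :
    HasDerivAt (fun s : ℝ => f (y + Pi.single i (s : UnitAddCircle)))
      (f' i (y + Pi.single i (s : UnitAddCircle))) s := by
  have h := hf.deriv i (y + Pi.single i (s : UnitAddCircle))
  have h0 : (0 : ℝ) = s - s := by simp
  rw [h0] at h
  have h2 := HasDerivAt.comp_sub_const s s h
  refine h2.congr_of_eventuallyEq (Filter.Eventually.of_forall fun r => ?_)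
  simp only [add_assoc, ← Pi.single_add]
  congr 3
  rw [← AddCircle.coe_add]; congr 1; ring

theorem congr (hf : HasGrad f f') (h : f = g) (h' : f' = g') : HasGrad g g' := by
  subst h h'; exact hf

theorem const (c : ℝ) : HasGrad (fun _ => c) (fun _ _ => 0) :=
  ⟨continuous_const, fun _ => continuous_const, fun _ _ => hasDerivAt_const _ _⟩

theorem add (hf : HasGrad f f') (hg : HasGrad g g') :
    HasGrad (fun x => f x + g x) (fun i x => f' i x + g' i x) :=
  ⟨hf.cont.add hg.cont, fun i => (hf.cont' i).add (hg.cont' i),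
    fun i y => (hf.deriv i y).fun_add (hg.deriv i y)⟩

theorem mul (hf : HasGrad f f') (hg : HasGrad g g') :
    HasGrad (fun x => f x * g x) (fun i x => f' i x * g x + f x * g' i x) := by
  refine ⟨hf.cont.mul hg.cont, fun i => ((hf.cont' i).mul hg.cont).add (hf.cont.mul (hg.cont' i)),
    fun i y => ?_⟩
  have := (hf.deriv i y).fun_mul (hg.deriv i y)
  simpa using this

theorem comp (hf : HasGrad f f') {h h' : ℝ → ℝ} (hh : ∀ x, HasDerivAt h (h' (f x)) (f x))
    (hc : Continuous fun x => h' (f x)) :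
    HasGrad (fun x => h (f x)) (fun i x => h' (f x) * f' i x) := by
  refine ⟨?_, fun i => hc.mul (hf.cont' i), fun i y => ?_⟩
  · exact continuous_iff_continuousAt.2 fun x =>
      ContinuousAt.comp (g := h) (hh x).continuousAt hf.cont.continuousAt
  · have := hf.deriv i y
    have h2 := hh y
    refine HasDerivAt.comp (h₂ := h) (0 : ℝ) ?_ this
    simpa using h2

theorem pow (hf : HasGrad f f') (n : ℕ) :
    HasGrad (fun x => f x ^ n) (fun i x => n * f x ^ (n - 1) * f' i x) :=
  hf.comp (h := fun r => r ^ n) (h' := fun r => n * r ^ (n - 1)) (fun x => hasDerivAt_pow n (f x))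
    (continuous_const.mul (hf.cont.pow _))

theorem rpow (hf : HasGrad f f') (hpos : ∀ x, 0 < f x) (a : ℝ) :
    HasGrad (fun x => f x ^ a) (fun i x => a * f x ^ (a - 1) * f' i x) :=
  hf.comp (h := fun r => r ^ a) (h' := fun r => a * r ^ (a - 1))
    (fun x => Real.hasDerivAt_rpow_const (Or.inl (hpos x).ne'))
    (continuous_const.mul (hf.cont.rpow_const fun x => Or.inl (hpos x).ne'))

theorem log (hf : HasGrad f f') (hpos : ∀ x, 0 < f x) :
    HasGrad (fun x => Real.log (f x)) (fun i x => (f x)⁻¹ * f' i x) :=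
  hf.comp (h := Real.log) (h' := fun r => r⁻¹) (fun x => Real.hasDerivAt_log (hpos x).ne')
    (hf.cont.inv₀ fun x => (hpos x).ne')

/-- The integral of a translate of `f` does not depend on the shift; differentiating under the
integral at shift zero gives the claim. -/
theorem integral_eq_zero (hf : HasGrad f f') (i : Fin 3) : ∫ x, f' i x = 0 := by
  obtain ⟨C, -, hC⟩ := exists_bound_of_continuous (hf.cont' i)
  have hsh : ∀ s : ℝ, Continuous fun y : Torus3 => y + Pi.single i (s : UnitAddCircle) :=
    fun s => continuous_id.add continuous_const
  let F : ℝ → Torus3 → ℝ := fun s y => f (y + Pi.single i (s : UnitAddCircle))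
  let F' : ℝ → Torus3 → ℝ := fun s y => f' i (y + Pi.single i (s : UnitAddCircle))
  have hm : ∀ s : ℝ, Continuous (F s) := fun s => hf.cont.comp (hsh s)
  have hm' : Continuous (F' 0) := (hf.cont' i).comp (hsh 0)
  have key := hasDerivAt_integral_of_dominated_loc_of_deriv_le (𝕜 := ℝ)
    (μ := (volume : Measure Torus3)) (x₀ := 0) (s := univ) (bound := fun _ => C)
    (F := F) (F' := F')
    Filter.univ_mem
    (Filter.Eventually.of_forall fun s => (hm s).aestronglyMeasurable)
    (hm 0).integrable_torus hm'.aestronglyMeasurable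
    (Filter.Eventually.of_forall fun y s _ => hC _) (integrable_const C)
    (Filter.Eventually.of_forall fun y s _ => hf.hasDerivAt i y s)
  have h1 : ∀ s : ℝ, ∫ y : Torus3, f (y + Pi.single i (s : UnitAddCircle)) = ∫ y, f y :=
    fun s => integral_add_right_eq_self f _
  have h2 := key.2
  simp only [F, F', h1] at h2
  have h3 := h2.unique (hasDerivAt_const _ _)
  simpa using h3

theorem integral_mul_deriv (hf : HasGrad f f') (hg : HasGrad g g') (i : Fin 3) :
    ∫ x, f x * g' i x = - ∫ x, f' i x * g x := by
  have h := (hf.mul hg).integral_eq_zero i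
  have h2 : ∫ x, (f' i x * g x + f x * g' i x) = (∫ x, f' i x * g x) + ∫ x, f x * g' i x :=
    integral_add ((hf.cont' i).mul hg.cont).integrable_torus
      (hf.cont.mul (hg.cont' i)).integrable_torus
  linarith

end HasGrad

theorem isOpenQuotientMap_torus :
    IsOpenQuotientMap fun (x : Fin 3 → ℝ) (i : Fin 3) => (x i : UnitAddCircle) :=
  IsOpenQuotientMap.piMap fun _ => QuotientAddGroup.isOpenQuotientMap_mk

/-- `IsSmooth` concerns the periodic lift; continuity of the function and its partials descends
because $\mathbb R^3\to\mathbb T^3$ is an open quotient map. -/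
theorem IsSmooth.hasGrad {φ : Torus3 → ℝ} (hφ : IsSmooth φ) :
    HasGrad φ (fun i => pderiv i φ) := by
  set Φ : (Fin 3 → ℝ) → ℝ := fun x => φ (fun i => (x i : UnitAddCircle)) with hΦ
  have hd : ∀ (i : Fin 3) (x : Fin 3 → ℝ),
      HasDerivAt (fun s : ℝ => φ ((fun j => (x j : UnitAddCircle)) + Pi.single i (s : UnitAddCircle)))
        (fderiv ℝ Φ x (Pi.single i 1)) 0 := by
    intro i x
    have h1 : HasFDerivAt Φ (fderiv ℝ Φ x) x :=
      ((hφ.differentiable (by simp)) x).hasFDerivAt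
    have h2 : HasDerivAt (fun s : ℝ => x + s • (Pi.single i (1 : ℝ) : Fin 3 → ℝ))
        (Pi.single i (1 : ℝ)) 0 := by
      simpa using ((hasDerivAt_id (0 : ℝ)).smul_const (Pi.single i (1 : ℝ) : Fin 3 → ℝ)).const_add x
    have h3 := HasFDerivAt.comp_hasDerivAt_of_eq (0 : ℝ) h1 h2 (by simp)
    refine h3.congr_of_eventuallyEq (Filter.Eventually.of_forall fun s => ?_)
    simp only [Function.comp, hΦ]
    congr 1
    funext j
    by_cases h : j = i
    · subst h; simp
    · simp [h]
  refine ⟨?_, fun i => ?_, fun i y => ?_⟩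
  · exact isOpenQuotientMap_torus.isQuotientMap.continuous_iff.2 hφ.continuous
  · rw [isOpenQuotientMap_torus.isQuotientMap.continuous_iff]
    have : (pderiv i φ ∘ fun (x : Fin 3 → ℝ) (i : Fin 3) => (x i : UnitAddCircle)) =
        fun x => fderiv ℝ Φ x (Pi.single i 1) := funext fun x => (hd i x).deriv
    rw [this]
    exact (hφ.continuous_fderiv (by simp)).clm_apply continuous_const
  · obtain ⟨x, rfl⟩ := isOpenQuotientMap_torus.surjective y
    have := hd i x
    convert this using 1
    exact this.deriv

theorem HasGrad.isWeakDeriv {f : Torus3 → ℝ} {f' : Fin 3 → Torus3 → ℝ} (hf : HasGrad f f')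
    (i : Fin 3) : IsWeakDeriv i f (f' i) :=
  ⟨hf.cont.integrable_torus, (hf.cont' i).integrable_torus,
    fun _ hφ => hf.integral_mul_deriv hφ.hasGrad i⟩

/-! ## Hölder and Sobolev inequalities -/

/-- The fundamental theorem of calculus compares `g x` with any other value on the coordinate circle
through `x`; averaging over that circle, of length one, gives the bound. -/
theorem le_integral_circle {g : Torus3 → ℝ} {g' : Fin 3 → Torus3 → ℝ} (hg : HasGrad g g')
    (i : Fin 3) (x : Torus3) :
    g x ≤ ∫ a : UnitAddCircle, (g (Function.update x i a) + |g' i (Function.update x i a)|) := by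
  have hc : ∀ {h : Torus3 → ℝ}, Continuous h →
      Continuous fun s : ℝ => h (x + Pi.single i (s : UnitAddCircle)) := fun hh =>
    hh.comp (continuous_const.add (continuous_shift i))
  have hG := hc hg.cont
  have hG' := hc (hg.cont' i)
  have hK := hG'.abs
  have h1 : ∀ s ∈ Icc (0 : ℝ) 1, g x ≤ g (x + Pi.single i (s : UnitAddCircle)) +
      ∫ r in (0 : ℝ)..1, |g' i (x + Pi.single i (r : UnitAddCircle))| := by
    intro s hs
    have e1 := intervalIntegral.integral_eq_sub_of_hasDerivAt (a := 0) (b := s)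
      (fun r _ => hg.hasDerivAt i x r) (hG'.intervalIntegrable _ _)
    have e2 : |∫ r in (0 : ℝ)..s, g' i (x + Pi.single i (r : UnitAddCircle))| ≤
        ∫ r in (0 : ℝ)..s, |g' i (x + Pi.single i (r : UnitAddCircle))| :=
      intervalIntegral.abs_integral_le_integral_abs hs.1
    have e3 : (∫ r in (0 : ℝ)..s, |g' i (x + Pi.single i (r : UnitAddCircle))|) ≤
        ∫ r in (0 : ℝ)..1, |g' i (x + Pi.single i (r : UnitAddCircle))| :=
      intervalIntegral.integral_mono_interval le_rfl hs.1 hs.2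
        (Filter.Eventually.of_forall fun _ => abs_nonneg _) (hK.intervalIntegrable _ _)
    have e4 : g (x + Pi.single i ((0 : ℝ) : UnitAddCircle)) = g x := by simp
    rw [e4] at e1
    have := abs_le.1 (e2.trans e3)
    linarith [this.1]
  have h2 : g x ≤ ∫ s in (0 : ℝ)..1, (g (x + Pi.single i (s : UnitAddCircle)) +
      |g' i (x + Pi.single i (s : UnitAddCircle))|) := by
    have e1 := intervalIntegral.integral_mono_on (μ := volume) (a := (0 : ℝ)) (b := 1) zero_le_one
      (f := fun _ => g x) (intervalIntegrable_const)
      ((hG.intervalIntegrable 0 1).add intervalIntegrable_const) h1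
    rw [intervalIntegral.integral_add (hG.intervalIntegrable 0 1)
      intervalIntegrable_const] at e1
    rw [intervalIntegral.integral_add (hG.intervalIntegrable _ _) (hK.intervalIntegrable _ _)]
    simpa using e1
  have h3 := UnitAddCircle.intervalIntegral_preimage 0
    (fun a : UnitAddCircle => g (x + Pi.single i a) + |g' i (x + Pi.single i a)|)
  rw [zero_add] at h3
  rw [h3] at h2
  refine h2.trans_eq ?_
  rw [← integral_sub_right_eq_self _ (x i)]
  have : ∀ a : UnitAddCircle, x + Pi.single i (a - x i) = Function.update x i a := by
    intro a
    funext j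
    by_cases h : j = i
    · subst h; simp
    · simp [h]
  simp only [this]

/-- The Gagliardo–Nirenberg embedding $W^{1,1}\subset L^{3/2}$: write $g^{3/2}$ as three factors
$g^{1/2}$, bound each by its integral along one coordinate direction, and apply the Loomis–Whitney
type grid inequality. -/
theorem integral_rpow_three_halves_le {g : Torus3 → ℝ} {g' : Fin 3 → Torus3 → ℝ}
    (hg : HasGrad g g') (h0 : ∀ x, 0 ≤ g x) :
    ∫ x, g x ^ (3 / 2 : ℝ) ≤ (∫ x, (g x + ∑ i, |g' i x|)) ^ (3 / 2 : ℝ) := by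
  set k : Torus3 → ℝ := fun x => g x + ∑ i, |g' i x| with hk
  have hkc : Continuous k :=
    hg.cont.add (continuous_finsetSum _ fun i _ => (hg.cont' i).abs)
  have hk0 : ∀ x, 0 ≤ k x := fun x =>
    add_nonneg (h0 x) (Finset.sum_nonneg fun i _ => abs_nonneg _)
  have hline : ∀ (i : Fin 3) (x : Torus3), ENNReal.ofReal (g x) ≤
      ∫⁻ a : UnitAddCircle, ENNReal.ofReal (k (Function.update x i a)) := by
    intro i x
    have hupd : Continuous fun a : UnitAddCircle => Function.update x i a :=
      continuous_const.update i continuous_id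
    have hkcu : Continuous fun a : UnitAddCircle => k (Function.update x i a) := hkc.comp hupd
    rw [← ofReal_integral_eq_lintegral_ofReal
      (hkcu.integrable_of_hasCompactSupport (HasCompactSupport.of_compactSpace _))
      (Filter.Eventually.of_forall fun a => hk0 _)]
    refine ENNReal.ofReal_le_ofReal ((le_integral_circle hg i x).trans ?_)
    refine integral_mono (Continuous.integrable_of_hasCompactSupport
      ((hg.cont.comp hupd).add ((hg.cont' i).comp hupd).abs)
        (HasCompactSupport.of_compactSpace _))
      (hkcu.integrable_of_hasCompactSupport (HasCompactSupport.of_compactSpace _)) fun a => ?_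
    simp only [hk]
    gcongr
    exact Finset.single_le_sum (f := fun j => |g' j (Function.update x i a)|)
      (fun j _ => abs_nonneg _) (Finset.mem_univ i)
  have hp : Real.HolderConjugate (Fintype.card (Fin 3) : ℝ) (3 / 2) := by
    rw [Real.holderConjugate_iff]; norm_num
  have hgrid := lintegral_prod_lintegral_pow_le (μ := fun _ : Fin 3 => (volume : Measure UnitAddCircle))
    hp (f := fun x => ENNReal.ofReal (k x)) (hkc.measurable.ennreal_ofReal)
  have h1 : ∫⁻ x : Torus3, ENNReal.ofReal (g x ^ (3 / 2 : ℝ)) ≤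
      (∫⁻ x : Torus3, ENNReal.ofReal (k x)) ^ (3 / 2 : ℝ) := by
    refine le_trans (lintegral_mono fun x => ?_) hgrid
    rw [← ENNReal.ofReal_rpow_of_nonneg (h0 x) (by norm_num)]
    have e : ENNReal.ofReal (g x) ^ (3 / 2 : ℝ) =
        ∏ _i : Fin 3, ENNReal.ofReal (g x) ^ ((1 : ℝ) / ((Fintype.card (Fin 3) : ℝ) - 1)) := by
      rw [Finset.prod_const, Finset.card_univ, ← ENNReal.rpow_natCast, ← ENNReal.rpow_mul]
      congr 1; norm_num
    rw [e]
    refine Finset.prod_le_prod' fun i _ => ?_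
    refine ENNReal.rpow_le_rpow (hline i x) (by norm_num)
  have hgc : Continuous fun x => g x ^ (3 / 2 : ℝ) :=
    hg.cont.rpow_const fun x => Or.inr (by norm_num)
  rw [← ofReal_integral_eq_lintegral_ofReal hgc.integrable_torus
      (Filter.Eventually.of_forall fun x => Real.rpow_nonneg (h0 x) _),
    ← ofReal_integral_eq_lintegral_ofReal hkc.integrable_torus
      (Filter.Eventually.of_forall hk0),
    ENNReal.ofReal_rpow_of_nonneg (integral_nonneg hk0) (by norm_num)] at h1
  exact (ENNReal.ofReal_le_ofReal_iff (Real.rpow_nonneg (integral_nonneg hk0) _)).1 h1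

theorem integral_mul_le_rpow {a b : Torus3 → ℝ} (ha : Continuous a) (hb : Continuous b)
    (ha0 : ∀ x, 0 ≤ a x) (hb0 : ∀ x, 0 ≤ b x) {p q : ℝ} (hpq : p.HolderConjugate q) :
    ∫ x, a x * b x ≤ (∫ x, a x ^ p) ^ (1 / p) * (∫ x, b x ^ q) ^ (1 / q) :=
  integral_mul_le_Lp_mul_Lq_of_nonneg hpq (Filter.Eventually.of_forall ha0)
    (Filter.Eventually.of_forall hb0) (ha.memLp_of_hasCompactSupport
      (HasCompactSupport.of_compactSpace _)) (hb.memLp_of_hasCompactSupport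
      (HasCompactSupport.of_compactSpace _))

theorem integral_mul_sq_le {a b : Torus3 → ℝ} (ha : Continuous a) (hb : Continuous b) :
    (∫ x, a x * b x) ^ 2 ≤ (∫ x, a x ^ 2) * ∫ x, b x ^ 2 := by
  have h := integral_mul_le_rpow ha.abs hb.abs (fun x => abs_nonneg _) (fun x => abs_nonneg _)
    (p := 2) (q := 2) (by rw [Real.holderConjugate_iff]; norm_num)
  have h1 : |∫ x, a x * b x| ≤ ∫ x, |a x| * |b x| := by
    refine abs_integral_le_integral_abs.trans_eq ?_
    simp only [abs_mul]
  simp only [Real.rpow_two, sq_abs, ← Real.sqrt_eq_rpow] at h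
  have h2 := h1.trans h
  have h3 := pow_le_pow_left₀ (abs_nonneg _) h2 2
  rwa [sq_abs, mul_pow, Real.sq_sqrt (integral_nonneg fun x => sq_nonneg _),
    Real.sq_sqrt (integral_nonneg fun x => sq_nonneg _)] at h3

/-- This is $H^1\subset L^6$ for $f^{p/2}$, obtained from the $W^{1,1}$ embedding applied to
$f^{2p}$. The gradient term is exactly the dissipation in the $L^p$ estimate for the mass equation,
and the explicit $p^2$ is what the Moser iteration needs. -/
theorem sobolev_pow {f : Torus3 → ℝ} {f' : Fin 3 → Torus3 → ℝ} (hf : HasGrad f f')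
    (hpos : ∀ x, 0 < f x) {p : ℕ} (hp : 2 ≤ p) :
    (∫ x, f x ^ (3 * p)) ^ (1 / 3 : ℝ) ≤
      2 * (∫ x, f x ^ p) + 24 * p ^ 2 * ∑ i, ∫ x, f x ^ (p - 2) * f' i x ^ 2 := by
  have hg := hf.pow (2 * p)
  have h0 := integral_rpow_three_halves_le hg fun x => by have := hpos x; positivity
  have e1 : ∀ x, (f x ^ (2 * p)) ^ (3 / 2 : ℝ) = f x ^ (3 * p) := by
    intro x
    rw [← Real.rpow_natCast, ← Real.rpow_mul (hpos x).le, ← Real.rpow_natCast]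
    congr 1; push_cast; ring
  simp only [e1] at h0
  have hc : ∀ n : ℕ, Continuous fun x => f x ^ n := fun n => hf.cont.pow n
  set S := ∫ x, f x ^ (3 * p) with hS
  have hS0 : 0 ≤ S := integral_nonneg fun x => by have := hpos x; positivity
  set A := ∫ x, f x ^ p with hA
  have hA0 : 0 ≤ A := integral_nonneg fun x => by have := hpos x; positivity
  set B : Fin 3 → ℝ := fun i => ∫ x, f x ^ (p - 2) * f' i x ^ 2 with hB
  have hB0 : ∀ i, 0 ≤ B i := fun i => integral_nonneg fun x => by have := hpos x; positivity
  have e2 : ∫ x, f x ^ (2 * p) ≤ √S * √A := by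
    -- Half-integer exponents occur because odd `p` is allowed; `p = 3` is used for the bound on
    -- $\int\varrho^5$.
    have hr : ∀ (n : ℕ) x, (f x ^ ((n : ℝ) / 2)) ^ 2 = f x ^ n := by
      intro n x
      rw [← Real.rpow_natCast (f x ^ ((n : ℝ) / 2)), ← Real.rpow_mul (hpos x).le,
        ← Real.rpow_natCast]
      congr 1; push_cast; ring
    have h := integral_mul_sq_le (a := fun x => f x ^ (((3 * p : ℕ) : ℝ) / 2))
      (b := fun x => f x ^ ((p : ℝ) / 2))
      (hf.cont.rpow_const fun x => Or.inl (hpos x).ne')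
      (hf.cont.rpow_const fun x => Or.inl (hpos x).ne')
    simp only [hr] at h
    have h2 : ∀ x, f x ^ (((3 * p : ℕ) : ℝ) / 2) * f x ^ ((p : ℝ) / 2) = f x ^ (2 * p) := by
      intro x
      rw [← Real.rpow_add (hpos x), ← Real.rpow_natCast]
      congr 1; push_cast; ring
    simp only [h2] at h
    rw [← Real.sqrt_mul hS0]
    exact Real.le_sqrt_of_sq_le h
  have e3 : ∀ i, ∫ x, f x ^ (2 * p - 1) * |f' i x| ≤ √S * √(B i) := by
    intro i
    have hr : ∀ (n : ℕ) x, (f x ^ ((n : ℝ) / 2)) ^ 2 = f x ^ n := by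
      intro n x
      rw [← Real.rpow_natCast (f x ^ ((n : ℝ) / 2)), ← Real.rpow_mul (hpos x).le,
        ← Real.rpow_natCast]
      congr 1; push_cast; ring
    have h := integral_mul_sq_le (a := fun x => f x ^ (((3 * p : ℕ) : ℝ) / 2))
      (b := fun x => f x ^ (((p - 2 : ℕ) : ℝ) / 2) * |f' i x|)
      (hf.cont.rpow_const fun x => Or.inl (hpos x).ne')
      ((hf.cont.rpow_const fun x => Or.inl (hpos x).ne').mul (hf.cont' i).abs)
    simp only [mul_pow, sq_abs, hr] at h
    have h2 : ∀ x, f x ^ (((3 * p : ℕ) : ℝ) / 2) * (f x ^ (((p - 2 : ℕ) : ℝ) / 2) * |f' i x|) =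
        f x ^ (2 * p - 1) * |f' i x| := by
      intro x
      rw [← mul_assoc, ← Real.rpow_add (hpos x), ← Real.rpow_natCast]
      congr 2
      rw [Nat.cast_sub hp, Nat.cast_sub (by omega)]; push_cast; ring
    simp only [h2] at h
    rw [← Real.sqrt_mul hS0]
    exact Real.le_sqrt_of_sq_le h
  have e4 : ∫ x, (f x ^ (2 * p) + ∑ i, |((2 * p : ℕ) : ℝ) * f x ^ (2 * p - 1) * f' i x|) ≤
      √S * (√A + 2 * p * ∑ i, √(B i)) := by
    have hd : ∀ i, Continuous fun x => |((2 * p : ℕ) : ℝ) * f x ^ (2 * p - 1) * f' i x| :=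
      fun i => ((continuous_const.mul (hc _)).mul (hf.cont' i)).abs
    rw [integral_add (hc _).integrable_torus
      (integrable_finsetSum _ fun i _ => (hd i).integrable_torus),
      integral_finsetSum _ fun i _ => (hd i).integrable_torus]
    have e5 : ∀ i, ∫ x, |((2 * p : ℕ) : ℝ) * f x ^ (2 * p - 1) * f' i x| ≤
        2 * p * (√S * √(B i)) := by
      intro i
      have : ∀ x, |((2 * p : ℕ) : ℝ) * f x ^ (2 * p - 1) * f' i x| =
          2 * p * (f x ^ (2 * p - 1) * |f' i x|) := by
        intro x
        rw [abs_mul, abs_of_nonneg (by have := hpos x; positivity)]; push_cast; ring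
      simp only [this]
      rw [integral_const_mul]
      gcongr
      exact e3 i
    calc _ ≤ √S * √A + ∑ i, 2 * p * (√S * √(B i)) :=
          add_le_add e2 (Finset.sum_le_sum fun i _ => e5 i)
      _ = _ := by rw [← Finset.mul_sum, ← Finset.mul_sum]; ring
  set X := √A + 2 * p * ∑ i, √(B i) with hX
  have hX0 : 0 ≤ X := add_nonneg (Real.sqrt_nonneg _)
    (mul_nonneg (by positivity) (Finset.sum_nonneg fun i _ => Real.sqrt_nonneg _))
  have h1 : S ≤ (√S * X) ^ (3 / 2 : ℝ) := h0.trans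
    (Real.rpow_le_rpow (integral_nonneg fun x => add_nonneg (by have := hpos x; positivity)
      (Finset.sum_nonneg fun i _ => abs_nonneg _)) e4 (by norm_num))
  -- Raise $S\le(\sqrt S\,X)^{3/2}$ to the power $2/3$ and cancel $\sqrt S$: this leaves $S^{1/6}\le
  -- X$.
  have h2 : S ^ (1 / 3 : ℝ) ≤ X ^ 2 := by
    rcases hS0.eq_or_lt with h | h
    · rw [← h, Real.zero_rpow (by norm_num)]; positivity
    · have h3 := Real.rpow_le_rpow hS0 h1 (show (0 : ℝ) ≤ 2 / 3 by norm_num)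
      rw [← Real.rpow_mul (by positivity)] at h3
      norm_num at h3
      have h4 : S ^ (2 / 3 : ℝ) = √S * S ^ (1 / 6 : ℝ) := by
        rw [Real.sqrt_eq_rpow, ← Real.rpow_add h]; norm_num
      rw [h4] at h3
      have h5 := le_of_mul_le_mul_left h3 (Real.sqrt_pos.2 h)
      have h6 := pow_le_pow_left₀ (by positivity) h5 2
      rw [← Real.rpow_natCast, ← Real.rpow_mul hS0] at h6
      norm_num at h6 ⊢
      exact h6
  refine h2.trans ?_
  have h7 : (∑ i, √(B i)) ^ 2 ≤ 3 * ∑ i, B i := by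
    have := sq_sum_le_card_mul_sum_sq (s := (Finset.univ : Finset (Fin 3))) (f := fun i => √(B i))
    simpa [Real.sq_sqrt (hB0 _)] using this
  have h8 : √A ^ 2 = A := Real.sq_sqrt hA0
  have h9 : (2 * p * ∑ i, √(B i)) ^ 2 ≤ 4 * p ^ 2 * (3 * ∑ i, B i) := by
    rw [mul_pow]
    calc _ ≤ (2 * (p : ℝ)) ^ 2 * (3 * ∑ i, B i) := by gcongr
      _ = _ := by ring
  nlinarith [sq_nonneg (√A - 2 * p * ∑ i, √(B i))]

/-! ## Fourier coefficients and weak derivatives -/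

/-- The Fourier coefficients of a real function on the torus. -/
def fc (f : Torus3 → ℝ) (n : Fin 3 → ℤ) : ℂ := ∫ x, mFourier (-n) x * (f x : ℂ)

theorem norm_mFourier_apply (n : Fin 3 → ℤ) (x : Torus3) : ‖mFourier n x‖ = 1 := by
  simp only [mFourier, fourier_apply, ContinuousMap.coe_mk, norm_prod, Circle.norm_coe,
    Finset.prod_const_one]

theorem continuous_mFourier (n : Fin 3 → ℤ) : Continuous fun x : Torus3 => mFourier n x :=
  (mFourier n).continuous

theorem integrable_mFourier_mul {f : Torus3 → ℂ} (hf : Integrable f) (n : Fin 3 → ℤ) :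
    Integrable fun x => mFourier n x * f x :=
  hf.bdd_mul (c := 1) (continuous_mFourier n).aestronglyMeasurable
    (Filter.Eventually.of_forall fun x => (norm_mFourier_apply n x).le)

/-- The measure is a variable so that the Haar product measure of the Fourier theory can be
substituted for it; on the circle `volume` equals that Haar measure only by a theorem. -/
theorem parseval_aux (μ : Measure Torus3)
    (hμ : μ = Measure.pi fun _ => (AddCircle.haarAddCircle : Measure UnitAddCircle))
    {f g : Torus3 → ℂ} (hf : MemLp f 2 μ) (hg : MemLp g 2 μ) :
    HasSum (fun n : Fin 3 → ℤ => conj (∫ x, mFourier (-n) x * f x ∂μ) *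
      ∫ x, mFourier (-n) x * g x ∂μ) (∫ x, conj (f x) * g x ∂μ) := by
  subst hμ
  have h := UnitAddTorus.hasSum_prod_mFourierCoeff (d := Fin 3) (hf.toLp f) (hg.toLp g)
  have e1 : ∀ {f : Torus3 → ℂ} (hf : MemLp f 2 (Measure.pi fun _ => AddCircle.haarAddCircle))
      (n : Fin 3 → ℤ), UnitAddTorus.mFourierCoeff (hf.toLp f) n =
      ∫ x, mFourier (-n) x * f x ∂(Measure.pi fun _ => AddCircle.haarAddCircle) := by
    intro f hf n
    refine integral_congr_ae ?_
    filter_upwards [hf.coeFn_toLp] with x hx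
    rw [hx, smul_eq_mul]
  simp only [e1] at h
  convert h using 1
  refine integral_congr_ae ?_
  filter_upwards [hf.coeFn_toLp, hg.coeFn_toLp] with x hx hx'
  rw [hx, hx']

theorem hasSum_conj_fc_mul_fc {f g : Torus3 → ℝ} (hf : MemLp f 2) (hg : MemLp g 2) :
    HasSum (fun n => conj (fc f n) * fc g n) ((∫ x, f x * g x : ℝ) : ℂ) := by
  have h := parseval_aux volume
    (by rw [volume_pi]; simp only [volume_unitAddCircle_eq_haar]) hf.ofReal hg.ofReal
  have e : ∫ x, conj (f x : ℂ) * (g x : ℂ) = ((∫ x, f x * g x : ℝ) : ℂ) := by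
    rw [← integral_complex_ofReal]
    congr 1; funext x; simp
  rw [← e]
  exact h

theorem hasSum_sq_fc {f : Torus3 → ℝ} (hf : MemLp f 2) :
    HasSum (fun n => ‖fc f n‖ ^ 2) (∫ x, f x ^ 2) := by
  have h := hasSum_conj_fc_mul_fc hf hf
  have h2 := Complex.hasSum_re h
  simp only [Complex.ofReal_re] at h2
  convert h2 using 1
  · funext n
    rw [mul_comm, Complex.mul_conj, Complex.ofReal_re, Complex.normSq_eq_norm_sq]
  · congr 1; funext x; ring

theorem mFourier_add_single (n : Fin 3 → ℤ) (y : Torus3) (i : Fin 3) (a : UnitAddCircle) :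
    mFourier n (y + Pi.single i a) = mFourier n y * fourier (n i) a := by
  simp only [mFourier, ContinuousMap.coe_mk, Pi.add_apply, fourier_apply]
  simp only [smul_add, AddCircle.toCircle_add, Circle.coe_mul, Finset.prod_mul_distrib]
  congr 1
  rw [Finset.prod_eq_single i]
  · simp
  · intro b _ hb; simp [hb]
  · simp

theorem hasDerivAt_mFourier (n : Fin 3 → ℤ) (y : Torus3) (i : Fin 3) (s : ℝ) :
    HasDerivAt (fun s : ℝ => mFourier n (y + Pi.single i (s : UnitAddCircle)))
      (2 * Real.pi * Complex.I * n i * mFourier n (y + Pi.single i (s : UnitAddCircle))) s := by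
  simp only [mFourier_add_single]
  have h := (hasDerivAt_fourier 1 (n i) s).const_mul (mFourier n y)
  refine HasDerivAt.congr_deriv h ?_
  rw [Complex.ofReal_one, div_one]
  ring

theorem contDiff_mFourier (n : Fin 3 → ℤ) :
    ContDiff ℝ ∞ fun x : Fin 3 → ℝ => mFourier n (fun i => (x i : UnitAddCircle)) := by
  have e : (fun x : Fin 3 → ℝ => mFourier n (fun i => (x i : UnitAddCircle))) =
      fun x => ∏ i, Complex.exp (2 * Real.pi * Complex.I * n i * x i / (1 : ℝ)) := by
    funext x
    change ∏ i, fourier (n i) (x i : UnitAddCircle) = _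
    exact Finset.prod_congr rfl fun i _ => fourier_coe_apply
  rw [e]
  refine contDiff_prod fun i _ => ContDiff.cexp ?_
  have : ContDiff ℝ ∞ fun x : Fin 3 → ℝ => ((x i : ℝ) : ℂ) :=
    Complex.ofRealCLM.contDiff.comp (contDiff_apply ℝ ℝ i)
  exact (contDiff_const.mul this).div_const _

theorem isSmooth_re_mFourier (n : Fin 3 → ℤ) : IsSmooth fun x => (mFourier n x).re :=
  Complex.reCLM.contDiff.comp (contDiff_mFourier n)

theorem isSmooth_im_mFourier (n : Fin 3 → ℤ) : IsSmooth fun x => (mFourier n x).im :=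
  Complex.imCLM.contDiff.comp (contDiff_mFourier n)

theorem pderiv_re_mFourier (n : Fin 3 → ℤ) (i : Fin 3) (x : Torus3) :
    pderiv i (fun x => (mFourier n x).re) x = -(2 * Real.pi * n i * (mFourier n x).im) := by
  have h := Complex.reCLM.hasFDerivAt.comp_hasDerivAt (0 : ℝ) (hasDerivAt_mFourier n x i 0)
  refine h.deriv.trans ?_
  simp

theorem pderiv_im_mFourier (n : Fin 3 → ℤ) (i : Fin 3) (x : Torus3) :
    pderiv i (fun x => (mFourier n x).im) x = 2 * Real.pi * n i * (mFourier n x).re := by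
  have h := Complex.imCLM.hasFDerivAt.comp_hasDerivAt (0 : ℝ) (hasDerivAt_mFourier n x i 0)
  refine h.deriv.trans ?_
  simp

theorem fc_eq {f : Torus3 → ℝ} (hf : Integrable f) (n : Fin 3 → ℤ) :
    fc f n = ((∫ x, f x * (mFourier (-n) x).re : ℝ) : ℂ) +
      Complex.I * ((∫ x, f x * (mFourier (-n) x).im : ℝ) : ℂ) := by
  have hi := integrable_mFourier_mul hf.ofReal (-n)
  have h := integral_re_add_im hi
  refine Eq.trans (b := _) h.symm ?_
  have e1 : ∀ x, RCLike.re (mFourier (-n) x * (RCLike.ofReal (f x) : ℂ)) = f x * (mFourier (-n) x).re := by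
    intro x; simp [mul_comm]
  have e2 : ∀ x, RCLike.im (mFourier (-n) x * (RCLike.ofReal (f x) : ℂ)) = f x * (mFourier (-n) x).im := by
    intro x; simp [mul_comm]
  simp only [e1, e2]
  simp [mul_comm]

/-- Real and imaginary parts of characters are admissible test functions, and differentiation
exchanges them up to a factor. -/
theorem IsWeakDeriv.fc_eq {i : Fin 3} {f g : Torus3 → ℝ} (h : IsWeakDeriv i f g)
    (n : Fin 3 → ℤ) : fc g n = 2 * Real.pi * Complex.I * n i * fc f n := by
  have h1 := h.2.2 _ (isSmooth_re_mFourier (-n))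
  have h2 := h.2.2 _ (isSmooth_im_mFourier (-n))
  simp only [pderiv_re_mFourier, pderiv_im_mFourier] at h1 h2
  have e1 : ∀ x, f x * -(2 * Real.pi * ((-n) i : ℤ) * (mFourier (-n) x).im) =
      (2 * Real.pi * n i) * (f x * (mFourier (-n) x).im) := by
    intro x; simp; ring
  have e2 : ∀ x, f x * (2 * Real.pi * ((-n) i : ℤ) * (mFourier (-n) x).re) =
      -(2 * Real.pi * n i) * (f x * (mFourier (-n) x).re) := by
    intro x; simp; ring
  simp only [e1, integral_const_mul] at h1
  simp only [e2, integral_const_mul] at h2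
  rw [NSK.fc_eq h.1, NSK.fc_eq h.2.1]
  have h1' : ∫ x, g x * (mFourier (-n) x).re =
      -((2 * Real.pi * n i) * ∫ x, f x * (mFourier (-n) x).im) := by linarith
  have h2' : ∫ x, g x * (mFourier (-n) x).im =
      (2 * Real.pi * n i) * ∫ x, f x * (mFourier (-n) x).re := by linarith
  rw [h1', h2']
  push_cast
  linear_combination (2 * Real.pi * n i * (∫ x, f x * (mFourier (-n) x).im : ℝ) : ℂ) *
    (-Complex.I_sq)

/-! ### Uniqueness of Fourier coefficients and of weak derivatives -/

/-- The positive and negative parts of `f` are densities of two finite measures with the same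
integrals of continuous functions, so these measures agree. -/
theorem ae_eq_zero_of_integral_continuous {f : Torus3 → ℝ} (hf : Integrable f)
    (h : ∀ φ : C(Torus3, ℝ), ∫ x, φ x * f x = 0) : f =ᵐ[volume] 0 := by
  set μ : Measure Torus3 := volume.withDensity fun x => ENNReal.ofReal (f x) with hμ
  set ν : Measure Torus3 := volume.withDensity fun x => ENNReal.ofReal ((-f) x) with hν
  have hμf : IsFiniteMeasure μ := isFiniteMeasure_withDensity_ofReal hf.2
  have hνf : IsFiniteMeasure ν := isFiniteMeasure_withDensity_ofReal hf.neg.2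
  have hpn : ∀ r : ℝ, max r 0 - max (-r) 0 = r := fun r => by
    rcases le_total r 0 with h | h <;> simp [h]
  have heq : μ = ν := by
    refine ext_of_forall_integral_eq_of_IsFiniteMeasure fun φ => ?_
    rw [hμ, hν, integral_withDensity_eq_integral_toReal_smul₀
        hf.aemeasurable.ennreal_ofReal (Filter.Eventually.of_forall fun x => ENNReal.ofReal_lt_top),
      integral_withDensity_eq_integral_toReal_smul₀
        hf.neg.aemeasurable.ennreal_ofReal
        (Filter.Eventually.of_forall fun x => ENNReal.ofReal_lt_top)]
    have hb : ∀ {g : Torus3 → ℝ}, Integrable g → Integrable fun x => φ x * g x := fun hg =>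
      hg.bdd_mul (c := ‖φ‖) φ.continuous.aestronglyMeasurable
        (Filter.Eventually.of_forall fun x => φ.norm_coe_le_norm x)
    have h1 := h φ.toContinuousMap
    have h2 : ∀ x, φ.toContinuousMap x * f x = φ x * max (f x) 0 - φ x * max (-f x) 0 := by
      intro x
      rw [← mul_sub, hpn]; rfl
    simp only [h2] at h1
    rw [integral_sub (hb hf.pos_part) (hb hf.neg_part)] at h1
    simp only [ENNReal.toReal_ofReal', smul_eq_mul, mul_comm _ (φ _), Pi.neg_apply]
    linarith
  have h3 := (withDensity_eq_iff hf.aemeasurable.ennreal_ofReal hf.neg.aemeasurable.ennreal_ofReal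
    (by
      have := hf.lintegral_lt_top
      exact this.ne)).1 heq
  filter_upwards [h3] with x hx
  have h4 := congrArg ENNReal.toReal hx
  rw [ENNReal.toReal_ofReal', ENNReal.toReal_ofReal'] at h4
  have := hpn (f x)
  simp only [Pi.zero_apply]
  rw [h4] at this
  simpa using this.symm

/-- For integrable `f` the pairing is continuous in the sup norm, so its kernel is closed; it
contains the characters, whose span is dense. -/
theorem integral_continuous_mul_eq_zero {f : Torus3 → ℂ} (hf : Integrable f)
    (h : ∀ n, ∫ x, mFourier (-n) x * f x = 0) (φ : C(Torus3, ℂ)) :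
    ∫ x, φ x * f x = 0 := by
  have hint : ∀ φ : C(Torus3, ℂ), Integrable fun x => φ x * f x := fun φ =>
    hf.bdd_mul (c := ‖φ‖) φ.continuous.aestronglyMeasurable
      (Filter.Eventually.of_forall fun x => φ.norm_coe_le_norm x)
  let L : C(Torus3, ℂ) →ₗ[ℂ] ℂ :=
    { toFun := fun φ => ∫ x, φ x * f x
      map_add' := fun φ ψ => by
        simp only [ContinuousMap.add_apply, add_mul]
        exact integral_add (hint φ) (hint ψ)
      map_smul' := fun c φ => by
        simp only [ContinuousMap.smul_apply, smul_eq_mul, mul_assoc, RingHom.id_apply]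
        exact integral_const_mul c _ }
  let Lc : C(Torus3, ℂ) →L[ℂ] ℂ := L.mkContinuous (∫ x, ‖f x‖) fun φ => by
    refine (norm_integral_le_integral_norm _).trans ?_
    rw [← integral_mul_const]
    refine integral_mono (hint φ).norm (hf.norm.mul_const _) fun x => ?_
    simp only [norm_mul]
    rw [mul_comm]
    gcongr
    exact φ.norm_coe_le_norm x
  have hker : (Submodule.span ℂ (range (mFourier (d := Fin 3)))).topologicalClosure ≤
      LinearMap.ker Lc.toLinearMap := by
    refine Submodule.topologicalClosure_minimal _ (Submodule.span_le.2 ?_) Lc.isClosed_ker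
    rintro _ ⟨n, rfl⟩
    have := h (-n)
    rw [neg_neg] at this
    exact this
  rw [UnitAddTorus.span_mFourier_closure_eq_top] at hker
  exact hker (Submodule.mem_top (x := φ))

theorem ae_eq_zero_of_fourier {f : Torus3 → ℂ} (hf : Integrable f)
    (h : ∀ n, ∫ x, mFourier (-n) x * f x = 0) : f =ᵐ[volume] 0 := by
  have key : ∀ φ : C(Torus3, ℝ), ∫ x, (φ x : ℂ) * f x = 0 := fun φ =>
    integral_continuous_mul_eq_zero hf h
      ⟨fun x => (φ x : ℂ), Complex.continuous_ofReal.comp φ.continuous⟩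
  have hint : ∀ φ : C(Torus3, ℝ), Integrable fun x => (φ x : ℂ) * f x := fun φ =>
    hf.bdd_mul (c := ‖φ‖) (Complex.continuous_ofReal.comp φ.continuous).aestronglyMeasurable
      (Filter.Eventually.of_forall fun x => by
        simpa using φ.norm_coe_le_norm x)
  have h1 := ae_eq_zero_of_integral_continuous hf.re fun φ => by
    have := integral_re (hint φ)
    rw [key φ] at this
    simpa using this
  have h2 := ae_eq_zero_of_integral_continuous hf.im fun φ => by
    have := integral_im (hint φ)
    rw [key φ] at this
    simpa using this
  filter_upwards [h1, h2] with x hx hx'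
  exact Complex.ext hx hx'

theorem ae_eq_of_fc_eq {f g : Torus3 → ℝ} (hf : Integrable f) (hg : Integrable g)
    (h : ∀ n, fc f n = fc g n) : f =ᵐ[volume] g := by
  have h1 := ae_eq_zero_of_fourier (hf.ofReal (𝕜 := ℂ) |>.sub (hg.ofReal (𝕜 := ℂ))) fun n => by
    have := h n
    rw [fc, fc] at this
    simp only [Pi.sub_apply, mul_sub]
    rw [integral_sub (integrable_mFourier_mul hf.ofReal _) (integrable_mFourier_mul hg.ofReal _)]
    exact sub_eq_zero.2 this
  filter_upwards [h1] with x hx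
  have h2 : ((f x : ℝ) : ℂ) - (g x : ℂ) = 0 := hx
  exact_mod_cast sub_eq_zero.1 h2

/-- This makes `wderiv`, a chosen witness, computable: any explicit weak derivative of an a.e. equal
function may replace it. -/
theorem IsWeakDeriv.unique {i : Fin 3} {f f₂ g g₂ : Torus3 → ℝ} (h : IsWeakDeriv i f g)
    (h₂ : IsWeakDeriv i f₂ g₂) (hf : f =ᵐ[volume] f₂) : g =ᵐ[volume] g₂ := by
  refine ae_eq_of_fc_eq h.2.1 h₂.2.1 fun n => ?_
  rw [h.fc_eq, h₂.fc_eq]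
  congr 1
  refine integral_congr_ae ?_
  filter_upwards [hf] with x hx
  rw [hx]

theorem IsWeakDeriv.congr {i : Fin 3} {f f₂ g g₂ : Torus3 → ℝ} (h : IsWeakDeriv i f g)
    (hf : f =ᵐ[volume] f₂) (hg : g =ᵐ[volume] g₂) : IsWeakDeriv i f₂ g₂ := by
  refine ⟨h.1.congr hf, h.2.1.congr hg, fun φ hφ => ?_⟩
  have e1 : ∫ x, f x * pderiv i φ x = ∫ x, f₂ x * pderiv i φ x :=
    integral_congr_ae (by filter_upwards [hf] with x hx; rw [hx])
  have e2 : ∫ x, g x * φ x = ∫ x, g₂ x * φ x :=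
    integral_congr_ae (by filter_upwards [hg] with x hx; rw [hx])
  rw [← e1, ← e2]
  exact h.2.2 φ hφ

theorem HasWeakDeriv.wderiv {i : Fin 3} {f : Torus3 → ℝ} (h : HasWeakDeriv i f) :
    IsWeakDeriv i f (wderiv i f) := by
  rw [NSK.wderiv, dif_pos h]; exact h.choose_spec

theorem IsWeakDeriv.wderiv_ae_eq {i : Fin 3} {f f₂ g : Torus3 → ℝ} (h : IsWeakDeriv i f g)
    (hf : f₂ =ᵐ[volume] f) : NSK.wderiv i f₂ =ᵐ[volume] g :=
  (HasWeakDeriv.wderiv ⟨g, h.congr hf.symm Filter.EventuallyEq.rfl⟩).unique h hf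

theorem IsWeakDeriv.sub {i : Fin 3} {f f₂ g g₂ : Torus3 → ℝ} (h : IsWeakDeriv i f g)
    (h₂ : IsWeakDeriv i f₂ g₂) : IsWeakDeriv i (f - f₂) (g - g₂) := by
  refine ⟨h.1.sub h₂.1, h.2.1.sub h₂.2.1, fun φ hφ => ?_⟩
  have hb : ∀ {a b : Torus3 → ℝ}, Integrable a → Continuous b → Integrable fun x => a x * b x := by
    intro a b ha hb
    obtain ⟨C, -, hC⟩ := exists_bound_of_continuous hb
    exact ha.mul_bdd (c := C) hb.aestronglyMeasurable (Filter.Eventually.of_forall hC)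
  have hc := hφ.hasGrad
  simp only [Pi.sub_apply, sub_mul]
  rw [integral_sub (hb h.1 (hc.cont' i)) (hb h₂.1 (hc.cont' i)), integral_sub (hb h.2.1 hc.cont)
    (hb h₂.2.1 hc.cont), h.2.2 φ hφ, h₂.2.2 φ hφ]
  ring

theorem _root_.Continuous.memLp_torus {f : Torus3 → ℝ} (hf : Continuous f) (p : ℝ≥0∞) :
    MemLp f p :=
  hf.memLp_of_hasCompactSupport (HasCompactSupport.of_compactSpace _)

/-- Integration by parts of an `H¹` function against a `C¹` function. -/
theorem IsWeakDeriv.integral_mul_hasGrad {i : Fin 3} {f g ψ : Torus3 → ℝ}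
    {ψ' : Fin 3 → Torus3 → ℝ} (h : IsWeakDeriv i f g) (hf : MemLp f 2) (hg : MemLp g 2)
    (hψ : HasGrad ψ ψ') : ∫ x, f x * ψ' i x = - ∫ x, g x * ψ x := by
  -- Parseval replaces a mollification of `ψ`: the imaginary multiplier $2\pi i n_i$ changes sign
  -- when it moves across the conjugation.
  have h1 := hasSum_conj_fc_mul_fc hf ((hψ.cont' i).memLp_torus 2)
  have h2 := (hasSum_conj_fc_mul_fc hg (hψ.cont.memLp_torus 2)).neg
  have h3 : ∀ n, conj (fc f n) * fc (ψ' i) n = -(conj (fc g n) * fc ψ n) := by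
    intro n
    rw [h.fc_eq, (hψ.isWeakDeriv i).fc_eq]
    simp only [map_mul, Complex.conj_ofReal, Complex.conj_I, Complex.conj_ofNat, map_intCast]
    ring
  simp only [h3] at h1
  have := h1.unique h2
  exact_mod_cast this

/-! ## The continuous representative of an `H²` function -/

theorem summable_int_one_add_sq_rpow :
    Summable fun n : ℤ => (1 + (n : ℝ) ^ 2) ^ (-(2 / 3) : ℝ) := by
  refine Summable.of_norm_bounded_eventually
    (Real.summable_abs_int_rpow (b := 4 / 3) (by norm_num)) ?_
  refine (Set.finite_singleton (0 : ℤ)).subset fun n hn => ?_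
  by_contra h0
  refine hn ?_
  have hn0 : (0 : ℝ) < |(n : ℝ)| := abs_pos.2 (by exact_mod_cast h0)
  change ‖(1 + (n : ℝ) ^ 2) ^ (-(2 / 3) : ℝ)‖ ≤ |(n : ℝ)| ^ (-(4 / 3) : ℝ)
  rw [Real.norm_of_nonneg (by positivity)]
  have e : |(n : ℝ)| ^ (-(4 / 3) : ℝ) = (|(n : ℝ)| ^ 2) ^ (-(2 / 3) : ℝ) := by
    rw [← Real.rpow_natCast, ← Real.rpow_mul hn0.le]; norm_num
  rw [e, sq_abs]
  refine Real.rpow_le_rpow_of_nonpos ?_ (by linarith) (by norm_num)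
  rw [← sq_abs]; positivity

/-- In dimension three $(1+|n|^2)^{-2}$ splits into three powers $-2/3$, each bounded by a function
of one coordinate that decays like $|n_i|^{-4/3}$. -/
theorem summable_weight :
    Summable fun n : Fin 3 → ℤ => ((1 + ∑ i, (n i : ℝ) ^ 2)⁻¹) ^ 2 := by
  set a : ℤ → ℝ := fun n => (1 + (n : ℝ) ^ 2) ^ (-(2 / 3) : ℝ) with ha
  have ha0 : ∀ n, 0 ≤ a n := fun n => by positivity
  have hs := summable_int_one_add_sq_rpow
  have h3 := (hs.mul_of_nonneg (hs.mul_of_nonneg hs ha0 ha0) ha0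
    fun x => mul_nonneg (ha0 _) (ha0 _)).comp_injective
    (i := fun n : Fin 3 → ℤ => (n 0, n 1, n 2)) (by
      intro m n h
      simp only [Prod.mk.injEq] at h
      funext i
      fin_cases i
      · exact h.1
      · exact h.2.1
      · exact h.2.2)
  refine Summable.of_nonneg_of_le (fun n => by positivity) (fun n => ?_) h3
  simp only [Function.comp]
  set W := 1 + ∑ i, (n i : ℝ) ^ 2 with hW
  have hW1 : 0 < W := by positivity
  have hle : ∀ i, W ^ (-(2 / 3) : ℝ) ≤ a (n i) := fun i => by
    refine Real.rpow_le_rpow_of_nonpos (by positivity) ?_ (by norm_num)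
    rw [hW]
    gcongr
    exact Finset.single_le_sum (f := fun i => (n i : ℝ) ^ 2) (fun j _ => sq_nonneg _)
      (Finset.mem_univ i)
  have e : (W⁻¹) ^ 2 = W ^ (-(2 / 3) : ℝ) * (W ^ (-(2 / 3) : ℝ) * W ^ (-(2 / 3) : ℝ)) := by
    rw [← Real.rpow_add hW1, ← Real.rpow_add hW1, ← Real.rpow_neg_one, ← Real.rpow_natCast,
      ← Real.rpow_mul hW1.le]
    norm_num
  rw [e]
  have hp : 0 ≤ W ^ (-(2 / 3) : ℝ) := by positivity
  exact mul_le_mul (hle 0) (mul_le_mul (hle 1) (hle 2) hp (ha0 _)) (mul_nonneg hp hp) (ha0 _)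

theorem summable_weight_mul {f : Torus3 → ℝ} (hf : MemLp f 2) :
    Summable (fun n : Fin 3 → ℤ => (1 + ∑ i, (n i : ℝ) ^ 2)⁻¹ * ‖fc f n‖) ∧
    ∑' n : Fin 3 → ℤ, (1 + ∑ i, (n i : ℝ) ^ 2)⁻¹ * ‖fc f n‖ ≤
      √(∑' n : Fin 3 → ℤ, ((1 + ∑ i, (n i : ℝ) ^ 2)⁻¹) ^ 2) * √(∫ x, f x ^ 2) := by
  have h1 := hasSum_sq_fc hf
  have h := Real.summable_and_inner_le_Lp_mul_Lq_tsum_of_nonneg (p := 2) (q := 2)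
    (by rw [Real.holderConjugate_iff]; norm_num)
    (f := fun n : Fin 3 → ℤ => (1 + ∑ i, (n i : ℝ) ^ 2)⁻¹) (g := fun n => ‖fc f n‖)
    (fun n => by positivity) (fun n => norm_nonneg _)
    (by simpa only [Real.rpow_two] using summable_weight)
    (by simpa only [Real.rpow_two] using h1.summable)
  simp only [Real.rpow_two, ← Real.sqrt_eq_rpow, h1.tsum_eq] at h
  exact h

/-- `H²(𝕋³)` functions have absolutely summable Fourier coefficients. -/
theorem exists_tsum_fc_le : ∃ C : ℝ, 0 ≤ C ∧ ∀ (f : Torus3 → ℝ) (f₁ f₂ : Fin 3 → Torus3 → ℝ),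
    MemLp f 2 → (∀ i, IsWeakDeriv i f (f₁ i)) → (∀ i, IsWeakDeriv i (f₁ i) (f₂ i)) →
    (∀ i, MemLp (f₂ i) 2) → Summable (fun n => ‖fc f n‖) ∧
      ∑' n, ‖fc f n‖ ≤ C * (√(∫ x, f x ^ 2) + ∑ i, √(∫ x, f₂ i x ^ 2)) := by
  refine ⟨√(∑' n : Fin 3 → ℤ, ((1 + ∑ i, (n i : ℝ) ^ 2)⁻¹) ^ 2), Real.sqrt_nonneg _, ?_⟩
  intro f f₁ f₂ hf h1 h2 hf2
  set w : (Fin 3 → ℤ) → ℝ := fun n => (1 + ∑ i, (n i : ℝ) ^ 2) with hw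
  have hw0 : ∀ n, 0 < w n := fun n => by positivity
  -- Pure second derivatives suffice, since $|n|^2=\sum_i n_i^2$. Cauchy–Schwarz against the
  -- square-summable weight then gives absolute summability.
  have key : ∀ n, ‖fc f n‖ ≤ (w n)⁻¹ * ‖fc f n‖ + ∑ i, (w n)⁻¹ * ‖fc (f₂ i) n‖ := by
    intro n
    have e : ∀ i, (n i : ℝ) ^ 2 * ‖fc f n‖ ≤ ‖fc (f₂ i) n‖ := by
      intro i
      rw [(h2 i).fc_eq, (h1 i).fc_eq]
      simp only [norm_mul, Complex.norm_I, Complex.norm_real, Complex.norm_intCast,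
        Complex.norm_ofNat, Real.norm_eq_abs, abs_of_pos Real.pi_pos, mul_one]
      have hpi : (1 : ℝ) ≤ (2 * Real.pi) ^ 2 := by nlinarith [Real.pi_gt_three]
      have h3 : 0 ≤ |(n i : ℝ)| ^ 2 * ‖fc f n‖ := by positivity
      rw [← sq_abs]
      nlinarith
    rw [← Finset.mul_sum, ← mul_add, inv_mul_eq_div, le_div_iff₀ (hw0 n)]
    simp only [hw]
    rw [mul_comm, add_mul, one_mul, Finset.sum_mul]
    gcongr with i
    exact e i
  have hs := summable_weight_mul hf
  have hs2 := fun i => summable_weight_mul (hf2 i)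
  have hs3 : Summable fun n => ∑ i, (w n)⁻¹ * ‖fc (f₂ i) n‖ :=
    summable_sum fun i _ => (hs2 i).1
  have hsum : Summable fun n => ‖fc f n‖ :=
    Summable.of_nonneg_of_le (fun n => norm_nonneg _) key (hs.1.add hs3)
  refine ⟨hsum, (hsum.tsum_le_tsum key (hs.1.add hs3)).trans ?_⟩
  rw [hs.1.tsum_add hs3, Summable.tsum_finsetSum fun i _ => (hs2 i).1, mul_add, Finset.mul_sum]
  exact add_le_add hs.2 (Finset.sum_le_sum fun i _ => (hs2 i).2)

/-- The sum of the Fourier series of `f`. -/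
def rep (f : Torus3 → ℝ) (x : Torus3) : ℝ := (∑' n, fc f n * mFourier n x).re

section rep

variable {f : Torus3 → ℝ}

theorem summable_fc_mul (hs : Summable fun n => ‖fc f n‖) (x : Torus3) :
    Summable fun n => fc f n * mFourier n x :=
  Summable.of_norm (by simpa only [norm_mul, norm_mFourier_apply, mul_one] using hs)

theorem continuous_fourierSeries (hs : Summable fun n => ‖fc f n‖) :
    Continuous fun x : Torus3 => ∑' n, fc f n * mFourier n x :=
  continuous_tsum (fun n => continuous_const.mul (continuous_mFourier n)) hs
    fun n x => by simp [norm_mFourier_apply]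

theorem continuous_rep (hs : Summable fun n => ‖fc f n‖) : Continuous (rep f) :=
  Complex.continuous_re.comp (continuous_fourierSeries hs)

theorem abs_rep_le (hs : Summable fun n => ‖fc f n‖) (x : Torus3) :
    |rep f x| ≤ ∑' n, ‖fc f n‖ := by
  refine (Complex.abs_re_le_norm _).trans ((norm_tsum_le_tsum_norm ?_).trans_eq ?_)
  · simpa only [norm_mul, norm_mFourier_apply, mul_one] using hs
  · simp only [norm_mul, norm_mFourier_apply, mul_one]

theorem integral_mFourier_mul_mFourier (m n : Fin 3 → ℤ) :
    ∫ x : Torus3, mFourier (-m) x * mFourier n x = if m = n then 1 else 0 := by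
  have e1 : ∀ x : Torus3, mFourier (-m) x * mFourier n x = mFourier (-(m - n)) x * ((1 : ℝ) : ℂ) := by
    intro x
    rw [← UnitAddTorus.mFourier_add, neg_sub, Complex.ofReal_one, mul_one, neg_add_eq_sub]
  simp only [e1]
  split_ifs with h
  · subst h
    simp [UnitAddTorus.mFourier_zero]
  · obtain ⟨i, hi⟩ := Function.ne_iff.1 (sub_ne_zero.2 h)
    have h1 := ((HasGrad.const 1).isWeakDeriv i).fc_eq (m - n)
    have h2 : fc (fun _ => 0) (m - n) = 0 := by simp [fc]
    rw [h2] at h1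
    have h3 : (2 * Real.pi * Complex.I * ((m - n) i : ℤ) : ℂ) ≠ 0 := by
      have : (((m - n) i : ℤ) : ℂ) ≠ 0 := Int.cast_ne_zero.2 hi
      simp only [ne_eq, mul_eq_zero, this, or_false]
      simp [Real.pi_ne_zero]
    exact (mul_eq_zero.1 h1.symm).resolve_left h3

/-- Integrating the absolutely convergent series termwise shows that it has the Fourier coefficients
of `f`. -/
theorem ae_eq_rep (hf : Integrable f) (hs : Summable fun n => ‖fc f n‖) :
    f =ᵐ[volume] rep f := by
  have hc := continuous_fourierSeries hs
  have h1 := ae_eq_zero_of_fourier (hf.ofReal (𝕜 := ℂ) |>.sub hc.integrable_torus) fun m => by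
    simp only [Pi.sub_apply, mul_sub]
    rw [integral_sub (integrable_mFourier_mul hf.ofReal _)
      (integrable_mFourier_mul hc.integrable_torus _)]
    have e1 : ∀ x : Torus3, mFourier (-m) x * ∑' n, fc f n * mFourier n x =
        ∑' n, mFourier (-m) x * (fc f n * mFourier n x) := fun x => tsum_mul_left.symm
    simp only [e1]
    have h2 := hasSum_integral_of_summable_integral_norm (μ := (volume : Measure Torus3))
      (F := fun n x => mFourier (-m) x * (fc f n * mFourier n x)) (fun n => Continuous.integrable_torus
        ((continuous_mFourier _).mul (continuous_const.mul (continuous_mFourier n)))) (by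
      simpa only [norm_mul, norm_mFourier_apply, one_mul, mul_one, integral_const, probReal_univ,
        one_smul] using hs)
    rw [← h2.tsum_eq]
    have e2 : ∀ n, ∫ x : Torus3, mFourier (-m) x * (fc f n * mFourier n x) =
        if n = m then fc f m else 0 := by
      intro n
      have e3 : ∀ x : Torus3, mFourier (-m) x * (fc f n * mFourier n x) =
        fc f n * (mFourier (-m) x * mFourier n x) := fun x => by ring
      simp only [e3]
      rw [integral_const_mul, integral_mFourier_mul_mFourier]
      by_cases h : n = m
      · simp [h]
      · simp [h, Ne.symm h]
    simp only [e2]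
    rw [tsum_ite_eq]
    exact sub_self _
  filter_upwards [h1] with x hx
  have h2 : ((f x : ℝ) : ℂ) - ∑' n, fc f n * mFourier n x = 0 := hx
  rw [rep, ← sub_eq_zero.1 h2, Complex.ofReal_re]

theorem hasDerivAt_re {F : ℝ → ℂ} {F' : ℂ} {s : ℝ} (h : HasDerivAt F F' s) :
    HasDerivAt (fun s => (F s).re) F'.re s :=
  Complex.reCLM.hasFDerivAt.comp_hasDerivAt s h

theorem hasGrad_rep {f₁ : Fin 3 → Torus3 → ℝ} (hs : Summable fun n => ‖fc f n‖)
    (hs₁ : ∀ i, Summable fun n => ‖fc (f₁ i) n‖) (h : ∀ i, IsWeakDeriv i f (f₁ i)) :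
    HasGrad (rep f) fun i => rep (f₁ i) := by
  refine ⟨continuous_rep hs, fun i => continuous_rep (hs₁ i), fun i y => ?_⟩
  have hg : ∀ n (s : ℝ), HasDerivAt
      (fun s : ℝ => fc f n * mFourier n (y + Pi.single i (s : UnitAddCircle)))
      (fc (f₁ i) n * mFourier n (y + Pi.single i (s : UnitAddCircle))) s := fun n s => by
    refine HasDerivAt.congr_deriv ((hasDerivAt_mFourier n y i s).const_mul (fc f n)) ?_
    rw [(h i).fc_eq]; ring
  have hg' : ∀ n (s : ℝ), ‖fc (f₁ i) n * mFourier n (y + Pi.single i (s : UnitAddCircle))‖ ≤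
      ‖fc (f₁ i) n‖ := fun n s => by rw [norm_mul, norm_mFourier_apply, mul_one]
  have hd : HasDerivAt
      (fun s : ℝ => ∑' n, fc f n * mFourier n (y + Pi.single i (s : UnitAddCircle)))
      (∑' n, fc (f₁ i) n * mFourier n (y + Pi.single i ((0 : ℝ) : UnitAddCircle))) 0 :=
    hasDerivAt_tsum (hs₁ i) hg hg' (y₀ := 0) (summable_fc_mul hs _) 0
  have h2 := hasDerivAt_re hd
  rw [AddCircle.coe_zero, Pi.single_zero, add_zero] at h2
  exact h2

end rep

/-- Product rule for an `H¹` function and a `C¹` function. -/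
theorem IsWeakDeriv.mul_hasGrad {i : Fin 3} {f g ψ : Torus3 → ℝ}
    {ψ' : Fin 3 → Torus3 → ℝ} (h : IsWeakDeriv i f g) (hf : MemLp f 2) (hg : MemLp g 2)
    (hψ : HasGrad ψ ψ') :
    IsWeakDeriv i (fun x => ψ x * f x) (fun x => ψ x * g x + ψ' i x * f x) := by
  have hb : ∀ {a b : Torus3 → ℝ}, Continuous a → Integrable b → Integrable fun x => a x * b x := by
    intro a b ha hb
    obtain ⟨C, -, hC⟩ := exists_bound_of_continuous ha
    exact hb.bdd_mul (c := C) ha.aestronglyMeasurable (Filter.Eventually.of_forall hC)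
  refine ⟨hb hψ.cont h.1, (hb hψ.cont h.2.1).add (hb (hψ.cont' i) h.1), fun φ hφ => ?_⟩
  have hφ' := hφ.hasGrad
  have h1 := h.integral_mul_hasGrad hf hg (hψ.mul hφ')
  have hc1 : Continuous fun x => ψ' i x * φ x := (hψ.cont' i).mul hφ'.cont
  have hc2 : Continuous fun x => ψ x * pderiv i φ x := hψ.cont.mul (hφ'.cont' i)
  have e1 : ∀ x, f x * (ψ' i x * φ x + ψ x * pderiv i φ x) =
      ψ' i x * φ x * f x + ψ x * pderiv i φ x * f x := fun x => by ring
  simp only [e1] at h1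
  rw [integral_add (hb hc1 h.1) (hb hc2 h.1)] at h1
  have e2 : ∀ x, (ψ x * g x + ψ' i x * f x) * φ x = g x * (ψ x * φ x) + ψ' i x * φ x * f x :=
    fun x => by ring
  have e3 : ∀ x, ψ x * f x * pderiv i φ x = ψ x * pderiv i φ x * f x := fun x => by ring
  simp only [e2, e3]
  have h3 : Integrable fun x => g x * (ψ x * φ x) := by
    have h4 := hb (a := fun x => ψ x * φ x) (hψ.cont.mul hφ'.cont) h.2.1
    exact h4.congr (Filter.Eventually.of_forall fun x => mul_comm _ _)
  rw [integral_add h3 (hb hc1 h.1)]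
  linarith

/-! ## Differentiating integrals along regular curves -/

/-- A curve of functions on the torus that is bounded, continuous in the uniform norm, Lipschitz
continuous in `L¹`, and a.e. differentiable in `L¹` with derivative `G`. -/
structure RegularCurve {V : Type*} [NormedAddCommGroup V] [NormedSpace ℝ V] (T : ℝ)
    (F G : ℝ → Torus3 → V) : Prop where
  aesm : ∀ t ∈ Icc 0 T, AEStronglyMeasurable (F t) volume
  bdd : ∃ K, ∀ t ∈ Icc 0 T, ∀ᵐ x, ‖F t x‖ ≤ K
  unif : ∀ t ∈ Icc 0 T, ∀ ε > 0, ∃ δ > 0, ∀ s ∈ Icc 0 T, |s - t| < δ →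
    ∀ᵐ x, ‖F s x - F t x‖ ≤ ε
  lip : ∃ L, 0 ≤ L ∧ ∀ s ∈ Icc 0 T, ∀ t ∈ Icc 0 T, ∫ x, ‖F t x - F s x‖ ≤ L * |t - s|
  deriv : ∀ᵐ t ∂(volume.restrict (Ioo 0 T)), Integrable (G t) ∧ ∀ ε > 0, ∃ δ > 0,
    ∀ s ∈ Icc 0 T, |s - t| < δ → ∫ x, ‖F s x - F t x - (s - t) • G t x‖ ≤ ε * |s - t|

namespace RegularCurve

variable {V : Type*} [NormedAddCommGroup V] [NormedSpace ℝ V] {T : ℝ} {F G : ℝ → Torus3 → V}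

theorem integrable (hF : RegularCurve T F G) {t : ℝ} (ht : t ∈ Icc 0 T) : Integrable (F t) := by
  obtain ⟨K, hK⟩ := hF.bdd
  exact Integrable.of_bound (hF.aesm t ht) K (hK t ht)

theorem integrable_comp (hF : RegularCurve T F G) [FiniteDimensional ℝ V] {H : V → ℝ}
    (hH : Continuous H) {t : ℝ} (ht : t ∈ Icc 0 T) : Integrable fun x => H (F t x) := by
  obtain ⟨K, hK⟩ := hF.bdd
  have : ProperSpace V := FiniteDimensional.proper ℝ V
  obtain ⟨C, hC⟩ := (isCompact_closedBall (0 : V) K).exists_bound_of_continuousOn hH.continuousOn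
  refine Integrable.of_bound (hH.comp_aestronglyMeasurable (hF.aesm t ht)) C ?_
  filter_upwards [hK t ht] with x hx
  exact hC _ (by simpa using hx)

/-- A chain rule for curves differentiable only in $L^1$: uniform smallness of the increment makes
the Taylor remainder at most $\varepsilon$ times the increment, and the Lipschitz bound in $L^1$
makes its integral $o(|s-t|)$. -/
theorem integral_comp (hF : RegularCurve T F G) [FiniteDimensional ℝ V] {H : V → ℝ}
    (hH : ContDiff ℝ 1 H) :
    (∃ L, 0 ≤ L ∧ ∀ s ∈ Icc 0 T, ∀ t ∈ Icc 0 T,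
      |(∫ x, H (F t x)) - ∫ x, H (F s x)| ≤ L * |t - s|) ∧
    ∀ᵐ t ∂(volume.restrict (Ioo 0 T)),
      HasDerivAt (fun t => ∫ x, H (F t x)) (∫ x, fderiv ℝ H (F t x) (G t x)) t := by
  have : ProperSpace V := FiniteDimensional.proper ℝ V
  obtain ⟨K, hK⟩ := hF.bdd
  obtain ⟨L, hL0, hL⟩ := hF.lip
  have hcd : Continuous (fderiv ℝ H) := hH.continuous_fderiv one_ne_zero
  have hdiff : ∀ x, DifferentiableAt ℝ H x := fun x => hH.differentiable one_ne_zero x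
  have hcpt := isCompact_closedBall (0 : V) K
  have hconv := convex_closedBall (0 : V) K
  obtain ⟨M₀, hM₀⟩ := hcpt.exists_bound_of_continuousOn hcd.continuousOn
  set M := |M₀| with hMdef
  have hM : ∀ a ∈ Metric.closedBall (0 : V) K, ‖fderiv ℝ H a‖ ≤ M :=
    fun a ha => (hM₀ a ha).trans (le_abs_self _)
  have hM0 : 0 ≤ M := abs_nonneg _
  have hball : ∀ t ∈ Icc 0 T, ∀ᵐ x, F t x ∈ Metric.closedBall (0 : V) K := fun t ht => by
    filter_upwards [hK t ht] with x hx
    simpa using hx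
  constructor
  · refine ⟨M * L, mul_nonneg hM0 hL0, fun s hs t ht => ?_⟩
    rw [← integral_sub (hF.integrable_comp hH.continuous ht) (hF.integrable_comp hH.continuous hs)]
    refine abs_integral_le_integral_abs.trans ?_
    calc ∫ x, |H (F t x) - H (F s x)| ≤ ∫ x, M * ‖F t x - F s x‖ := by
          refine integral_mono_ae ((hF.integrable_comp hH.continuous ht).sub
            (hF.integrable_comp hH.continuous hs)).abs
            (((hF.integrable ht).sub (hF.integrable hs)).norm.const_mul M) ?_
          filter_upwards [hball t ht, hball s hs] with x hx hx'
          exact hconv.norm_image_sub_le_of_norm_fderiv_le (fun a _ => hdiff a) hM hx' hx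
      _ ≤ M * L * |t - s| := by
          rw [integral_const_mul, mul_assoc]
          exact mul_le_mul_of_nonneg_left (hL s hs t ht) hM0
  · filter_upwards [hF.deriv, ae_restrict_mem measurableSet_Ioo] with t ht htI
    obtain ⟨hGi, htd⟩ := ht
    have htI' : t ∈ Icc 0 T := Ioo_subset_Icc_self htI
    have hDG : Integrable fun x => fderiv ℝ H (F t x) (G t x) := by
      refine (hGi.norm.const_mul M).mono' ?_ ?_
      · have hc : Continuous fun p : V × V => fderiv ℝ H p.1 p.2 :=
          (hcd.comp continuous_fst).clm_apply continuous_snd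
        exact hc.comp_aestronglyMeasurable ((hF.aesm t htI').prodMk hGi.aestronglyMeasurable)
      · filter_upwards [hball t htI'] with x hx
        exact (ContinuousLinearMap.le_opNorm _ _).trans
          (mul_le_mul_of_nonneg_right (hM _ hx) (norm_nonneg _))
    rw [hasDerivAt_iff_isLittleO, Asymptotics.isLittleO_iff]
    intro c hc
    -- The Taylor remainder costs $\varepsilon L|s-t|$ and the $L^1$ derivative error costs
    -- $M\varepsilon|s-t|$, where `M` bounds the derivative of `H` on the ball containing the
    -- values.
    set ε := c / (L + M + 1) with hε
    have hε0 : 0 < ε := by positivity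
    obtain ⟨η, hη0, hη⟩ := Metric.uniformContinuousOn_iff.1
      (hcpt.uniformContinuousOn_of_continuous hcd.continuousOn) ε hε0
    obtain ⟨δ₁, hδ₁, h1⟩ := hF.unif t htI' (η / 2) (by positivity)
    obtain ⟨δ₂, hδ₂, h2⟩ := htd ε hε0
    filter_upwards [Icc_mem_nhds htI.1 htI.2, Metric.ball_mem_nhds t hδ₁,
      Metric.ball_mem_nhds t hδ₂] with s hs hs1 hs2
    rw [Metric.mem_ball, Real.dist_eq] at hs1 hs2
    have hHs := hF.integrable_comp hH.continuous hs
    have hHt := hF.integrable_comp hH.continuous htI'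
    have hdF := (hF.integrable hs).sub (hF.integrable htI')
    have hR := hdF.sub (hGi.smul (s - t))
    have hHd : Integrable fun x => H (F s x) - H (F t x) := hHs.sub hHt
    rw [smul_eq_mul, ← integral_const_mul, ← integral_sub hHs hHt,
      ← integral_sub hHd (hDG.const_mul _)]
    refine (norm_integral_le_integral_norm _).trans ?_
    have hpt : ∀ᵐ x, ‖H (F s x) - H (F t x) - (s - t) * fderiv ℝ H (F t x) (G t x)‖ ≤
        ε * ‖F s x - F t x‖ + M * ‖F s x - F t x - (s - t) • G t x‖ := by
      filter_upwards [hball t htI', hball s hs, h1 s hs hs1] with x hx hx' hx1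
      have e1 : ‖H (F s x) - H (F t x) - fderiv ℝ H (F t x) (F s x - F t x)‖ ≤
          ε * ‖F s x - F t x‖ := by
        refine (hconv.inter (convex_closedBall (F t x) (η / 2))).norm_image_sub_le_of_norm_fderiv_le'
          (fun a _ => hdiff a) (fun a ha => ?_) ⟨hx, Metric.mem_closedBall_self (by positivity)⟩
          ⟨hx', by rw [Metric.mem_closedBall, dist_eq_norm]; exact hx1⟩
        have := hη a ha.1 _ hx (lt_of_le_of_lt ha.2 (by linarith))
        rw [dist_eq_norm] at this
        exact this.le
      have e2 : ‖fderiv ℝ H (F t x) (F s x - F t x - (s - t) • G t x)‖ ≤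
          M * ‖F s x - F t x - (s - t) • G t x‖ :=
        (ContinuousLinearMap.le_opNorm _ _).trans
          (mul_le_mul_of_nonneg_right (hM _ hx) (norm_nonneg _))
      have e3 : H (F s x) - H (F t x) - (s - t) * fderiv ℝ H (F t x) (G t x) =
          (H (F s x) - H (F t x) - fderiv ℝ H (F t x) (F s x - F t x)) +
          fderiv ℝ H (F t x) (F s x - F t x - (s - t) • G t x) := by
        rw [map_sub _ (F s x - F t x), map_smul, smul_eq_mul]; ring
      rw [e3]
      exact (norm_add_le _ _).trans (add_le_add e1 e2)
    refine (integral_mono_ae (hHd.sub (hDG.const_mul _)).norm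
      ((hdF.norm.const_mul ε).add (hR.norm.const_mul M)) hpt).trans ?_
    have e4 : ∫ x, (ε * ‖F s x - F t x‖ + M * ‖F s x - F t x - (s - t) • G t x‖) =
        ε * (∫ x, ‖F s x - F t x‖) + M * ∫ x, ‖F s x - F t x - (s - t) • G t x‖ := by
      rw [← integral_const_mul, ← integral_const_mul]
      exact integral_add (hdF.norm.const_mul ε) (hR.norm.const_mul M)
    refine le_of_eq_of_le e4 ?_
    have e5 := hL t htI' s hs
    have e6 := h2 s hs hs2
    have hst : 0 ≤ |s - t| := abs_nonneg _
    calc ε * (∫ x, ‖F s x - F t x‖) + M * ∫ x, ‖F s x - F t x - (s - t) • G t x‖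
        ≤ ε * (L * |s - t|) + M * (ε * |s - t|) := by gcongr
      _ = ε * (L + M) * |s - t| := by ring
      _ ≤ c * |s - t| := by
          refine mul_le_mul_of_nonneg_right ?_ hst
          rw [hε, div_mul_eq_mul_div, div_le_iff₀ (by positivity)]
          nlinarith
      _ = c * ‖s - t‖ := by rw [Real.norm_eq_abs]

theorem prodMk {W : Type*} [NormedAddCommGroup W] [NormedSpace ℝ W] {F₂ G₂ : ℝ → Torus3 → W}
    (h : RegularCurve T F G) (h₂ : RegularCurve T F₂ G₂) :
    RegularCurve T (fun t x => (F t x, F₂ t x)) (fun t x => (G t x, G₂ t x)) := by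
  have hle : ∀ (a : V) (b : W), ‖(a, b)‖ ≤ ‖a‖ + ‖b‖ := fun a b => by
    rw [Prod.norm_mk]
    exact max_le (le_add_of_nonneg_right (norm_nonneg _)) (le_add_of_nonneg_left (norm_nonneg _))
  refine ⟨fun t ht => (h.aesm t ht).prodMk (h₂.aesm t ht), ?_, ?_, ?_, ?_⟩
  · obtain ⟨K, hK⟩ := h.bdd
    obtain ⟨K₂, hK₂⟩ := h₂.bdd
    refine ⟨K + K₂, fun t ht => ?_⟩
    filter_upwards [hK t ht, hK₂ t ht] with x hx hx'
    exact (hle _ _).trans (add_le_add hx hx')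
  · intro t ht ε hε
    obtain ⟨δ, hδ, h1⟩ := h.unif t ht (ε / 2) (by positivity)
    obtain ⟨δ₂, hδ₂, h2⟩ := h₂.unif t ht (ε / 2) (by positivity)
    refine ⟨min δ δ₂, lt_min hδ hδ₂, fun s hs hst => ?_⟩
    filter_upwards [h1 s hs (hst.trans_le (min_le_left _ _)),
      h2 s hs (hst.trans_le (min_le_right _ _))] with x hx hx'
    rw [Prod.mk_sub_mk]
    exact (hle _ _).trans (by linarith)
  · obtain ⟨L, hL0, hL⟩ := h.lip
    obtain ⟨L₂, hL₂0, hL₂⟩ := h₂.lip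
    refine ⟨L + L₂, add_nonneg hL0 hL₂0, fun s hs t ht => ?_⟩
    have i1 := ((h.integrable ht).sub (h.integrable hs)).norm
    have i2 := ((h₂.integrable ht).sub (h₂.integrable hs)).norm
    calc _ ≤ ∫ x, (‖F t x - F s x‖ + ‖F₂ t x - F₂ s x‖) := by
          refine integral_mono_of_nonneg (Filter.Eventually.of_forall fun x => norm_nonneg _)
            (i1.add i2) (Filter.Eventually.of_forall fun x => ?_)
          simp only [Prod.mk_sub_mk]
          exact hle _ _
      _ = (∫ x, ‖F t x - F s x‖) + ∫ x, ‖F₂ t x - F₂ s x‖ := integral_add i1 i2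
      _ ≤ _ := by linarith [hL s hs t ht, hL₂ s hs t ht]
  · filter_upwards [h.deriv, h₂.deriv, ae_restrict_mem measurableSet_Ioo] with t ht ht₂ htI
    refine ⟨ht.1.prodMk ht₂.1, fun ε hε => ?_⟩
    have htI' : t ∈ Icc 0 T := Ioo_subset_Icc_self htI
    obtain ⟨δ, hδ, h1⟩ := ht.2 (ε / 2) (by positivity)
    obtain ⟨δ₂, hδ₂, h2⟩ := ht₂.2 (ε / 2) (by positivity)
    refine ⟨min δ δ₂, lt_min hδ hδ₂, fun s hs hst => ?_⟩
    have i1 := (((h.integrable hs).sub (h.integrable htI')).sub (ht.1.smul (s - t))).norm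
    have i2 := (((h₂.integrable hs).sub (h₂.integrable htI')).sub (ht₂.1.smul (s - t))).norm
    calc _ ≤ ∫ x, (‖F s x - F t x - (s - t) • G t x‖ + ‖F₂ s x - F₂ t x - (s - t) • G₂ t x‖) := by
          refine integral_mono_of_nonneg (Filter.Eventually.of_forall fun x => norm_nonneg _)
            (i1.add i2) (Filter.Eventually.of_forall fun x => ?_)
          simp only [Prod.mk_sub_mk, Prod.smul_mk]
          exact hle _ _
      _ = (∫ x, ‖F s x - F t x - (s - t) • G t x‖) +
          ∫ x, ‖F₂ s x - F₂ t x - (s - t) • G₂ t x‖ := integral_add i1 i2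
      _ ≤ _ := by
          have e1 := h1 s hs (hst.trans_le (min_le_left _ _))
          have e2 := h2 s hs (hst.trans_le (min_le_right _ _))
          linarith

/-- Composition of a regular curve with a continuous linear map. -/
theorem clm_comp {W : Type*} [NormedAddCommGroup W] [NormedSpace ℝ W]
    (h : RegularCurve T F G) (A : V →L[ℝ] W) :
    RegularCurve T (fun t x => A (F t x)) (fun t x => A (G t x)) := by
  have hle : ∀ a : V, ‖A a‖ ≤ (‖A‖ + 1) * ‖a‖ := fun a =>
    (A.le_opNorm a).trans (mul_le_mul_of_nonneg_right (by linarith) (norm_nonneg _))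
  have hA : 0 < ‖A‖ + 1 := by positivity
  refine ⟨fun t ht => A.continuous.comp_aestronglyMeasurable (h.aesm t ht), ?_, ?_, ?_, ?_⟩
  · obtain ⟨K, hK⟩ := h.bdd
    refine ⟨(‖A‖ + 1) * K, fun t ht => ?_⟩
    filter_upwards [hK t ht] with x hx
    exact (hle _).trans (by gcongr)
  · intro t ht ε hε
    obtain ⟨δ, hδ, h1⟩ := h.unif t ht (ε / (‖A‖ + 1)) (by positivity)
    refine ⟨δ, hδ, fun s hs hst => ?_⟩
    filter_upwards [h1 s hs hst] with x hx
    rw [← map_sub]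
    exact (hle _).trans ((mul_le_mul_of_nonneg_left hx hA.le).trans_eq (by field_simp))
  · obtain ⟨L, hL0, hL⟩ := h.lip
    refine ⟨(‖A‖ + 1) * L, by positivity, fun s hs t ht => ?_⟩
    have i1 := ((h.integrable ht).sub (h.integrable hs)).norm
    calc _ ≤ ∫ x, (‖A‖ + 1) * ‖F t x - F s x‖ := by
          refine integral_mono_of_nonneg (Filter.Eventually.of_forall fun x => norm_nonneg _)
            (i1.const_mul _) (Filter.Eventually.of_forall fun x => ?_)
          simp only [← map_sub]
          exact hle _
      _ ≤ _ := by
          rw [integral_const_mul, mul_assoc]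
          exact mul_le_mul_of_nonneg_left (hL s hs t ht) hA.le
  · filter_upwards [h.deriv, ae_restrict_mem measurableSet_Ioo] with t ht htI
    refine ⟨A.integrable_comp ht.1, fun ε hε => ?_⟩
    have htI' : t ∈ Icc 0 T := Ioo_subset_Icc_self htI
    obtain ⟨δ, hδ, h1⟩ := ht.2 (ε / (‖A‖ + 1)) (by positivity)
    refine ⟨δ, hδ, fun s hs hst => ?_⟩
    have i1 := (((h.integrable hs).sub (h.integrable htI')).sub (ht.1.smul (s - t))).norm
    calc _ ≤ ∫ x, (‖A‖ + 1) * ‖F s x - F t x - (s - t) • G t x‖ := by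
          refine integral_mono_of_nonneg (Filter.Eventually.of_forall fun x => norm_nonneg _)
            (i1.const_mul _) (Filter.Eventually.of_forall fun x => ?_)
          simp only [← map_sub, ← map_smul]
          exact hle _
      _ ≤ (‖A‖ + 1) * (ε / (‖A‖ + 1) * |s - t|) := by
          rw [integral_const_mul]
          exact mul_le_mul_of_nonneg_left (h1 s hs hst) hA.le
      _ = _ := by field_simp

end RegularCurve

/-! ## Regular curves from Sobolev regularity -/

theorem toL2_eq {f : Torus3 → ℝ} (hf : MemLp f 2) : toL2 f = hf.toLp f := by
  rw [toL2, dif_pos hf]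

theorem norm_toL2 {f : Torus3 → ℝ} (hf : MemLp f 2) : ‖toL2 f‖ = √(∫ x, f x ^ 2) := by
  rw [toL2_eq hf, ← Real.sqrt_sq (norm_nonneg _), ← real_inner_self_eq_norm_sq, L2.inner_def]
  congr 1
  refine integral_congr_ae ?_
  filter_upwards [hf.coeFn_toLp] with x hx
  rw [hx]
  simp [sq]

theorem toL2_sub {f g : Torus3 → ℝ} (hf : MemLp f 2) (hg : MemLp g 2) :
    toL2 (f - g) = toL2 f - toL2 g := by
  rw [toL2_eq hf, toL2_eq hg, toL2_eq (hf.sub hg), MemLp.toLp_sub]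

theorem toL2_smul {f : Torus3 → ℝ} (hf : MemLp f 2) (c : ℝ) :
    toL2 (c • f) = c • toL2 f := by
  rw [toL2_eq hf, toL2_eq (hf.const_smul c), MemLp.toLp_const_smul]

theorem integral_norm_le_norm_toL2 {f : Torus3 → ℝ} (hf : MemLp f 2) :
    ∫ x, ‖f x‖ ≤ ‖toL2 f‖ := by
  have h := integral_mul_le_Lp_mul_Lq_of_nonneg (μ := (volume : Measure Torus3)) (p := 2) (q := 2)
    (by rw [Real.holderConjugate_iff]; norm_num) (f := fun x => ‖f x‖) (g := fun _ => 1)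
    (Filter.Eventually.of_forall fun x => norm_nonneg _)
    (Filter.Eventually.of_forall fun x => zero_le_one)
    (by simpa using hf.norm) (memLp_const 1)
  rw [norm_toL2 hf, Real.sqrt_eq_rpow]
  simpa using h

theorem ae_abs_le_of_H2 : ∃ C : ℝ, 0 ≤ C ∧ ∀ (f : Torus3 → ℝ) (f₁ f₂ : Fin 3 → Torus3 → ℝ),
    MemLp f 2 → (∀ i, IsWeakDeriv i f (f₁ i)) → (∀ i, IsWeakDeriv i (f₁ i) (f₂ i)) →
    (∀ i, MemLp (f₂ i) 2) → ∀ᵐ x, ‖f x‖ ≤ C * (‖toL2 f‖ + ∑ i, ‖toL2 (f₂ i)‖) := by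
  obtain ⟨C, hC0, hC⟩ := exists_tsum_fc_le
  refine ⟨C, hC0, fun f f₁ f₂ hf h1 h2 hf2 => ?_⟩
  obtain ⟨hs, hle⟩ := hC f f₁ f₂ hf h1 h2 hf2
  filter_upwards [ae_eq_rep (hf.integrable one_le_two) hs] with x hx
  rw [hx, norm_toL2 hf]
  simp only [norm_toL2 (hf2 _)]
  exact (abs_rep_le hs x).trans hle

/-- The $H^2$ bound controls the sup norm of `F` and of its increments. The a.e. bound on the $L^2$
norm of `G` gives the Lipschitz property, and Lebesgue differentiation of the Bochner integral gives
the derivative. -/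
theorem regularCurve_of_contSobolev {T M : ℝ} {F G : ℝ → Torus3 → ℝ} (hT : 0 < T)
    (h : ContSobolev T 2 F) (ht : IsTimeDeriv T F G)
    (hG : ∀ᵐ r ∂(volume.restrict (Ioo 0 T)), MemLp (G r) 2 ∧ ‖toL2 (G r)‖ ≤ M) :
    RegularCurve T F G := by
  obtain ⟨C, hC0, hC⟩ := ae_abs_le_of_H2
  obtain ⟨⟨hF, hFc⟩, h1⟩ := h
  have hw1 : ∀ i, ∀ t ∈ Icc 0 T, IsWeakDeriv i (F t) (wderiv i (F t)) :=
    fun i t ht => ((h1 i).1 t ht).wderiv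
  have hw2 : ∀ i, ∀ t ∈ Icc 0 T, IsWeakDeriv i (wderiv i (F t)) (wderiv i (wderiv i (F t))) :=
    fun i t ht => (((h1 i).2.2 i).1 t ht).wderiv
  have hF2 : ∀ i, ∀ t ∈ Icc 0 T, MemLp (wderiv i (wderiv i (F t))) 2 :=
    fun i t ht => ((h1 i).2.2 i).2.1 t ht
  have hF2c : ∀ i, ContinuousOn (fun t => toL2 (wderiv i (wderiv i (F t)))) (Icc 0 T) :=
    fun i => ((h1 i).2.2 i).2.2
  have hM0 : ∀ᵐ r ∂(volume.restrict (Ioo 0 T)), ‖toL2 (G r)‖ ≤ |M| := by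
    filter_upwards [hG] with r hr
    exact hr.2.trans (le_abs_self M)
  refine ⟨fun t ht => (hF t ht).aestronglyMeasurable, ?_, ?_, ?_, ?_⟩
  · obtain ⟨K, hK⟩ := isCompact_Icc.exists_bound_of_continuousOn hFc
    choose K2 hK2 using fun i => isCompact_Icc.exists_bound_of_continuousOn (hF2c i)
    refine ⟨C * (K + ∑ i, K2 i), fun t ht => ?_⟩
    filter_upwards [hC (F t) _ _ (hF t ht) (fun i => hw1 i t ht) (fun i => hw2 i t ht)
      fun i => hF2 i t ht] with x hx
    refine hx.trans (mul_le_mul_of_nonneg_left ?_ hC0)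
    exact add_le_add (hK t ht) (Finset.sum_le_sum fun i _ => hK2 i t ht)
  · intro t ht ε hε
    have hcont : ContinuousWithinAt (fun s => C * (‖toL2 (F s) - toL2 (F t)‖ +
        ∑ i, ‖toL2 (wderiv i (wderiv i (F s))) - toL2 (wderiv i (wderiv i (F t)))‖)) (Icc 0 T) t := by
      refine ContinuousWithinAt.mul continuousWithinAt_const (ContinuousWithinAt.add
        ((hFc t ht).sub continuousWithinAt_const).norm
        (tendsto_finsetSum _ fun i _ =>
          ((hF2c i t ht).sub continuousWithinAt_const).norm))
    have hlt := hcont.eventually_lt_const (u := ε) (by simpa using hε)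
    obtain ⟨δ, hδ, hδ'⟩ := Metric.mem_nhdsWithin_iff.1 hlt
    refine ⟨δ, hδ, fun s hs hst => ?_⟩
    have hs' := hδ' ⟨by rwa [Metric.mem_ball, Real.dist_eq], hs⟩
    filter_upwards [hC (F s - F t) _ _ ((hF s hs).sub (hF t ht))
      (fun i => (hw1 i s hs).sub (hw1 i t ht)) (fun i => (hw2 i s hs).sub (hw2 i t ht))
      fun i => (hF2 i s hs).sub (hF2 i t ht)] with x hx
    rw [toL2_sub (hF s hs) (hF t ht)] at hx
    simp only [toL2_sub (hF2 _ s hs) (hF2 _ t ht)] at hx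
    exact hx.trans (le_of_lt hs')
  · refine ⟨|M|, abs_nonneg _, fun s hs t ht' => ?_⟩
    refine (integral_norm_le_norm_toL2 ((hF t ht').sub (hF s hs))).trans ?_
    rw [toL2_sub (hF t ht') (hF s hs), ht.2 s hs t ht', add_sub_cancel_left]
    refine intervalIntegral.norm_integral_le_of_norm_le_const_ae ?_
    rw [← ae_restrict_iff' measurableSet_uIoc]
    have hsub : uIoc s t ⊆ Ioc 0 T := by
      rw [uIoc]
      exact Ioc_subset_Ioc (le_min hs.1 ht'.1) (max_le hs.2 ht'.2)
    refine ae_restrict_of_ae_restrict_of_subset hsub ?_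
    rwa [← restrict_Ioo_eq_restrict_Ioc]
  · have hd := ht.1.ae_hasDerivAt_integral
    rw [ae_restrict_iff' measurableSet_Ioo] at hG ⊢
    filter_upwards [hd, hG] with t htd htG htI
    have hGt := (htG htI).1
    refine ⟨hGt.integrable one_le_two, fun ε hε => ?_⟩
    have htI' : t ∈ Icc 0 T := Ioo_subset_Icc_self htI
    have hd0 := htd (by rwa [uIcc_of_le hT.le]) 0 (by simp [hT.le])
    rw [hasDerivAt_iff_isLittleO, Asymptotics.isLittleO_iff] at hd0
    obtain ⟨δ, hδ, hδ'⟩ := Metric.eventually_nhds_iff.1 (hd0 hε)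
    refine ⟨δ, hδ, fun s hs hst => ?_⟩
    have h3 := hδ' (by rwa [Real.dist_eq])
    have h0 : (0 : ℝ) ∈ Icc 0 T := ⟨le_rfl, hT.le⟩
    have e1 := ht.2 0 h0 s hs
    have e2 := ht.2 0 h0 t htI'
    have hm := ((hF s hs).sub (hF t htI')).sub (hGt.const_smul (s - t))
    refine (integral_norm_le_norm_toL2 hm).trans ?_
    rw [toL2_sub ((hF s hs).sub (hF t htI')) (hGt.const_smul (s - t)),
      toL2_sub (hF s hs) (hF t htI'), toL2_smul hGt, e1, e2, add_sub_add_left_eq_sub]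
    exact h3

theorem ContL2.exists_bound {T : ℝ} {F : ℝ → Torus3 → ℝ} (h : ContL2 T F) :
    ∃ M, ∀ᵐ r ∂(volume.restrict (Ioo 0 T)), MemLp (F r) 2 ∧ ‖toL2 (F r)‖ ≤ M := by
  obtain ⟨K, hK⟩ := isCompact_Icc.exists_bound_of_continuousOn h.2
  refine ⟨K, ?_⟩
  filter_upwards [ae_restrict_mem measurableSet_Ioo] with r hr
  exact ⟨h.1 r (Ioo_subset_Icc_self hr), hK r (Ioo_subset_Icc_self hr)⟩

theorem LpL2.exists_bound {T : ℝ} {F : ℝ → Torus3 → ℝ} (h : LpL2 ∞ T F) :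
    ∃ M, ∀ᵐ r ∂(volume.restrict (Ioo 0 T)), MemLp (F r) 2 ∧ ‖toL2 (F r)‖ ≤ M := by
  refine ⟨(eLpNorm (fun t => toL2 (F t)) ∞ (volume.restrict (Ioo 0 T))).toReal, ?_⟩
  have h2 := ae_le_eLpNormEssSup (f := fun t => toL2 (F t)) (μ := volume.restrict (Ioo 0 T))
  filter_upwards [h.1, h2] with r hr hr2
  refine ⟨hr, ?_⟩
  rw [← toReal_enorm]
  refine ENNReal.toReal_mono h.2.2.ne ?_
  rw [eLpNorm_exponent_top]
  exact hr2

/-- The linear map assembling three coordinates into a vector. -/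
def assemble : (ℝ × ℝ × ℝ × ℝ) →L[ℝ] ℝ × EuclideanSpace ℝ (Fin 3) :=
  LinearMap.toContinuousLinearMap
    { toFun := fun p => (p.1, !₂[p.2.1, p.2.2.1, p.2.2.2])
      map_add' := fun p q => by
        refine Prod.ext rfl ?_
        ext i
        fin_cases i <;> simp
      map_smul' := fun c p => by
        refine Prod.ext rfl ?_
        ext i
        fin_cases i <;> simp }

theorem assemble_apply (r : ℝ) (w : EuclideanSpace ℝ (Fin 3)) :
    assemble (r, w 0, w 1, w 2) = (r, w) := by
  refine Prod.ext rfl ?_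
  ext i
  fin_cases i <;> simp [assemble]

theorem RegularCurve.assemble {T : ℝ} {F G : ℝ → Torus3 → ℝ}
    {v w : ℝ → Torus3 → EuclideanSpace ℝ (Fin 3)} (h : RegularCurve T F G)
    (hv : ∀ j, RegularCurve T (fun t x => v t x j) (fun t x => w t x j)) :
    RegularCurve T (fun t x => (F t x, v t x)) (fun t x => (G t x, w t x)) := by
  have := (h.prodMk ((hv 0).prodMk ((hv 1).prodMk (hv 2)))).clm_comp NSK.assemble
  simpa only [assemble_apply] using this

/-! ## The state of a strong solution at a fixed time -/

/-- `f ∈ H^k(𝕋³)`. -/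
def IsSobolev : ℕ → (Torus3 → ℝ) → Prop
  | 0, f => MemLp f 2
  | k + 1, f => MemLp f 2 ∧ ∀ i : Fin 3, HasWeakDeriv i f ∧ IsSobolev k (wderiv i f)

theorem IsSobolev.memLp {k : ℕ} {f : Torus3 → ℝ} (h : IsSobolev k f) : MemLp f 2 := by
  cases k with
  | zero => exact h
  | succ k => exact h.1

theorem ContSobolev.isSobolev {T : ℝ} {k : ℕ} {F : ℝ → Torus3 → ℝ} (h : ContSobolev T k F)
    {t : ℝ} (ht : t ∈ Icc 0 T) : IsSobolev k (F t) := by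
  induction k generalizing F with
  | zero => exact h.1 t ht
  | succ k ih => exact ⟨h.1.1 t ht, fun i => ⟨(h.2 i).1 t ht, ih (h.2 i).2⟩⟩

theorem LpSobolev.isSobolev {T : ℝ} {p : ℝ≥0∞} {k : ℕ} {F : ℝ → Torus3 → ℝ}
    (h : LpSobolev p T k F) : ∀ᵐ t ∂(volume.restrict (Ioo 0 T)), IsSobolev k (F t) := by
  induction k generalizing F with
  | zero => exact h.1
  | succ k ih =>
    filter_upwards [h.1.1, ae_all_iff.2 fun i => (h.2 i).1, ae_all_iff.2 fun i => ih (h.2 i).2]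
      with t h1 h2 h3
    exact ⟨h1, fun i => ⟨h2 i, h3 i⟩⟩

theorem ContSobolev.mono {T : ℝ} {k : ℕ} {F : ℝ → Torus3 → ℝ} (h : ContSobolev T (k + 1) F) :
    ContSobolev T k F := by
  induction k generalizing F with
  | zero => exact h.1
  | succ k ih => exact ⟨h.1, fun i => ⟨(h.2 i).1, ih (h.2 i).2⟩⟩

theorem IsSobolev.summable_fc {f : Torus3 → ℝ} (h : IsSobolev 2 f) :
    Summable fun n => ‖fc f n‖ := by
  obtain ⟨C, -, hC⟩ := exists_tsum_fc_le
  exact (hC f _ _ h.1 (fun i => (h.2 i).1.wderiv) (fun i => ((h.2 i).2.2 i).1.wderiv)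
    fun i => ((h.2 i).2.2 i).2).1

theorem IsSobolev.hasGrad_rep {f : Torus3 → ℝ} (h : IsSobolev 3 f) :
    HasGrad (rep f) (fun i => rep (wderiv i f)) ∧ f =ᵐ[volume] rep f ∧
      ∀ i, wderiv i f =ᵐ[volume] rep (wderiv i f) := by
  have h2 : IsSobolev 2 f := ⟨h.1, fun i => ⟨(h.2 i).1, (h.2 i).2.1, fun j =>
    ⟨((h.2 i).2.2 j).1, ((h.2 i).2.2 j).2.1⟩⟩⟩
  exact ⟨NSK.hasGrad_rep h2.summable_fc (fun i => (h.2 i).2.summable_fc)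
      fun i => (h.2 i).1.wderiv,
    ae_eq_rep (h.1.integrable one_le_two) h2.summable_fc, fun i =>
    ae_eq_rep ((h.2 i).2.1.integrable one_le_two) (h.2 i).2.summable_fc⟩

/-- The state of a strong solution at a fixed time: `r`, `w` are the `C¹` density and velocity,
`rt`, `wt` their time derivatives, and the equations hold weakly against `C¹` functions. -/
structure Snapshot (γ : ℝ) (r : Torus3 → ℝ) (r' : Fin 3 → Torus3 → ℝ)
    (w : Torus3 → EuclideanSpace ℝ (Fin 3)) (w' : Fin 3 → Fin 3 → Torus3 → ℝ)
    (rt : Torus3 → ℝ) (wt : Torus3 → EuclideanSpace ℝ (Fin 3)) : Prop where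
  pos : ∀ x, 0 < r x
  grad : HasGrad r r'
  gradw : ∀ j, HasGrad (fun x => w x j) (fun i => w' i j)
  rt_int : Integrable rt
  wt_int : ∀ j, Integrable fun x => wt x j
  mass : ∀ φ φ', HasGrad φ φ' →
    ∫ x, rt x * φ x = ∑ i, ∫ x, (r x * w x i - r' i x) * φ' i x
  momentum : ∀ j φ φ', HasGrad φ φ' → ∫ x, r x * wt x j * φ x =
    (∫ x, r x ^ γ * φ' j x) - ∑ i, ∫ x, ((r x * w x i - r' i x) * w' i j x * φ x +
      r x * w' i j x * φ' i x)

theorem integrable_continuous_mul {a b : Torus3 → ℝ} (ha : Continuous a) (hb : Integrable b) :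
    Integrable fun x => a x * b x := by
  obtain ⟨C, -, hC⟩ := exists_bound_of_continuous ha
  exact hb.bdd_mul (c := C) ha.aestronglyMeasurable (Filter.Eventually.of_forall hC)

theorem integrable_mul_continuous {a b : Torus3 → ℝ} (ha : Integrable a) (hb : Continuous b) :
    Integrable fun x => a x * b x := by
  simpa only [mul_comm] using integrable_continuous_mul hb ha

theorem memLp_continuous_mul {a b : Torus3 → ℝ} (ha : Continuous a) (hb : MemLp b 2) :
    MemLp (fun x => a x * b x) 2 := by
  obtain ⟨C, -, hC⟩ := exists_bound_of_continuous ha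
  refine (hb.const_mul C).of_le (ha.aestronglyMeasurable.mul hb.aestronglyMeasurable)
    (Filter.Eventually.of_forall fun x => ?_)
  rw [norm_mul, norm_mul]
  gcongr
  exact (hC x).trans (le_abs_self C)

/-- Since $r(v-\nabla\log r)=rv-\nabla r$, integrating the second-order terms and the pressure by
parts leaves only quantities that are continuous for $H^3$ states, apart from the time derivatives.
-/
theorem exists_snapshot {γ : ℝ} {r : Torus3 → ℝ} {v : Torus3 → EuclideanSpace ℝ (Fin 3)}
    {rt : Torus3 → ℝ} {vt : Torus3 → EuclideanSpace ℝ (Fin 3)}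
    (hc : Continuous r) (hpos : ∀ x, 0 < r x) (hr : IsSobolev 3 r)
    (hv : ∀ j, IsSobolev 3 fun x => v x j) (hrt : Integrable rt)
    (hvt : ∀ j, Integrable fun x => vt x j)
    (hmass : ∀ᵐ x : Torus3, rt x + (∑ i, wderiv i (fun y => r y * v y i) x)
      - (∑ i, wderiv i (wderiv i r) x) = 0)
    (hmom : ∀ᵐ x : Torus3, ∀ j : Fin 3, r x * vt x j
      + (∑ i, r x * (v x i - wderiv i (fun y => Real.log (r y)) x)
          * wderiv i (fun y => v y j) x)
      + wderiv j (fun y => r y ^ γ) x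
      = ∑ i, wderiv i (fun y => r y * wderiv i (fun z => v z j) y) x) :
    ∃ r' w w', Snapshot γ r r' w w' rt vt ∧ v =ᵐ[volume] w := by
  obtain ⟨hg, hre, hre'⟩ := hr.hasGrad_rep
  -- The density is continuous, so it equals its Fourier sum everywhere; the velocity is only a.e.
  -- equal to its representative `w`.
  have hrr : rep r = r := ((hc.ae_eq_iff_eq (μ := volume) hg.cont).1 hre).symm
  rw [hrr] at hg
  have hV := fun j => (hv j).hasGrad_rep
  set r' : Fin 3 → Torus3 → ℝ := fun i => rep (wderiv i r) with hr'
  set w : Torus3 → EuclideanSpace ℝ (Fin 3) :=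
    fun x => WithLp.toLp 2 fun j => rep (fun x => v x j) x with hw
  set w' : Fin 3 → Fin 3 → Torus3 → ℝ := fun i j => rep (wderiv i fun x => v x j) with hw'
  have hgw : ∀ j, HasGrad (fun x => w x j) (fun i => w' i j) := fun j => (hV j).1
  have hvw : ∀ᵐ x, ∀ j, v x j = w x j := ae_all_iff.2 fun j => (hV j).2.1
  have hvw' : ∀ᵐ x, ∀ i j, wderiv i (fun x => v x j) x = w' i j x :=
    ae_all_iff.2 fun i => ae_all_iff.2 fun j => (hV j).2.2 i
  have hrw' : ∀ᵐ x, ∀ i, wderiv i r x = r' i x := ae_all_iff.2 fun i => hre' i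
  refine ⟨r', w, w', ⟨hpos, hg, hgw, hrt, hvt, ?_, ?_⟩, ?_⟩
  · intro φ φ' hφ
    have h1 : ∀ᵐ x, ∀ i, wderiv i (fun y => r y * v y i) x = r' i x * w x i + r x * w' i i x := by
      refine ae_all_iff.2 fun i => ((hg.mul (hgw i)).isWeakDeriv i).wderiv_ae_eq ?_
      filter_upwards [hvw] with x hx
      rw [hx]
    have h2 : ∀ᵐ x, rt x * φ x =
        ∑ i, (wderiv i (wderiv i r) x * φ x - (r' i x * w x i + r x * w' i i x) * φ x) := by
      filter_upwards [hmass, h1] with x hx hx1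
      simp only [hx1] at hx
      rw [Finset.sum_sub_distrib, ← Finset.sum_mul, ← Finset.sum_mul]
      linear_combination φ x * hx
    have hw2 : ∀ i, Integrable fun x => wderiv i (wderiv i r) x * φ x := fun i =>
      integrable_mul_continuous ((((hr.2 i).2.2 i).2.memLp).integrable one_le_two) hφ.cont
    have hc2 : ∀ i, Integrable fun x => (r' i x * w x i + r x * w' i i x) * φ x := fun i =>
      integrable_mul_continuous ((hg.mul (hgw i)).cont' i).integrable_torus hφ.cont
    have hd2 : ∀ i, Integrable fun x => wderiv i (wderiv i r) x * φ x -
        (r' i x * w x i + r x * w' i i x) * φ x := fun i => (hw2 i).sub (hc2 i)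
    rw [integral_congr_ae h2, integral_finsetSum _ fun i _ => hd2 i]
    refine Finset.sum_congr rfl fun i _ => ?_
    rw [integral_sub (hw2 i) (hc2 i)]
    have e1 := ((hr.2 i).2.2 i).1.wderiv.integral_mul_hasGrad (hr.2 i).2.1
      ((hr.2 i).2.2 i).2.memLp hφ
    have e2 := (hg.mul (hgw i)).integral_mul_deriv hφ i
    have e3 : ∫ x, wderiv i r x * φ' i x = ∫ x, r' i x * φ' i x :=
      integral_congr_ae (by filter_upwards [hrw'] with x hx; rw [hx])
    have e4 : ∫ x, (r x * w x i - r' i x) * φ' i x =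
        (∫ x, r x * w x i * φ' i x) - ∫ x, r' i x * φ' i x := by
      rw [← integral_sub (integrable_mul_continuous (hg.mul (hgw i)).cont.integrable_torus
        (hφ.cont' i)) (integrable_mul_continuous (hg.cont' i).integrable_torus (hφ.cont' i))]
      congr 1; funext x; ring
    rw [e4, ← e3, e1, e2]
    ring
  · intro j φ φ' hφ
    have hlog : ∀ᵐ x, ∀ i, wderiv i (fun y => Real.log (r y)) x = (r x)⁻¹ * r' i x :=
      ae_all_iff.2 fun i => ((hg.log hpos).isWeakDeriv i).wderiv_ae_eq Filter.EventuallyEq.rfl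
    have hpow : ∀ᵐ x, wderiv j (fun y => r y ^ γ) x = γ * r x ^ (γ - 1) * r' j x :=
      ((hg.rpow hpos γ).isWeakDeriv j).wderiv_ae_eq Filter.EventuallyEq.rfl
    have hVj := hv j
    set V : Torus3 → ℝ := fun z => v z j with hVdef
    have hD : ∀ i, IsWeakDeriv i (fun x => r x * wderiv i V x)
        (fun x => r x * wderiv i (wderiv i V) x + r' i x * wderiv i V x) := fun i =>
      ((hVj.2 i).2.2 i).1.wderiv.mul_hasGrad (hVj.2 i).2.1 ((hVj.2 i).2.2 i).2.memLp hg
    have hDm : ∀ i, MemLp (fun x => r x * wderiv i V x) 2 := fun i =>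
      memLp_continuous_mul hg.cont (hVj.2 i).2.1
    have hDm' : ∀ i, MemLp (fun x => r x * wderiv i (wderiv i V) x + r' i x * wderiv i V x) 2 :=
      fun i => (memLp_continuous_mul hg.cont ((hVj.2 i).2.2 i).2.memLp).add
        (memLp_continuous_mul (hg.cont' i) (hVj.2 i).2.1)
    have hDw : ∀ᵐ x, ∀ i, wderiv i (fun y => r y * wderiv i V y) x =
        r x * wderiv i (wderiv i V) x + r' i x * wderiv i V x :=
      ae_all_iff.2 fun i => (hD i).wderiv_ae_eq Filter.EventuallyEq.rfl
    have h2 : ∀ᵐ x, r x * vt x j * φ x =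
        (∑ i, ((r x * wderiv i (wderiv i V) x + r' i x * wderiv i V x) * φ x -
          (r x * w x i - r' i x) * w' i j x * φ x)) - γ * r x ^ (γ - 1) * r' j x * φ x := by
      filter_upwards [hmom, hlog, hpow, hDw, hvw, hvw'] with x h1 h2 h3 h4 h5 h6
      have h1j : r x * vt x j + (∑ i, r x * (v x i - wderiv i (fun y => Real.log (r y)) x)
          * wderiv i V x) + wderiv j (fun y => r y ^ γ) x =
          ∑ i, wderiv i (fun y => r y * wderiv i V y) x := h1 j
      simp only [h2, h3, h4, h5] at h1j
      have e : ∀ i, (r x * w x i - r' i x) * w' i j x =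
          r x * (w x i - (r x)⁻¹ * r' i x) * wderiv i V x := by
        intro i
        have e6 : wderiv i V x = w' i j x := h6 i j
        rw [e6]
        have := (hpos x).ne'
        field_simp
      simp only [e]
      rw [Finset.sum_sub_distrib, ← Finset.sum_mul, ← Finset.sum_mul]
      linear_combination φ x * h1j
    have i1 : ∀ i, Integrable fun x =>
        (r x * wderiv i (wderiv i V) x + r' i x * wderiv i V x) * φ x := fun i =>
      integrable_mul_continuous ((hDm' i).integrable one_le_two) hφ.cont
    have c2 : ∀ i, Continuous fun x => (r x * w x i - r' i x) * w' i j x * φ x := fun i =>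
      (((hg.mul (hgw i)).cont.sub (hg.cont' i)).mul ((hgw j).cont' i)).mul hφ.cont
    have c3 : Continuous fun x => γ * r x ^ (γ - 1) * r' j x * φ x :=
      ((hg.rpow hpos γ).cont' j).mul hφ.cont
    have i12 : ∀ i, Integrable fun x =>
        (r x * wderiv i (wderiv i V) x + r' i x * wderiv i V x) * φ x -
          (r x * w x i - r' i x) * w' i j x * φ x := fun i =>
      (i1 i).sub (c2 i).integrable_torus
    rw [integral_congr_ae h2, integral_sub (integrable_finsetSum _ fun i _ => i12 i)
      c3.integrable_torus, integral_finsetSum _ fun i _ => i12 i]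
    have e1 := (hg.rpow hpos γ).integral_mul_deriv hφ j
    have e2 : ∀ i, ∫ x, ((r x * wderiv i (wderiv i V) x + r' i x * wderiv i V x) * φ x -
          (r x * w x i - r' i x) * w' i j x * φ x) =
        -∫ x, ((r x * w x i - r' i x) * w' i j x * φ x + r x * w' i j x * φ' i x) := by
      intro i
      have e3 := (hD i).integral_mul_hasGrad (hDm i) (hDm' i) hφ
      have e4 : ∫ x, r x * wderiv i V x * φ' i x = ∫ x, r x * w' i j x * φ' i x :=
        integral_congr_ae (by filter_upwards [hvw'] with x hx; rw [hx i j])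
      have c4 : Continuous fun x => r x * w' i j x * φ' i x :=
        (hg.cont.mul ((hgw j).cont' i)).mul (hφ.cont' i)
      rw [integral_sub (i1 i) (c2 i).integrable_torus,
        integral_add (c2 i).integrable_torus c4.integrable_torus]
      linarith
    simp only [e2]
    rw [Finset.sum_neg_distrib]
    linarith
  · filter_upwards [hvw] with x hx
    ext j
    exact hx j

/-! ## Power and energy balances -/

namespace HasGrad

theorem hasDerivAt_vector {w : Torus3 → EuclideanSpace ℝ (Fin 3)} {w' : Fin 3 → Fin 3 → Torus3 → ℝ}
    (hw : ∀ j, HasGrad (fun x => w x j) (fun i => w' i j)) (i : Fin 3) (y : Torus3) :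
    HasDerivAt (fun s : ℝ => w (y + Pi.single i (s : UnitAddCircle)))
      (WithLp.toLp 2 fun j => w' i j y) 0 := by
  have h1 : HasDerivAt (fun (s : ℝ) (j : Fin 3) => w (y + Pi.single i (s : UnitAddCircle)) j)
      (fun j => w' i j y) 0 := hasDerivAt_pi.2 fun j => (hw j).deriv i y
  exact (PiLp.continuousLinearEquiv 2 ℝ fun _ : Fin 3 => ℝ).symm.hasFDerivAt.comp_hasDerivAt 0 h1

theorem continuous_vector {w : Torus3 → EuclideanSpace ℝ (Fin 3)}
    (hw : ∀ j, Continuous fun x => w x j) : Continuous w :=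
  (PiLp.continuous_toLp 2 fun _ : Fin 3 => ℝ).comp (continuous_pi hw)

/-- The condition `1 < p` makes $|z|^p$ continuously differentiable across $z=0$, so zeros of the
velocity need no regularisation. -/
theorem norm_rpow {w : Torus3 → EuclideanSpace ℝ (Fin 3)} {w' : Fin 3 → Fin 3 → Torus3 → ℝ}
    (hw : ∀ j, HasGrad (fun x => w x j) (fun i => w' i j)) {p : ℝ} (hp : 1 < p) :
    HasGrad (fun x => ‖w x‖ ^ p) (fun i x => p * ‖w x‖ ^ (p - 2) * ∑ j, w x j * w' i j x) := by
  have hwc : Continuous w := continuous_vector fun j => (hw j).cont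
  have e : ∀ i x, p * ‖w x‖ ^ (p - 2) * ∑ j, w x j * w' i j x =
      fderiv ℝ (fun z : EuclideanSpace ℝ (Fin 3) => ‖z‖ ^ p) (w x)
        (WithLp.toLp 2 fun j => w' i j x) := by
    intro i x
    rw [(hasFDerivAt_norm_rpow (w x) hp).fderiv]
    simp [PiLp.inner_apply, mul_comm]
  refine ⟨hwc.norm.rpow_const fun x => Or.inr (by linarith), fun i => ?_, fun i y => ?_⟩
  · simp only [e]
    refine Continuous.clm_apply
      (((contDiff_norm_rpow hp).continuous_fderiv one_ne_zero).comp hwc) ?_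
    exact (PiLp.continuous_toLp 2 fun _ : Fin 3 => ℝ).comp
      (continuous_pi fun j => (hw j).cont' i)
  · rw [e]
    have h1 := hasDerivAt_vector hw i y
    have h2 : HasFDerivAt (fun z : EuclideanSpace ℝ (Fin 3) => ‖z‖ ^ p)
        (fderiv ℝ (fun z : EuclideanSpace ℝ (Fin 3) => ‖z‖ ^ p) (w y)) (w y) :=
      ((contDiff_norm_rpow hp).differentiable one_ne_zero _).hasFDerivAt
    exact HasFDerivAt.comp_hasDerivAt_of_eq (0 : ℝ) h2 h1 (by simp)

theorem const_mul {f : Torus3 → ℝ} {f' : Fin 3 → Torus3 → ℝ} (hf : HasGrad f f') (c : ℝ) :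
    HasGrad (fun x => c * f x) (fun i x => c * f' i x) :=
  ((const c).mul hf).congr rfl (by funext i x; ring)

end HasGrad

namespace Snapshot

variable {γ : ℝ} {r : Torus3 → ℝ} {r' : Fin 3 → Torus3 → ℝ}
  {w : Torus3 → EuclideanSpace ℝ (Fin 3)} {w' : Fin 3 → Fin 3 → Torus3 → ℝ}
  {rt : Torus3 → ℝ} {wt : Torus3 → EuclideanSpace ℝ (Fin 3)}

theorem integral_pow_mul (h : Snapshot γ r r' w w' rt wt) (k : ℕ) :
    ∫ x, ((k + 2 : ℕ) : ℝ) * r x ^ (k + 1) * rt x =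
      (k + 2) * (k + 1) * ∫ x, ∑ i, (r x * w x i - r' i x) * (r x ^ k * r' i x) := by
  have hg := h.grad
  have h1 := h.mass _ _ (hg.pow (k + 1))
  have hc : ∀ i, Continuous fun x => (r x * w x i - r' i x) * (r x ^ k * r' i x) := fun i =>
    (((hg.mul (h.gradw i)).cont).sub (hg.cont' i)).mul ((hg.cont.pow k).mul (hg.cont' i))
  rw [integral_finsetSum _ fun i _ => (hc i).integrable_torus]
  have e1 : ∀ i x, (r x * w x i - r' i x) * (((k + 1 : ℕ) : ℝ) * r x ^ (k + 1 - 1) * r' i x) =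
      (k + 1) * ((r x * w x i - r' i x) * (r x ^ k * r' i x)) := by
    intro i x; push_cast; ring
  simp only [e1, integral_const_mul] at h1
  rw [← Finset.mul_sum] at h1
  have e2 : ∀ x, ((k + 2 : ℕ) : ℝ) * r x ^ (k + 1) * rt x = (k + 2) * (rt x * r x ^ (k + 1)) := by
    intro x; push_cast; ring
  simp only [e2]
  rw [integral_const_mul, h1]
  ring

/-- The energy balance. -/
theorem energy_le (h : Snapshot γ r r' w w' rt wt) (hγ : 1 < γ) :
    ∫ x, (rt x * (1 / 2 * ‖w x‖ ^ 2 + γ / (γ - 1) * r x ^ (γ - 1)) +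
      ∑ j, r x * wt x j * w x j) ≤ -∫ x, r x * ∑ i, ∑ j, w' i j x ^ 2 := by
  have hg := h.grad
  have hγ1 : γ - 1 ≠ 0 := by linarith
  have hc1 := hg.cont
  have hcr' := hg.cont'
  have hcw : ∀ j, Continuous fun x => w x j := fun j => (h.gradw j).cont
  have hcw' : ∀ i j, Continuous (w' i j) := fun i j => (h.gradw j).cont' i
  have hcγ : ∀ a : ℝ, Continuous fun x => r x ^ a :=
    fun a => hc1.rpow_const fun x => Or.inl (h.pos x).ne'
  -- The test function for the mass equation is the density derivative of the energy integrand; the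
  -- momentum equation is tested with `w`.
  have hφ : HasGrad (fun x => 1 / 2 * ‖w x‖ ^ 2 + γ / (γ - 1) * r x ^ (γ - 1))
      (fun i x => (∑ j, w x j * w' i j x) + γ * (r x ^ (γ - 2) * r' i x)) := by
    have h1 := (HasGrad.norm_rpow h.gradw (p := 2) one_lt_two).const_mul (1 / 2)
    have h2 := (hg.rpow h.pos (γ - 1)).const_mul (γ / (γ - 1))
    refine (h1.add h2).congr (by funext x; simp) ?_
    funext i x
    rw [sub_self, Real.rpow_zero, show γ - 1 - 1 = γ - 2 by ring]
    field_simp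
  have hmass := h.mass _ _ hφ
  have hmom := fun j => h.momentum j _ _ (h.gradw j)
  have cA : ∀ i, Continuous fun x => (r x * w x i - r' i x) *
      ((∑ j, w x j * w' i j x) + γ * (r x ^ (γ - 2) * r' i x)) := fun i =>
    ((hc1.mul (hcw i)).sub (hcr' i)).mul ((continuous_finsetSum _ fun j _ =>
      (hcw j).mul (hcw' i j)).add (continuous_const.mul ((hcγ _).mul (hcr' i))))
  have cB : ∀ j, Continuous fun x => r x ^ γ * w' j j x := fun j => (hcγ γ).mul (hcw' j j)
  have cC : ∀ j i, Continuous fun x =>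
      (r x * w x i - r' i x) * w' i j x * w x j + r x * w' i j x * w' i j x := fun j i =>
    ((((hc1.mul (hcw i)).sub (hcr' i)).mul (hcw' i j)).mul (hcw j)).add
      ((hc1.mul (hcw' i j)).mul (hcw' i j))
  have iT : ∀ j, Integrable fun x => r x * wt x j * w x j := fun j =>
    integrable_mul_continuous (integrable_continuous_mul hc1 (h.wt_int j)) (hcw j)
  rw [integral_add (integrable_mul_continuous h.rt_int hφ.cont)
    (integrable_finsetSum _ fun j _ => iT j), integral_finsetSum _ fun j _ => iT j, hmass]
  simp only [hmom]
  have hparts : ∀ j, ∫ x, r x ^ γ * w' j j x = -∫ x, γ * r x ^ (γ - 1) * r' j x * w x j :=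
    fun j => (hg.rpow h.pos γ).integral_mul_deriv (h.gradw j) j
  simp only [hparts]
  have cD : ∀ j, Continuous fun x => γ * r x ^ (γ - 1) * r' j x * w x j := fun j =>
    ((continuous_const.mul (hcγ _)).mul (hcr' j)).mul (hcw j)
  have cDn : ∀ j, Continuous fun x => -(γ * r x ^ (γ - 1) * r' j x * w x j) :=
    fun j => (cD j).neg
  have key : (∑ i, ∫ x, (r x * w x i - r' i x) *
      ((∑ j, w x j * w' i j x) + γ * (r x ^ (γ - 2) * r' i x))) +
      ∑ j, (-(∫ x, γ * r x ^ (γ - 1) * r' j x * w x j) -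
      ∑ i, ∫ x, ((r x * w x i - r' i x) * w' i j x * w x j + r x * w' i j x * w' i j x)) =
      ∫ x, ((∑ i, (r x * w x i - r' i x) *
      ((∑ j, w x j * w' i j x) + γ * (r x ^ (γ - 2) * r' i x))) +
      ∑ j, (-(γ * r x ^ (γ - 1) * r' j x * w x j) -
      ∑ i, ((r x * w x i - r' i x) * w' i j x * w x j + r x * w' i j x * w' i j x))) := by
    have i3 : ∀ j, Integrable fun x => (∑ i, ((r x * w x i - r' i x) * w' i j x * w x j +
        r x * w' i j x * w' i j x)) :=
      fun j => integrable_finsetSum _ fun i _ => (cC j i).integrable_torus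
    have i4 : ∀ j, Integrable fun x => (-(γ * r x ^ (γ - 1) * r' j x * w x j) -
      ∑ i, ((r x * w x i - r' i x) * w' i j x * w x j + r x * w' i j x * w' i j x)) :=
      fun j => (cDn j).integrable_torus.sub (i3 j)
    rw [integral_add (integrable_finsetSum _ fun i _ => (cA i).integrable_torus)
      (integrable_finsetSum _ fun j _ => i4 j), integral_finsetSum _ fun i _ =>
      (cA i).integrable_torus, integral_finsetSum _ fun j _ => i4 j]
    congr 1
    refine Finset.sum_congr rfl fun j _ => ?_
    rw [integral_sub (cDn j).integrable_torus (i3 j), integral_finsetSum _ fun i _ =>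
      (cC j i).integrable_torus, integral_neg]
  rw [key, ← integral_neg]
  have cE : Continuous fun x => (∑ i, (r x * w x i - r' i x) *
      ((∑ j, w x j * w' i j x) + γ * (r x ^ (γ - 2) * r' i x))) +
      ∑ j, (-(γ * r x ^ (γ - 1) * r' j x * w x j) -
      ∑ i, ((r x * w x i - r' i x) * w' i j x * w x j + r x * w' i j x * w' i j x)) := by
    refine (continuous_finsetSum _ fun i _ => cA i).add (continuous_finsetSum _ fun j _ =>
      (cD j).neg.sub (continuous_finsetSum _ fun i _ => cC j i))
  have cF : Continuous fun x => -(r x * ∑ i, ∑ j, w' i j x ^ 2) :=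
    (hc1.mul (continuous_finsetSum _ fun i _ => continuous_finsetSum _ fun j _ =>
      (hcw' i j).pow 2)).neg
  -- The convective terms and the pressure work cancel pointwise. Besides the viscous dissipation
  -- only $-\gamma r^{\gamma-2}|\nabla r|^2$ remains, and it is dropped.
  refine integral_mono cE.integrable_torus cF.integrable_torus fun x => ?_
  have hr := h.pos x
  have e1 : r x ^ (γ - 1) = r x * r x ^ (γ - 2) := by
    rw [← Real.rpow_one_add' hr.le (by linarith)]; congr 1; ring
  have e2 : 0 ≤ γ * r x ^ (γ - 2) := by positivity
  simp only [e1, Fin.sum_univ_three]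
  nlinarith [mul_nonneg e2 (sq_nonneg (r' 0 x)), mul_nonneg e2 (sq_nonneg (r' 1 x)),
    mul_nonneg e2 (sq_nonneg (r' 2 x))]

end Snapshot

/-! ## The weighted velocity estimate -/

/-- Compare $r^{2\gamma-2}$ with $z^2$: when it is smaller the first term wins, otherwise only
$r^{(\gamma-1)(q+2)+1}$ remains. Here the relation between $\gamma$ and $q$ caps the exponent at 5.
-/
theorem rpow_mul_rpow_le {γ q r z : ℝ} (hγ : 1 < γ) (hq : 0 < q)
    (hs : (γ - 1) * (q + 2) + 1 ≤ 5) (hr : 0 < r) (hz : 0 ≤ z) :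
    r ^ (2 * γ - 1) * z ^ q ≤ r * z ^ (q + 2) + 1 + r ^ 5 := by
  have e1 : r ^ (2 * γ - 1) = r * r ^ (2 * γ - 2) := by
    rw [← Real.rpow_one_add' hr.le (by linarith)]; congr 1; ring
  have e2 : z ^ (q + 2) = z ^ 2 * z ^ q := by
    rw [Real.rpow_add' hz (by linarith), Real.rpow_two]; ring
  have hzq : 0 ≤ z ^ q := by positivity
  rcases le_total (r ^ (2 * γ - 2)) (z ^ 2) with h | h
  · have : r ^ (2 * γ - 1) * z ^ q ≤ r * z ^ (q + 2) := by
      rw [e1, e2, mul_assoc]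
      gcongr
    have : 0 ≤ r ^ 5 := by positivity
    linarith
  · have h1 : z ^ q ≤ r ^ ((γ - 1) * q) := by
      have h2 := Real.rpow_le_rpow (sq_nonneg z) h (show 0 ≤ q / 2 by positivity)
      rw [← Real.rpow_mul hr.le, ← Real.rpow_natCast, ← Real.rpow_mul hz] at h2
      convert h2 using 2 <;> push_cast <;> ring
    have h3 : r ^ (2 * γ - 1) * z ^ q ≤ r ^ ((γ - 1) * (q + 2) + 1) := by
      refine (mul_le_mul_of_nonneg_left h1 (by positivity)).trans_eq ?_
      rw [← Real.rpow_add hr]; congr 1; ring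
    have h4 : r ^ ((γ - 1) * (q + 2) + 1) ≤ 1 + r ^ 5 := by
      rcases le_total r 1 with h | h
      · have := Real.rpow_le_one hr.le h (show 0 ≤ (γ - 1) * (q + 2) + 1 by nlinarith)
        have : 0 ≤ r ^ 5 := by positivity
        linarith
      · have := Real.rpow_le_rpow_of_exponent_le h hs
        rw [show (5 : ℝ) = ((5 : ℕ) : ℝ) by norm_num, Real.rpow_natCast] at this
        linarith
    have : 0 ≤ r * z ^ (q + 2) := by positivity
    linarith

theorem mul_sub_sq_le {R r g s t : ℝ} (hr : 0 < r) (h : R ^ 2 = r * g) :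
    R * (t * s) - r * t ^ 2 ≤ g * s ^ 2 / 4 := by
  have h1 : 0 ≤ r * (g * s ^ 2 / 4 - (R * (t * s) - r * t ^ 2)) := by
    have : r * (g * s ^ 2 / 4 - (R * (t * s) - r * t ^ 2)) = (R * s / 2 - r * t) ^ 2 := by
      linear_combination -(s ^ 2 / 4) * h
    rw [this]; positivity
  have := nonneg_of_mul_nonneg_right h1 hr
  linarith

/-- The pointwise algebra of the $L^{q+2}$ estimate, used with $a=|w|^q$, $c=q|w|^{q-2}$,
$R=r^\gamma$, $g=r^{2\gamma-1}$, `m` the flux and $b=\frac12\nabla|w|^2$. The terms with `m` cancel;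
Young absorbs the pressure into the two dissipations, at cost $qag/4$ and $3ag/4$. -/
theorem weighted_dissipation_le {a c R r g q z : ℝ} {W m b : Fin 3 → ℝ} {d : Fin 3 → Fin 3 → ℝ}
    (hb : ∀ i, b i = ∑ k, W k * d i k) (ha : 0 ≤ a) (hc : 0 ≤ c) (hr : 0 < r)
    (h : R ^ 2 = r * g) (hz : z ^ 2 = ∑ j, W j ^ 2) (hcz : c * z ^ 2 = q * a) (hq : 0 ≤ q + 2) :
    (∑ i, m i * ((q + 2) * a * b i)) + (q + 2) * ∑ j, (R * (c * b j * W j + a * d j j) -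
      ∑ i, (m i * d i j * (a * W j) + r * d i j * (c * b i * W j + a * d i j))) ≤
    (q + 2) * (q + 3) / 4 * (g * a) := by
  have e : (∑ i, m i * ((q + 2) * a * b i)) + (q + 2) * ∑ j, (R * (c * b j * W j + a * d j j) -
      ∑ i, (m i * d i j * (a * W j) + r * d i j * (c * b i * W j + a * d i j))) =
      (q + 2) * (c * ∑ j, (R * (b j * W j) - r * b j ^ 2) +
        a * (∑ j, R * d j j - r * ∑ i, ∑ j, d i j ^ 2)) := by
    simp only [hb, Fin.sum_univ_three]
    ring
  rw [e]
  have h1 : c * ∑ j, (R * (b j * W j) - r * b j ^ 2) ≤ q * a * g / 4 := by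
    have h2 : ∑ j, (R * (b j * W j) - r * b j ^ 2) ≤ ∑ j, g * W j ^ 2 / 4 :=
      Finset.sum_le_sum fun j _ => mul_sub_sq_le hr h
    rw [← Finset.sum_div, ← Finset.mul_sum, ← hz] at h2
    calc _ ≤ c * (g * z ^ 2 / 4) := mul_le_mul_of_nonneg_left h2 hc
      _ = _ := by linear_combination g / 4 * hcz
  have h3 : a * (∑ j, R * d j j - r * ∑ i, ∑ j, d i j ^ 2) ≤ a * (3 * g / 4) := by
    refine mul_le_mul_of_nonneg_left ?_ ha
    have h4 := fun j => mul_sub_sq_le (s := 1) (t := d j j) hr h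
    have h5 := fun i j => mul_nonneg hr.le (sq_nonneg (d i j))
    simp only [Fin.sum_univ_three]
    linarith [h4 0, h4 1, h4 2, h5 0 1, h5 0 2, h5 1 0, h5 1 2, h5 2 0, h5 2 1]
  calc _ ≤ (q + 2) * (q * a * g / 4 + a * (3 * g / 4)) := by gcongr
    _ = _ := by ring

namespace Snapshot

variable {γ : ℝ} {r : Torus3 → ℝ} {r' : Fin 3 → Torus3 → ℝ}
  {w : Torus3 → EuclideanSpace ℝ (Fin 3)} {w' : Fin 3 → Fin 3 → Torus3 → ℝ}
  {rt : Torus3 → ℝ} {wt : Torus3 → EuclideanSpace ℝ (Fin 3)}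

theorem continuous_velocity (h : Snapshot γ r r' w w' rt wt) : Continuous w :=
  HasGrad.continuous_vector fun j => (h.gradw j).cont

/-- The `L^{q+2}` estimate for the velocity. -/
theorem velocity_rpow_le (h : Snapshot γ r r' w w' rt wt) {q : ℝ} (hγ : 1 < γ) (hq : 1 < q)
    (hs : (γ - 1) * (q + 2) + 1 ≤ 5) :
    ∫ x, (rt x * ‖w x‖ ^ (q + 2) + ∑ j, (q + 2) * (r x * wt x j * (‖w x‖ ^ q * w x j))) ≤
      (q + 2) * (q + 3) / 4 * ((∫ x, r x * ‖w x‖ ^ (q + 2)) + 1 + ∫ x, r x ^ 5) := by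
  have hc1 := h.grad.cont
  have hcr' := h.grad.cont'
  have hcw : ∀ j, Continuous fun x => w x j := fun j => (h.gradw j).cont
  have hcw' : ∀ i j, Continuous (w' i j) := fun i j => (h.gradw j).cont' i
  have hcγ : Continuous fun x => r x ^ γ := hc1.rpow_const fun x => Or.inl (h.pos x).ne'
  have hφ : HasGrad (fun x => ‖w x‖ ^ (q + 2))
      (fun i x => (q + 2) * ‖w x‖ ^ q * ∑ j, w x j * w' i j x) := by
    refine (HasGrad.norm_rpow h.gradw (p := q + 2) (by linarith)).congr rfl ?_
    rw [add_sub_cancel_right]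
  -- Here $q>1$ makes the momentum test function $|w|^qw$ a $C^1$ function by the product rule.
  have hψ : ∀ j, HasGrad (fun x => ‖w x‖ ^ q * w x j)
      (fun i x => q * ‖w x‖ ^ (q - 2) * (∑ k, w x k * w' i k x) * w x j +
        ‖w x‖ ^ q * w' i j x) := fun j => (HasGrad.norm_rpow h.gradw hq).mul (h.gradw j)
  have hmass := h.mass _ _ hφ
  have hmom := fun j => h.momentum j _ _ (hψ j)
  have cm : ∀ i, Continuous fun x => r x * w x i - r' i x := fun i =>
    (hc1.mul (hcw i)).sub (hcr' i)
  have iA : ∀ i, Integrable fun x => (r x * w x i - r' i x) *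
      ((q + 2) * ‖w x‖ ^ q * ∑ j, w x j * w' i j x) := fun i =>
    Continuous.integrable_torus ((cm i).mul (hφ.cont' i))
  have iB : ∀ j, Integrable fun x => r x ^ γ *
      (q * ‖w x‖ ^ (q - 2) * (∑ k, w x k * w' j k x) * w x j + ‖w x‖ ^ q * w' j j x) := fun j =>
    Continuous.integrable_torus (hcγ.mul ((hψ j).cont' j))
  have iC : ∀ j i, Integrable fun x => (r x * w x i - r' i x) * w' i j x * (‖w x‖ ^ q * w x j) +
      r x * w' i j x * (q * ‖w x‖ ^ (q - 2) * (∑ k, w x k * w' i k x) * w x j +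
        ‖w x‖ ^ q * w' i j x) := fun j i =>
    Continuous.integrable_torus ((((cm i).mul (hcw' i j)).mul (hψ j).cont).add
      ((hc1.mul (hcw' i j)).mul ((hψ j).cont' i)))
  have iT : ∀ j, Integrable fun x => (q + 2) * (r x * wt x j * (‖w x‖ ^ q * w x j)) := fun j =>
    (integrable_mul_continuous (integrable_continuous_mul hc1 (h.wt_int j)) (hψ j).cont).const_mul _
  have iCs : ∀ j, Integrable fun x =>
      ∑ i, ((r x * w x i - r' i x) * w' i j x * (‖w x‖ ^ q * w x j) +
      r x * w' i j x * (q * ‖w x‖ ^ (q - 2) * (∑ k, w x k * w' i k x) * w x j +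
        ‖w x‖ ^ q * w' i j x)) := fun j => integrable_finsetSum _ fun i _ => iC j i
  have iD := fun j => (iB j).sub (iCs j)
  simp only [Pi.sub_def] at iD
  have iF := (integrable_finsetSum Finset.univ fun i _ => iA i).add
    ((integrable_finsetSum Finset.univ fun j _ => iD j).const_mul (q + 2))
  rw [integral_add (integrable_mul_continuous h.rt_int hφ.cont)
    (integrable_finsetSum _ fun j _ => iT j), integral_finsetSum _ fun j _ => iT j, hmass]
  simp only [integral_const_mul, hmom]
  have e : ∀ j, (∫ x, r x ^ γ *
      (q * ‖w x‖ ^ (q - 2) * (∑ k, w x k * w' j k x) * w x j + ‖w x‖ ^ q * w' j j x)) -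
      ∑ i, ∫ x, ((r x * w x i - r' i x) * w' i j x * (‖w x‖ ^ q * w x j) +
      r x * w' i j x * (q * ‖w x‖ ^ (q - 2) * (∑ k, w x k * w' i k x) * w x j +
        ‖w x‖ ^ q * w' i j x)) = ∫ x, (r x ^ γ *
      (q * ‖w x‖ ^ (q - 2) * (∑ k, w x k * w' j k x) * w x j + ‖w x‖ ^ q * w' j j x) -
      ∑ i, ((r x * w x i - r' i x) * w' i j x * (‖w x‖ ^ q * w x j) +
      r x * w' i j x * (q * ‖w x‖ ^ (q - 2) * (∑ k, w x k * w' i k x) * w x j +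
        ‖w x‖ ^ q * w' i j x))) := fun j => by
    rw [integral_sub (iB j) (iCs j), integral_finsetSum _ fun i _ => iC j i]
  simp only [e]
  rw [← Finset.mul_sum, ← integral_finsetSum _ fun j _ => iD j,
    ← integral_finsetSum _ fun i _ => iA i, ← integral_const_mul, ← integral_add
    (integrable_finsetSum _ fun i _ => iA i)
    ((integrable_finsetSum _ fun j _ => iD j).const_mul _)]
  have iY : Integrable fun x => r x * ‖w x‖ ^ (q + 2) :=
    Continuous.integrable_torus (hc1.mul hφ.cont)
  have iW : Integrable fun x => r x ^ 5 := (hc1.pow 5).integrable_torus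
  have i1 : Integrable fun _ : Torus3 => (1 : ℝ) := integrable_const _
  have eR : (∫ x, r x * ‖w x‖ ^ (q + 2)) + 1 + ∫ x, r x ^ 5 =
      ∫ x, (r x * ‖w x‖ ^ (q + 2) + 1 + r x ^ 5) := by
    have i2 : Integrable fun x => r x * ‖w x‖ ^ (q + 2) + 1 := iY.add i1
    rw [integral_add i2 iW, integral_add iY i1]
    simp
  rw [eR, ← integral_const_mul]
  refine integral_mono iF (((iY.add i1).add iW).const_mul _) fun x => ?_
  have hr := h.pos x
  have hz := norm_nonneg (w x)
  refine (weighted_dissipation_le (q := q) (z := ‖w x‖) (g := r x ^ (2 * γ - 1))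
    (W := fun j => w x j) (d := fun i j => w' i j x) (m := fun i => r x * w x i - r' i x)
    (b := fun i => ∑ k, w x k * w' i k x) (fun i => rfl) (by positivity) (by positivity) hr ?_ ?_
    ?_ (by linarith)).trans ?_
  · rw [← Real.rpow_one_add' hr.le (by linarith), ← Real.rpow_natCast, ← Real.rpow_mul hr.le]
    congr 1; push_cast; ring
  · rw [EuclideanSpace.norm_sq_eq]; simp
  · rw [mul_assoc, ← Real.rpow_two, ← Real.rpow_add' hz (by linarith)]
    congr 2; ring
  · exact mul_le_mul_of_nonneg_left (rpow_mul_rpow_le hγ (by linarith) hs hr hz) (by positivity)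

end Snapshot

/-! ## The `L³` estimate and the Moser step -/

/-- Complete the square in $\varepsilon r^2+\operatorname{div}v$ and use
$(\operatorname{div}v)^2\le3|\nabla v|^2$. -/
theorem neg_two_mul_pow_three_mul_le {r ε : ℝ} (hr : 0 < r) (hε : 0 < ε) (d : Fin 3 → Fin 3 → ℝ) :
    -2 * (r ^ 3 * ∑ i, d i i) ≤ ε * r ^ 5 + 3 / ε * (r * ∑ i, ∑ j, d i j ^ 2) := by
  have h1 : (∑ i, d i i) ^ 2 ≤ 3 * ∑ i, ∑ j, d i j ^ 2 := by
    simp only [Fin.sum_univ_three]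
    nlinarith [sq_nonneg (d 0 0 - d 1 1), sq_nonneg (d 0 0 - d 2 2), sq_nonneg (d 1 1 - d 2 2),
      sq_nonneg (d 0 1), sq_nonneg (d 0 2), sq_nonneg (d 1 0), sq_nonneg (d 1 2),
      sq_nonneg (d 2 0), sq_nonneg (d 2 1)]
  have h2 : 0 ≤ r / ε * (ε * r ^ 2 + ∑ i, d i i) ^ 2 := by positivity
  have h3 : r / ε * (ε * r ^ 2 + ∑ i, d i i) ^ 2 =
      ε * r ^ 5 + 2 * (r ^ 3 * ∑ i, d i i) + r / ε * (∑ i, d i i) ^ 2 := by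
    field_simp
    ring
  have h4 : r / ε * (∑ i, d i i) ^ 2 ≤ r / ε * (3 * ∑ i, ∑ j, d i j ^ 2) := by gcongr
  have h5 : r / ε * (3 * ∑ i, ∑ j, d i j ^ 2) = 3 / ε * (r * ∑ i, ∑ j, d i j ^ 2) := by ring
  linarith

theorem sq_le_mul_add_pow_six {z κ : ℝ} (hz : 0 ≤ z) (hκ : 0 < κ) :
    z ^ 2 ≤ κ * z + (κ ^ 4)⁻¹ * z ^ 6 := by
  rcases le_total z κ with h | h
  · have : 0 ≤ (κ ^ 4)⁻¹ * z ^ 6 := by positivity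
    nlinarith
  · have h1 : z ^ 2 ≤ (κ ^ 4)⁻¹ * z ^ 6 := by
      rw [inv_mul_eq_div, le_div_iff₀ (by positivity)]
      calc z ^ 2 * κ ^ 4 ≤ z ^ 2 * z ^ 4 := by gcongr
        _ = z ^ 6 := by ring
    have : 0 ≤ κ * z := by positivity
    linarith

theorem sq_le_one_add_rpow {z q : ℝ} (hz : 0 ≤ z) (hq : 0 ≤ q) : z ^ 2 ≤ 1 + z ^ (q + 2) := by
  rcases le_total z 1 with h | h
  · have : z ^ 2 ≤ 1 := pow_le_one₀ hz h
    have : 0 ≤ z ^ (q + 2) := by positivity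
    linarith
  · have := Real.rpow_le_rpow_of_exponent_le h (show (2 : ℝ) ≤ q + 2 by linarith)
    rw [Real.rpow_two] at this
    linarith

/-- Three regimes: $r\le1$, then $z\le l$, then $z\ge l$ with $r\ge1$. In the last, $z^3\le
l^{1-q}z^{q+2}$, so $z^2$ is bounded in $L^{3/2}$ with a factor that is small for large $l$ because
$q>1$. -/
theorem pow_mul_sq_le {q r z l : ℝ} {n : ℕ} (hn : 1 ≤ n) (hq : 1 < q) (hr : 0 < r) (hz : 0 ≤ z)
    (hl : 1 ≤ l) : r ^ (2 * n) * z ^ 2 ≤ (1 + r * z ^ (q + 2)) + l ^ 2 * r ^ (2 * n) +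
      r ^ (2 * n) * (l ^ (1 - q) * (r * z ^ (q + 2))) ^ (2 / 3 : ℝ) := by
  have p1 : 0 ≤ r * z ^ (q + 2) := by positivity
  have p2 : 0 ≤ l ^ 2 * r ^ (2 * n) := by positivity
  have p3 : 0 ≤ r ^ (2 * n) * (l ^ (1 - q) * (r * z ^ (q + 2))) ^ (2 / 3 : ℝ) := by positivity
  rcases le_total r 1 with h | h
  · have h1 : r ^ (2 * n) ≤ r := pow_le_of_le_one hr.le h (by omega)
    have h2 := sq_le_one_add_rpow hz (show 0 ≤ q by linarith)
    have : r ^ (2 * n) * z ^ 2 ≤ r * (1 + z ^ (q + 2)) := by gcongr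
    linarith
  · rcases le_total z l with h' | h'
    · have : r ^ (2 * n) * z ^ 2 ≤ r ^ (2 * n) * l ^ 2 := by gcongr
      linarith
    · have hl0 : 0 < l := by linarith
      have h1 : z ^ 2 ≤ (l ^ (1 - q) * (r * z ^ (q + 2))) ^ (2 / 3 : ℝ) := by
        have h2 : z ^ 3 ≤ l ^ (1 - q) * (r * z ^ (q + 2)) := by
          have e : z ^ (q + 2) = z ^ (q - 1) * z ^ 3 := by
            rw [← Real.rpow_natCast z 3, ← Real.rpow_add (by linarith)]
            congr 1; push_cast; ring
          have h3 : 1 ≤ l ^ (1 - q) * z ^ (q - 1) := by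
            rw [show 1 - q = -(q - 1) by ring, Real.rpow_neg hl0.le, inv_mul_eq_div,
              one_le_div (by positivity)]
            exact Real.rpow_le_rpow hl0.le h' (by linarith)
          calc z ^ 3 = 1 * (1 * z ^ 3) := by ring
            _ ≤ (l ^ (1 - q) * z ^ (q - 1)) * (r * z ^ 3) := by gcongr
            _ = _ := by rw [e]; ring
        calc z ^ 2 = (z ^ 3) ^ (2 / 3 : ℝ) := by
              rw [← Real.rpow_natCast z 3, ← Real.rpow_mul hz, ← Real.rpow_natCast]
              congr 1; norm_num
          _ ≤ _ := Real.rpow_le_rpow (by positivity) h2 (by norm_num)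
      have : r ^ (2 * n) * z ^ 2 ≤
          r ^ (2 * n) * (l ^ (1 - q) * (r * z ^ (q + 2))) ^ (2 / 3 : ℝ) := by gcongr
      linarith

namespace Snapshot

variable {γ : ℝ} {r : Torus3 → ℝ} {r' : Fin 3 → Torus3 → ℝ}
  {w : Torus3 → EuclideanSpace ℝ (Fin 3)} {w' : Fin 3 → Fin 3 → Torus3 → ℝ}
  {rt : Torus3 → ℝ} {wt : Torus3 → EuclideanSpace ℝ (Fin 3)}

/-- Hölder on $r^2\cdot r^3$ with exponents $3/2$ and $3$, then `sobolev_pow` with `p = 3`; the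
factor $P^{2/3}$ is weakened to $1+P$. -/
theorem integral_pow_five_le (h : Snapshot γ r r' w w' rt wt) :
    ∫ x, r x ^ 5 ≤ (1 + ∫ x, r x ^ 3) *
      (2 * (∫ x, r x ^ 3) + 216 * ∑ i, ∫ x, r x * r' i x ^ 2) := by
  have hc := h.grad.cont
  have h0 := fun x => (h.pos x).le
  have h1 := sobolev_pow h.grad h.pos (p := 3) (by norm_num)
  have h2 := integral_mul_le_rpow (a := fun x => r x ^ 2) (b := fun x => r x ^ 3) (hc.pow 2)
    (hc.pow 3) (fun x => pow_nonneg (h0 x) _) (fun x => pow_nonneg (h0 x) _)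
    (p := 3 / 2) (q := 3) (by rw [Real.holderConjugate_iff]; norm_num)
  have e1 : ∀ x, (r x ^ 2) ^ (3 / 2 : ℝ) = r x ^ 3 := fun x => by
    rw [← Real.rpow_natCast, ← Real.rpow_mul (h0 x), ← Real.rpow_natCast]
    congr 1; norm_num
  have e2 : ∀ x, (r x ^ 3) ^ (3 : ℝ) = r x ^ (3 * 3) := fun x => by
    rw [← Real.rpow_natCast, ← Real.rpow_mul (h0 x), ← Real.rpow_natCast]
    congr 1; norm_num
  have e3 : ∀ x, r x ^ 2 * r x ^ 3 = r x ^ 5 := fun x => by ring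
  simp only [e1, e2, e3] at h2
  have hP : 0 ≤ ∫ x, r x ^ 3 := integral_nonneg fun x => pow_nonneg (h0 x) _
  have h3 : (∫ x, r x ^ 3) ^ (1 / (3 / 2) : ℝ) ≤ 1 + ∫ x, r x ^ 3 := by
    rcases le_total (∫ x, r x ^ 3) 1 with h | h
    · have := Real.rpow_le_one hP h (show (0 : ℝ) ≤ 1 / (3 / 2) by norm_num)
      linarith
    · have := Real.rpow_le_rpow_of_exponent_le h (show (1 / (3 / 2) : ℝ) ≤ 1 by norm_num)
      rw [Real.rpow_one] at this
      linarith
  norm_num at h1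
  refine h2.trans (mul_le_mul h3 h1 ?_ (by linarith))
  exact Real.rpow_nonneg (integral_nonneg fun x => pow_nonneg (h0 x) _) _

theorem integral_cube_deriv_le (h : Snapshot γ r r' w w' rt wt) :
    ∫ x, 3 * r x ^ 2 * rt x ≤ -3 * (∑ i, ∫ x, r x * r' i x ^ 2) +
      (1 + ∫ x, r x ^ 3) * (1 + 216 * ∫ x, r x * ∑ i, ∑ j, w' i j x ^ 2) := by
  have hc := h.grad.cont
  have hcr' := h.grad.cont'
  have hcw : ∀ j, Continuous fun x => w x j := fun j => (h.gradw j).cont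
  have hcw' : ∀ i j, Continuous (w' i j) := fun i j => (h.gradw j).cont' i
  have h1 := h.integral_pow_mul 1
  norm_num at h1
  have iG : ∀ i, Integrable fun x => r x * r' i x ^ 2 := fun i =>
    Continuous.integrable_torus (hc.mul ((hcr' i).pow 2))
  have iA : ∀ i, Integrable fun x => 3 * r x ^ 2 * r' i x * w x i := fun i =>
    Continuous.integrable_torus (((continuous_const.mul (hc.pow 2)).mul (hcr' i)).mul (hcw i))
  have iB : ∀ i, Integrable fun x => r x ^ 3 * w' i i x := fun i =>
    Continuous.integrable_torus ((hc.pow 3).mul (hcw' i i))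
  have hparts : ∀ i, ∫ x, r x ^ 3 * w' i i x = -∫ x, 3 * r x ^ 2 * r' i x * w x i := fun i =>
    (h.grad.pow 3).integral_mul_deriv (h.gradw i) i
  have e1 : 6 * ∫ x, ∑ i, (r x * w x i - r' i x) * (r x * r' i x) =
      -2 * (∫ x, r x ^ 3 * ∑ i, w' i i x) - 6 * ∑ i, ∫ x, r x * r' i x ^ 2 := by
    have e2 : ∀ x, ∑ i, (r x * w x i - r' i x) * (r x * r' i x) =
        ∑ i, (1 / 3 * (3 * r x ^ 2 * r' i x * w x i) - r x * r' i x ^ 2) := fun x =>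
      Finset.sum_congr rfl fun i _ => by ring
    have iE : ∀ i, Integrable fun x =>
        1 / 3 * (3 * r x ^ 2 * r' i x * w x i) - r x * r' i x ^ 2 := fun i =>
      ((iA i).const_mul _).sub (iG i)
    have e3 : ∀ i, ∫ x, (1 / 3 * (3 * r x ^ 2 * r' i x * w x i) - r x * r' i x ^ 2) =
        -(1 / 3) * (∫ x, r x ^ 3 * w' i i x) - ∫ x, r x * r' i x ^ 2 := fun i => by
      rw [integral_sub ((iA i).const_mul _) (iG i), integral_const_mul, hparts]
      ring
    simp only [e2]
    rw [integral_finsetSum _ fun i _ => iE i]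
    simp only [e3, Finset.mul_sum]
    rw [integral_finsetSum _ fun i _ => iB i]
    simp only [Fin.sum_univ_three]
    ring
  rw [e1] at h1
  have hP : 0 ≤ ∫ x, r x ^ 3 := integral_nonneg fun x => pow_nonneg (h.pos x).le _
  set P := ∫ x, r x ^ 3 with hPdef
  set G := ∑ i, ∫ x, r x * r' i x ^ 2 with hG
  -- Chosen so that $\varepsilon\int r^5\le P/36+3G$: half of the dissipation $6G$ survives, and
  -- $3/\varepsilon=216(1+P)$ suits a logarithmic Gronwall argument.
  set ε : ℝ := 1 / (72 * (1 + P)) with hε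
  have hε0 : 0 < ε := by positivity
  have iW : Integrable fun x => r x ^ 5 := (hc.pow 5).integrable_torus
  have iD : Integrable fun x => r x * ∑ i, ∑ j, w' i j x ^ 2 := Continuous.integrable_torus
    (hc.mul (continuous_finsetSum _ fun i _ => continuous_finsetSum _ fun j _ =>
      (hcw' i j).pow 2))
  have iBs : Integrable fun x => r x ^ 3 * ∑ i, w' i i x := Continuous.integrable_torus
    ((hc.pow 3).mul (continuous_finsetSum _ fun i _ => hcw' i i))
  have h2 : -2 * (∫ x, r x ^ 3 * ∑ i, w' i i x) ≤
      ε * (∫ x, r x ^ 5) + 3 / ε * ∫ x, r x * ∑ i, ∑ j, w' i j x ^ 2 := by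
    rw [← integral_const_mul, ← integral_const_mul, ← integral_const_mul,
      ← integral_add (iW.const_mul _) (iD.const_mul _)]
    exact integral_mono (iBs.const_mul _) ((iW.const_mul _).add (iD.const_mul _)) fun x =>
      neg_two_mul_pow_three_mul_le (h.pos x) hε0 fun i j => w' i j x
  have h3 : ε * (∫ x, r x ^ 5) ≤ P / 36 + 3 * G := by
    calc _ ≤ ε * ((1 + P) * (2 * P + 216 * G)) :=
          mul_le_mul_of_nonneg_left h.integral_pow_five_le hε0.le
      _ = _ := by rw [hε]; field_simp; ring
  have h4 : 3 / ε = 216 * (1 + P) := by rw [hε]; field_simp; norm_num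
  rw [h4] at h2
  rw [h1]
  nlinarith

/-- Test the mass equation with $r^{2n-1}$ and apply Young to the flux: $(rw-\nabla r)\cdot\nabla
r\le\frac12(r^2|w|^2-|\nabla r|^2)$. No derivative of the velocity appears. -/
theorem integral_pow_mul_le (h : Snapshot γ r r' w w' rt wt) {n : ℕ} (hn : 1 ≤ n) :
    ∫ x, ((2 * n : ℕ) : ℝ) * r x ^ (2 * n - 1) * rt x ≤
      n * (2 * n - 1) * (-(∑ i, ∫ x, r x ^ (2 * n - 2) * r' i x ^ 2) +
        ∫ x, r x ^ (2 * n) * ‖w x‖ ^ 2) := by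
  obtain ⟨k, rfl⟩ := Nat.exists_eq_add_of_le' hn
  have h1 := h.integral_pow_mul (2 * k)
  have hc := h.grad.cont
  have hcr' := h.grad.cont'
  have hcw : ∀ j, Continuous fun x => w x j := fun j => (h.gradw j).cont
  rw [show 2 * (k + 1) - 1 = 2 * k + 1 by omega, show 2 * (k + 1) - 2 = 2 * k by omega]
  rw [show 2 * (k + 1) = 2 * k + 2 by ring, h1]
  have iG : ∀ i, Integrable fun x => r x ^ (2 * k) * r' i x ^ 2 := fun i =>
    Continuous.integrable_torus ((hc.pow _).mul ((hcr' i).pow 2))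
  have iZ : Integrable fun x => r x ^ (2 * k + 2) * ‖w x‖ ^ 2 :=
    Continuous.integrable_torus ((hc.pow _).mul (h.continuous_velocity.norm.pow 2))
  have iA : Integrable fun x => ∑ i, (r x * w x i - r' i x) * (r x ^ (2 * k) * r' i x) :=
    integrable_finsetSum _ fun i _ => Continuous.integrable_torus
      (((hc.mul (hcw i)).sub (hcr' i)).mul ((hc.pow _).mul (hcr' i)))
  have iR : Integrable fun x => -(1 / 2) * (∑ i, r x ^ (2 * k) * r' i x ^ 2) +
      1 / 2 * (r x ^ (2 * k + 2) * ‖w x‖ ^ 2) :=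
    ((integrable_finsetSum _ fun i _ => iG i).const_mul _).add (iZ.const_mul _)
  have h2 : ∫ x, ∑ i, (r x * w x i - r' i x) * (r x ^ (2 * k) * r' i x) ≤
      1 / 2 * (-(∑ i, ∫ x, r x ^ (2 * k) * r' i x ^ 2) + ∫ x, r x ^ (2 * k + 2) * ‖w x‖ ^ 2) := by
    calc _ ≤ ∫ x, (-(1 / 2) * (∑ i, r x ^ (2 * k) * r' i x ^ 2) +
          1 / 2 * (r x ^ (2 * k + 2) * ‖w x‖ ^ 2)) := by
          refine integral_mono iA iR fun x => ?_
          have hp : 0 ≤ r x ^ (2 * k) := pow_nonneg (h.pos x).le _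
          have e : ‖w x‖ ^ 2 = ∑ j, w x j ^ 2 := by rw [EuclideanSpace.norm_sq_eq]; simp
          simp only [e, pow_add, Fin.sum_univ_three]
          nlinarith [mul_nonneg hp (sq_nonneg (r x * w x 0 - r' 0 x)),
            mul_nonneg hp (sq_nonneg (r x * w x 1 - r' 1 x)),
            mul_nonneg hp (sq_nonneg (r x * w x 2 - r' 2 x))]
      _ = _ := by
          rw [integral_add ((integrable_finsetSum _ fun i _ => iG i).const_mul _)
            (iZ.const_mul _), integral_const_mul, integral_const_mul,
            integral_finsetSum _ fun i _ => iG i]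
          ring
  push_cast
  calc _ ≤ ((2 * k : ℝ) + 2) * (2 * k + 1) * (1 / 2 *
        (-(∑ i, ∫ x, r x ^ (2 * k) * r' i x ^ 2) + ∫ x, r x ^ (2 * k + 2) * ‖w x‖ ^ 2)) :=
        mul_le_mul_of_nonneg_left h2 (by positivity)
    _ = _ := by ring

/-- One step of the Moser iteration. -/
theorem moser_step (h : Snapshot γ r r' w w' rt wt) {q Y l a : ℝ} {n : ℕ} (hn : 1 ≤ n)
    (hq : 1 < q) (hl : 1 ≤ l) (hY : ∫ x, r x * ‖w x‖ ^ (q + 2) ≤ Y)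
    (hδ : (l ^ (1 - q) * Y) ^ (2 / 3 : ℝ) ≤ 1 / (384 * n ^ 2)) (ha : a = 3 * n ^ 2 * l ^ 2) :
    ∫ x, ((2 * n : ℕ) : ℝ) * r x ^ (2 * n - 1) * rt x ≤
      2 * n ^ 2 * (1 + Y) + a * (384 * a) ^ 6 / 4 * (∫ x, r x ^ n) ^ 2 := by
  have hc := h.grad.cont
  have h0 := fun x => (h.pos x).le
  have hn' : (1 : ℝ) ≤ n := by exact_mod_cast hn
  have hcy : Continuous fun x => r x * ‖w x‖ ^ (q + 2) :=
    hc.mul (h.continuous_velocity.norm.rpow_const fun x => Or.inr (by linarith))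
  have hy0 : ∀ x, 0 ≤ r x * ‖w x‖ ^ (q + 2) := fun x => by have := h0 x; positivity
  have hl0 : 0 < l := by linarith
  have hcu : Continuous fun x => (l ^ (1 - q) * (r x * ‖w x‖ ^ (q + 2))) ^ (2 / 3 : ℝ) :=
    (continuous_const.mul hcy).rpow_const fun x => Or.inr (by norm_num)
  have hu0 : ∀ x, 0 ≤ (l ^ (1 - q) * (r x * ‖w x‖ ^ (q + 2))) ^ (2 / 3 : ℝ) := fun x => by
    have := hy0 x; positivity
  have ipow : ∀ m : ℕ, Integrable fun x => r x ^ m := fun m => (hc.pow m).integrable_torus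
  set S := (∫ x, r x ^ (3 * (2 * n))) ^ (1 / 3 : ℝ) with hS
  set G := ∑ i, ∫ x, r x ^ (2 * n - 2) * r' i x ^ 2 with hG
  set P := ∫ x, r x ^ (2 * n) with hP
  set B := ∫ x, r x ^ n with hB
  have hG0 : 0 ≤ G := Finset.sum_nonneg fun i _ => integral_nonneg fun x => by
    have := h0 x; positivity
  have hPpos : 0 ≤ P := integral_nonneg fun x => pow_nonneg (h0 x) _
  have hSob : S ≤ 2 * P + 96 * n ^ 2 * G := by
    have := sobolev_pow h.grad h.pos (p := 2 * n) (by omega)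
    push_cast at this
    linarith
  have hI6 : 0 < ∫ x, r x ^ (3 * (2 * n)) := by
    obtain ⟨c, hc0, hcr⟩ : ∃ c, 0 < c ∧ ∀ x, c ≤ r x := by
      obtain ⟨x, -, hx⟩ := isCompact_univ.exists_isMinOn univ_nonempty hc.continuousOn
      exact ⟨r x, h.pos x, fun y => hx (mem_univ y)⟩
    calc 0 < c ^ (3 * (2 * n)) := by positivity
      _ = ∫ _ : Torus3, c ^ (3 * (2 * n)) := by simp
      _ ≤ _ := integral_mono (integrable_const _) (ipow _) fun x =>
        pow_le_pow_left₀ hc0.le (hcr x) _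
  have hSpos : 0 < S := Real.rpow_pos_of_pos hI6 _
  have hS3 : ∫ x, r x ^ (3 * (2 * n)) = S ^ 3 := by
    rw [hS, ← Real.rpow_natCast, ← Real.rpow_mul hI6.le]
    norm_num
  -- Integrate the three-regime bound; Hölder with exponents 3 and 3/2 pairs the large-velocity part
  -- with $S=\|r^{2n}\|_{L^3}$.
  have hZ : ∫ x, r x ^ (2 * n) * ‖w x‖ ^ 2 ≤ 1 + Y + l ^ 2 * P + S * (1 / (384 * n ^ 2)) := by
    have i1 : Integrable fun x => 1 + r x * ‖w x‖ ^ (q + 2) :=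
      (integrable_const _).add hcy.integrable_torus
    have i2 : Integrable fun x => l ^ 2 * r x ^ (2 * n) := (ipow _).const_mul _
    have i3 : Integrable fun x => 1 + r x * ‖w x‖ ^ (q + 2) + l ^ 2 * r x ^ (2 * n) := i1.add i2
    have i4 : Integrable fun x =>
        r x ^ (2 * n) * (l ^ (1 - q) * (r x * ‖w x‖ ^ (q + 2))) ^ (2 / 3 : ℝ) :=
      Continuous.integrable_torus ((hc.pow _).mul hcu)
    have i5 : Integrable fun x => r x ^ (2 * n) * ‖w x‖ ^ 2 :=
      Continuous.integrable_torus ((hc.pow _).mul (h.continuous_velocity.norm.pow 2))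
    have h1 := integral_mono i5 (i3.add i4) fun x =>
      pow_mul_sq_le hn hq (h.pos x) (norm_nonneg (w x)) hl
    simp only [Pi.add_apply] at h1
    rw [integral_add i3 i4, integral_add i1 i2, integral_add (integrable_const _)
      hcy.integrable_torus, integral_const_mul] at h1
    have h2 := integral_mul_le_rpow (hc.pow (2 * n)) hcu (fun x => pow_nonneg (h0 x) _) hu0
      (p := 3) (q := 3 / 2) (by rw [Real.holderConjugate_iff]; norm_num)
    have e1 : ∀ x, ((r ^ (2 * n)) x) ^ (3 : ℝ) = r x ^ (3 * (2 * n)) := fun x => by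
      rw [Pi.pow_apply, ← Real.rpow_natCast, ← Real.rpow_mul (h0 x), ← Real.rpow_natCast]
      congr 1; push_cast; ring
    have e2 : ∀ x, ((l ^ (1 - q) * (r x * ‖w x‖ ^ (q + 2))) ^ (2 / 3 : ℝ)) ^ (3 / 2 : ℝ) =
        l ^ (1 - q) * (r x * ‖w x‖ ^ (q + 2)) := fun x => by
      rw [← Real.rpow_mul (mul_nonneg (by positivity) (hy0 x))]
      norm_num
    simp only [e1, e2, integral_const_mul] at h2
    have h3 : (l ^ (1 - q) * ∫ x, r x * ‖w x‖ ^ (q + 2)) ^ (1 / (3 / 2) : ℝ) ≤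
        1 / (384 * n ^ 2) := by
      refine le_trans ?_ hδ
      rw [show (1 / (3 / 2) : ℝ) = 2 / 3 by norm_num]
      refine Real.rpow_le_rpow (mul_nonneg (by positivity) (integral_nonneg hy0)) ?_ (by norm_num)
      gcongr
    have h4 := h2.trans (mul_le_mul_of_nonneg_left h3 hSpos.le)
    simp only [Pi.pow_apply] at h4
    simp only [integral_const, probReal_univ, one_smul] at h1
    linarith
  have ha0 : 3 ≤ a := by
    rw [ha]
    have : (1 : ℝ) ≤ n ^ 2 := one_le_pow₀ hn'
    have : (1 : ℝ) ≤ l ^ 2 := one_le_pow₀ hl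
    nlinarith
  -- With this value $2a\eta S=S/192$, precisely the Sobolev term left over: $S/96$ from dissipation
  -- minus $S/192$ spent on the large velocities.
  set η : ℝ := 1 / (384 * a) with hη
  have hη0 : 0 < η := by positivity
  have hη1 : η ≤ 1 := by
    rw [hη, div_le_one (by positivity)]; linarith
  -- Interpolate $r^{2n}$ between $r^n$ and $r^{6n}$ at the threshold $r^n=\sqrt S/\eta$, then apply
  -- Young to $\sqrt S\,B/\eta$.
  have hint : P ≤ 2 * η ^ 4 * S + B ^ 2 / (4 * η ^ 6) := by
    have hs : 0 < √S := Real.sqrt_pos.2 hSpos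
    have hs2 : √S ^ 2 = S := Real.sq_sqrt hSpos.le
    have i1 : Integrable fun x => √S / η * r x ^ n := (ipow n).const_mul _
    have i2 : Integrable fun x => ((√S / η) ^ 4)⁻¹ * r x ^ (3 * (2 * n)) := (ipow _).const_mul _
    have h1 : P ≤ ∫ x, (√S / η * r x ^ n + ((√S / η) ^ 4)⁻¹ * r x ^ (3 * (2 * n))) := by
      refine integral_mono (ipow _) (i1.add i2) fun x => ?_
      have := sq_le_mul_add_pow_six (pow_nonneg (h0 x) n) (div_pos hs hη0)
      rwa [← pow_mul, ← pow_mul, show n * 2 = 2 * n by ring,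
        show n * 6 = 3 * (2 * n) by ring] at this
    rw [integral_add i1 i2, integral_const_mul, integral_const_mul, hS3] at h1
    have e : ((√S / η) ^ 4)⁻¹ * S ^ 3 = η ^ 4 * S := by
      have h2 : √S ^ 4 = S ^ 2 := by
        rw [show √S ^ 4 = (√S ^ 2) ^ 2 by ring, hs2]
      rw [div_pow, h2]; field_simp
    rw [e] at h1
    have h2 : √S / η * B ≤ η ^ 4 * S + B ^ 2 / (4 * η ^ 6) := by
      have h3 : 0 ≤ (η ^ 2 * √S - B / (2 * η ^ 3)) ^ 2 := sq_nonneg _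
      have h4 : (η ^ 2 * √S - B / (2 * η ^ 3)) ^ 2 =
          η ^ 4 * √S ^ 2 + B ^ 2 / (4 * η ^ 6) - √S / η * B := by
        field_simp; ring
      rw [h4, hs2] at h3
      linarith
    linarith
  have hint2 : a * P ≤ S / 192 + a * (384 * a) ^ 6 / 4 * B ^ 2 := by
    have e1 : η ^ 4 ≤ η := pow_le_of_le_one hη0.le hη1 (by norm_num)
    calc a * P ≤ a * (2 * η * S + B ^ 2 / (4 * η ^ 6)) := by
          refine mul_le_mul_of_nonneg_left (hint.trans ?_) (by linarith)
          gcongr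
      _ = _ := by rw [hη]; field_simp; ring
  refine (h.integral_pow_mul_le hn).trans ?_
  set Z := ∫ x, r x ^ (2 * n) * ‖w x‖ ^ 2 with hZdef
  have hZ0 : 0 ≤ Z := integral_nonneg fun x => by have := h0 x; positivity
  have h1 : (n : ℝ) * (2 * n - 1) * (-G + Z) ≤ -(n ^ 2 * G) + 2 * n ^ 2 * Z := by
    nlinarith [mul_nonneg (mul_nonneg (by linarith : (0 : ℝ) ≤ n) (by linarith : (0 : ℝ) ≤ n - 1))
      hG0, mul_nonneg (by linarith : (0 : ℝ) ≤ n) hZ0]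
  have h2 : 2 * (n : ℝ) ^ 2 * Z ≤ 2 * n ^ 2 * (1 + Y) + 2 * n ^ 2 * l ^ 2 * P + S / 192 := by
    calc _ ≤ 2 * (n : ℝ) ^ 2 * (1 + Y + l ^ 2 * P + S * (1 / (384 * n ^ 2))) := by gcongr
      _ = _ := by field_simp; ring
  have h3 : P / 48 ≤ (n : ℝ) ^ 2 * l ^ 2 * P := by
    have : 1 ≤ (n : ℝ) ^ 2 * l ^ 2 := by rw [ha] at ha0; linarith
    nlinarith
  have h4 : a * P = 2 * n ^ 2 * l ^ 2 * P + n ^ 2 * l ^ 2 * P := by rw [ha]; ring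
  linarith

end Snapshot

/-! ## Lipschitz functions of time -/

/-- `f` is Lipschitz on `[0,T]` with a.e. derivative `f'`. -/
structure LipCurve (T : ℝ) (f f' : ℝ → ℝ) : Prop where
  lip : ∃ L, 0 ≤ L ∧ ∀ s ∈ Icc 0 T, ∀ t ∈ Icc 0 T, |f t - f s| ≤ L * |t - s|
  ae_hasDerivAt : ∀ᵐ t ∂(volume.restrict (Ioo 0 T)), HasDerivAt f (f' t) t

namespace LipCurve

variable {T : ℝ} {f f' g g' : ℝ → ℝ}

theorem add (hf : LipCurve T f f') (hg : LipCurve T g g') :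
    LipCurve T (fun t => f t + g t) (fun t => f' t + g' t) := by
  obtain ⟨L, hL0, hL⟩ := hf.lip
  obtain ⟨K, hK0, hK⟩ := hg.lip
  refine ⟨⟨L + K, by positivity, fun s hs t ht => ?_⟩, ?_⟩
  · rw [add_sub_add_comm, add_mul]
    exact (abs_add_le _ _).trans (add_le_add (hL s hs t ht) (hK s hs t ht))
  · filter_upwards [hf.ae_hasDerivAt, hg.ae_hasDerivAt] with t h1 h2
    exact h1.add h2

theorem const_mul (hf : LipCurve T f f') (c : ℝ) :
    LipCurve T (fun t => c * f t) (fun t => c * f' t) := by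
  obtain ⟨L, hL0, hL⟩ := hf.lip
  refine ⟨⟨|c| * L, by positivity, fun s hs t ht => ?_⟩, ?_⟩
  · rw [← mul_sub, abs_mul, mul_assoc]
    exact mul_le_mul_of_nonneg_left (hL s hs t ht) (abs_nonneg _)
  · filter_upwards [hf.ae_hasDerivAt] with t h1
    exact h1.const_mul c

/-- Passing to $\log(1+f)$ turns Gronwall inequalities into upper bounds on a derivative, to which
`le_add_mul` applies. -/
theorem log_one_add (hf : LipCurve T f f') (h0 : ∀ t ∈ Icc 0 T, 0 ≤ f t) :
    LipCurve T (fun t => Real.log (1 + f t)) (fun t => f' t / (1 + f t)) := by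
  obtain ⟨L, hL0, hL⟩ := hf.lip
  have key : ∀ a b : ℝ, 0 ≤ a → 0 ≤ b → Real.log (1 + a) - Real.log (1 + b) ≤ |a - b| := by
    intro a b ha hb
    rw [← Real.log_div (by positivity) (by positivity)]
    refine (Real.log_le_sub_one_of_pos (by positivity)).trans ?_
    rw [div_sub_one (by positivity), add_sub_add_left_eq_sub, div_le_iff₀ (by positivity)]
    nlinarith [le_abs_self (a - b), abs_nonneg (a - b)]
  refine ⟨⟨L, hL0, fun s hs t ht => le_trans ?_ (hL s hs t ht)⟩, ?_⟩
  · refine abs_sub_le_iff.2 ⟨key _ _ (h0 t ht) (h0 s hs), ?_⟩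
    rw [abs_sub_comm]
    exact key _ _ (h0 s hs) (h0 t ht)
  · filter_upwards [hf.ae_hasDerivAt, ae_restrict_mem measurableSet_Ioo] with t h1 ht
    have := h0 t (Ioo_subset_Icc_self ht)
    exact (h1.const_add 1).log (by positivity)

/-- Lipschitz functions are absolutely continuous, so the a.e. bound on the derivative can be
integrated. -/
theorem le_add_mul (hf : LipCurve T f f') {c : ℝ}
    (hc : ∀ᵐ t ∂(volume.restrict (Ioo 0 T)), f' t ≤ c) {t : ℝ} (ht : t ∈ Icc 0 T) :
    f t ≤ f 0 + c * t := by
  obtain ⟨L, hL0, hL⟩ := hf.lip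
  have hsub : uIcc 0 t ⊆ Icc 0 T := by
    rw [uIcc_of_le ht.1]; exact Icc_subset_Icc_right ht.2
  have hlip : LipschitzOnWith L.toNNReal f (uIcc 0 t) :=
    LipschitzOnWith.of_dist_le_mul fun x hx y hy => by
      rw [Real.dist_eq, Real.dist_eq, Real.coe_toNNReal _ hL0]
      exact hL y (hsub hy) x (hsub hx)
  have hac := hlip.absolutelyContinuousOnInterval
  have h1 := hac.integral_deriv_eq_sub
  have h2 : ∀ᵐ s ∂(volume.restrict (Icc 0 t)), deriv f s ≤ c := by
    rw [← restrict_Ioo_eq_restrict_Icc]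
    refine ae_restrict_of_ae_restrict_of_subset (Ioo_subset_Ioo_right ht.2) ?_
    filter_upwards [hf.ae_hasDerivAt, hc] with s h3 h4
    rwa [h3.deriv]
  have h3 := intervalIntegral.integral_mono_ae_restrict (g := fun _ => c) ht.1
    hac.intervalIntegrable_deriv intervalIntegrable_const h2
  rw [h1, intervalIntegral.integral_const, smul_eq_mul, sub_zero] at h3
  linarith

end LipCurve

/-! ### Time derivatives of the power, velocity and energy functionals -/

theorem RegularCurve.lipCurve {V : Type*} [NormedAddCommGroup V] [NormedSpace ℝ V]
    [FiniteDimensional ℝ V] {T : ℝ} {F G : ℝ → Torus3 → V} (hF : RegularCurve T F G)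
    {H : V → ℝ} (hH : ContDiff ℝ 1 H) {H' : V → V → ℝ} (hH' : ∀ z a, fderiv ℝ H z a = H' z a) :
    LipCurve T (fun t => ∫ x, H (F t x)) (fun t => ∫ x, H' (F t x) (G t x)) := by
  obtain ⟨h1, h2⟩ := hF.integral_comp hH
  exact ⟨h1, by simpa only [hH'] using h2⟩

theorem contDiff_fst_pow (n : ℕ) : ContDiff ℝ 1 (fun z : ℝ × EuclideanSpace ℝ (Fin 3) => z.1 ^ n) :=
  contDiff_fst.pow n

theorem fderiv_fst_pow (n : ℕ) (z a : ℝ × EuclideanSpace ℝ (Fin 3)) :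
    fderiv ℝ (fun z : ℝ × EuclideanSpace ℝ (Fin 3) => z.1 ^ n) z a = n * z.1 ^ (n - 1) * a.1 := by
  have h : HasFDerivAt (fun z : ℝ × EuclideanSpace ℝ (Fin 3) => z.1)
      (ContinuousLinearMap.fst ℝ ℝ (EuclideanSpace ℝ (Fin 3))) z := hasFDerivAt_fst
  rw [(h.pow n).fderiv]
  simp

theorem contDiff_fst_mul_norm_rpow {p : ℝ} (hp : 1 < p) :
    ContDiff ℝ 1 (fun z : ℝ × EuclideanSpace ℝ (Fin 3) => z.1 * ‖z.2‖ ^ p) :=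
  contDiff_fst.mul ((contDiff_norm_rpow hp).comp contDiff_snd)

theorem fderiv_fst_mul_norm_rpow {q : ℝ} (hq : 1 < q) (z a : ℝ × EuclideanSpace ℝ (Fin 3)) :
    fderiv ℝ (fun z : ℝ × EuclideanSpace ℝ (Fin 3) => z.1 * ‖z.2‖ ^ (q + 2)) z a =
      a.1 * ‖z.2‖ ^ (q + 2) + ∑ j, (q + 2) * (z.1 * a.2 j * (‖z.2‖ ^ q * z.2 j)) := by
  have h : HasFDerivAt (fun z : ℝ × EuclideanSpace ℝ (Fin 3) => z.1)
      (ContinuousLinearMap.fst ℝ ℝ (EuclideanSpace ℝ (Fin 3))) z := hasFDerivAt_fst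
  have h2 : HasFDerivAt (fun z : ℝ × EuclideanSpace ℝ (Fin 3) => z.2)
      (ContinuousLinearMap.snd ℝ ℝ (EuclideanSpace ℝ (Fin 3))) z := hasFDerivAt_snd
  have h3 := (hasFDerivAt_norm_rpow z.2 (p := q + 2) (by linarith)).comp z h2
  have h4 := (h.mul h3).fderiv
  simp only [Pi.mul_def, Function.comp_apply] at h4
  rw [h4]
  simp only [add_sub_cancel_right, add_apply,
    smul_apply, ContinuousLinearMap.comp_apply, ContinuousLinearMap.coe_fst',
    ContinuousLinearMap.coe_snd', innerSL_apply_apply, PiLp.inner_apply, smul_eq_mul,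
    Fin.sum_univ_three, RCLike.inner_apply, conj_trivial]
  ring

theorem contDiff_energy {γ : ℝ} (hγ : 1 < γ) :
    ContDiff ℝ 1 (fun z : ℝ × EuclideanSpace ℝ (Fin 3) =>
      1 / 2 * (z.1 * ‖z.2‖ ^ 2) + 1 / (γ - 1) * z.1 ^ γ) := by
  have h : ContDiff ℝ 1 fun r : ℝ => r ^ γ := by
    simpa using Real.contDiff_rpow_const_of_le (n := 1) (p := γ) (by simpa using hγ.le)
  exact (contDiff_const.mul (contDiff_fst.mul (contDiff_snd.norm_sq ℝ))).add
    (contDiff_const.mul (h.comp contDiff_fst))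

theorem fderiv_energy {γ : ℝ} (hγ : 1 < γ) (z a : ℝ × EuclideanSpace ℝ (Fin 3)) :
    fderiv ℝ (fun z : ℝ × EuclideanSpace ℝ (Fin 3) =>
      1 / 2 * (z.1 * ‖z.2‖ ^ 2) + 1 / (γ - 1) * z.1 ^ γ) z a =
      a.1 * (1 / 2 * ‖z.2‖ ^ 2 + γ / (γ - 1) * z.1 ^ (γ - 1)) + ∑ j, z.1 * a.2 j * z.2 j := by
  have h : HasFDerivAt (fun z : ℝ × EuclideanSpace ℝ (Fin 3) => z.1)
      (ContinuousLinearMap.fst ℝ ℝ (EuclideanSpace ℝ (Fin 3))) z := hasFDerivAt_fst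
  have h2 : HasFDerivAt (fun z : ℝ × EuclideanSpace ℝ (Fin 3) => z.2)
      (ContinuousLinearMap.snd ℝ ℝ (EuclideanSpace ℝ (Fin 3))) z := hasFDerivAt_snd
  have h3 := ((h.mul h2.norm_sq).const_mul (1 / 2)).add
    ((h.rpow_const (p := γ) (Or.inr hγ.le)).const_mul (1 / (γ - 1)))
  have h4 := h3.fderiv
  simp only [Pi.add_def, Pi.mul_def] at h4
  rw [h4]
  simp only [add_apply,
    smul_apply, ContinuousLinearMap.comp_apply, ContinuousLinearMap.coe_fst',
    ContinuousLinearMap.coe_snd', innerSL_apply_apply, PiLp.inner_apply, smul_eq_mul,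
    Fin.sum_univ_three, RCLike.inner_apply, conj_trivial, nsmul_eq_mul]
  push_cast
  ring

/-! ## A priori bounds along a solution -/

/-- The differential inequalities for the energy `E`, `P = ∫ρ³`, `W = ∫ρ⁵` and `Y = ∫ρ|v|^{q+2}`
bound `Y`. -/
theorem LipCurve.bootstrap {T τ e p y c : ℝ} {E E' P P' Y Y' W : ℝ → ℝ} (hTτ : T ≤ τ)
    (hc : 0 ≤ c) (hE : LipCurve T E E') (hP : LipCurve T P P') (hY : LipCurve T Y Y')
    (hE0 : ∀ t ∈ Icc 0 T, 0 ≤ E t) (hP0 : ∀ t ∈ Icc 0 T, 0 ≤ P t) (hY0 : ∀ t ∈ Icc 0 T, 0 ≤ Y t)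
    (hW0 : ∀ t ∈ Icc 0 T, 0 ≤ W t) (hEi : E 0 ≤ e) (hPi : P 0 ≤ p) (hYi : Y 0 ≤ y)
    (hae : ∀ᵐ t ∂(volume.restrict (Ioo 0 T)), ∃ D G, E' t ≤ -D ∧ 0 ≤ G ∧
      P' t ≤ -3 * G + (1 + P t) * (1 + 216 * D) ∧
      W t ≤ (1 + P t) * (2 * P t + 216 * G) ∧ Y' t ≤ c * (Y t + 1 + W t)) {M : ℝ}
    (hM : M = Real.exp (Real.log (1 + p) + 216 * e + τ)) {t : ℝ} (ht : t ∈ Icc 0 T) :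
    Y t ≤ Real.exp (Real.log (1 + y) + 72 * c * M ^ 2 * (Real.log (1 + p) + 216 * e) +
      c * (1 + 2 * M ^ 2 + 72 * M ^ 2) * τ) := by
  have h00 : (0 : ℝ) ∈ Icc 0 T := ⟨le_rfl, ht.1.trans ht.2⟩
  -- The weight 216 makes $E'\le-D$ cancel the dissipation in the growth rate of $\log(1+P)$.
  have hJ := (hP.log_one_add hP0).add (hE.const_mul 216)
  have hJ' : ∀ᵐ t ∂(volume.restrict (Ioo 0 T)), P' t / (1 + P t) + 216 * E' t ≤ 1 := by
    filter_upwards [hae, ae_restrict_mem measurableSet_Ioo] with t ⟨D, G, h1, h2, h3, _, _⟩ ht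
    have hp := hP0 t (Ioo_subset_Icc_self ht)
    have : P' t / (1 + P t) ≤ 1 + 216 * D := by
      rw [div_le_iff₀ (by positivity)]; linarith
    linarith
  have hl0 : Real.log (1 + P 0) ≤ Real.log (1 + p) :=
    Real.log_le_log (by linarith [hP0 0 h00]) (by linarith)
  have hlog : ∀ t ∈ Icc 0 T, 1 + P t ≤ M := by
    intro t ht
    have h1 := hJ.le_add_mul hJ' ht
    have h2 := hE0 t ht
    rw [hM, ← Real.log_le_iff_le_exp (by linarith [hP0 t ht])]
    linarith [ht.2]
  -- The rate of $\log(1+Y)$ contains `W`, hence `G`. Solving the inequality for `P'` for `G` gives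
  -- at most $72M^2(1+216D-l)$ in `W` beyond $2M^2$, with $l$ the rate of $\log(1+P)$; this weight
  -- cancels both $l$ and $D$.
  have hK := (hY.log_one_add hY0).add (hJ.const_mul (72 * c * M ^ 2))
  have hK' : ∀ᵐ t ∂(volume.restrict (Ioo 0 T)),
      Y' t / (1 + Y t) + 72 * c * M ^ 2 * (P' t / (1 + P t) + 216 * E' t) ≤
        c * (1 + 2 * M ^ 2 + 72 * M ^ 2) := by
    filter_upwards [hae, ae_restrict_mem measurableSet_Ioo] with t ⟨D, G, h1, h2, h3, h4, h5⟩ ht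
    have ht' := Ioo_subset_Icc_self ht
    have hp := hP0 t ht'
    have hw := hW0 t ht'
    have hy := hY0 t ht'
    have hm := hlog t ht'
    have hy' : Y' t / (1 + Y t) ≤ c * (1 + W t) := by
      rw [div_le_iff₀ (by positivity)]
      have : 0 ≤ c * (W t * Y t) := by positivity
      linarith
    set l := P' t / (1 + P t) with hl
    have hlP : P' t = l * (1 + P t) := by rw [hl]; field_simp
    rw [hlP] at h3
    have h6 : 3 * G ≤ (1 + P t) * (1 + 216 * D - l) := by linarith
    have h7 : 0 ≤ 1 + 216 * D - l :=
      nonneg_of_mul_nonneg_right (by linarith : 0 ≤ (1 + P t) * (1 + 216 * D - l)) (by linarith)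
    have h8 : W t ≤ 2 * M ^ 2 + 72 * M ^ 2 * (1 + 216 * D - l) := by
      calc W t ≤ (1 + P t) * (2 * (1 + P t) + 72 * ((1 + P t) * (1 + 216 * D - l))) := by
            refine h4.trans (mul_le_mul_of_nonneg_left ?_ (by linarith))
            linarith
        _ = (1 + P t) ^ 2 * (2 + 72 * (1 + 216 * D - l)) := by ring
        _ ≤ M ^ 2 * (2 + 72 * (1 + 216 * D - l)) := by gcongr
        _ = _ := by ring
    have h9 : c * (1 + W t) ≤ c * (1 + (2 * M ^ 2 + 72 * M ^ 2 * (1 + 216 * D - l))) := by gcongr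
    have h10 : 72 * c * M ^ 2 * (l + 216 * E' t) ≤ 72 * c * M ^ 2 * (l + 216 * (-D)) := by gcongr
    linarith
  have h1 := hK.le_add_mul hK' ht
  have h2 := hP0 t ht
  have h3 := hE0 t ht
  have hM0 : 0 ≤ 72 * c * M ^ 2 := by positivity
  have h4 : 0 ≤ Real.log (1 + P t) + 216 * E t :=
    add_nonneg (Real.log_nonneg (by linarith)) (by positivity)
  have h5 : Real.log (1 + Y 0) ≤ Real.log (1 + y) :=
    Real.log_le_log (by linarith [hY0 0 h00]) (by linarith)
  have h6 : 72 * c * M ^ 2 * (Real.log (1 + P 0) + 216 * E 0) ≤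
      72 * c * M ^ 2 * (Real.log (1 + p) + 216 * e) := by gcongr
  have h7 : c * (1 + 2 * M ^ 2 + 72 * M ^ 2) * t ≤ c * (1 + 2 * M ^ 2 + 72 * M ^ 2) * τ := by
    have := ht.2.trans hTτ
    gcongr
  have h8 := mul_nonneg hM0 h4
  have h9 : Real.log (1 + Y t) ≤ Real.log (1 + y) + 72 * c * M ^ 2 *
      (Real.log (1 + p) + 216 * e) + c * (1 + 2 * M ^ 2 + 72 * M ^ 2) * τ := by
    linarith
  rw [Real.log_le_iff_le_exp (by linarith [hY0 t ht])] at h9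
  linarith

/-- A solution on `[0,T]` that is a regular curve and whose states are `C¹` for a.e. time. -/
structure RegularSolution (γ T : ℝ) (ρ : ℝ → Torus3 → ℝ)
    (v : ℝ → Torus3 → EuclideanSpace ℝ (Fin 3)) (ρt : ℝ → Torus3 → ℝ)
    (vt : ℝ → Torus3 → EuclideanSpace ℝ (Fin 3)) : Prop where
  pos : ∀ t ∈ Icc 0 T, ∀ x, 0 < ρ t x
  cont : ∀ t ∈ Icc 0 T, Continuous (ρ t)
  curve : RegularCurve T (fun t x => (ρ t x, v t x)) (fun t x => (ρt t x, vt t x))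
  snap : ∀ᵐ t ∂(volume.restrict (Ioo 0 T)), ∃ r' w w',
    Snapshot γ (ρ t) r' w w' (ρt t) (vt t) ∧ v t =ᵐ[volume] w

namespace RegularSolution

variable {γ T : ℝ} {ρ ρt : ℝ → Torus3 → ℝ} {v vt : ℝ → Torus3 → EuclideanSpace ℝ (Fin 3)}

theorem lipCurve_pow (h : RegularSolution γ T ρ v ρt vt) (n : ℕ) :
    LipCurve T (fun t => ∫ x, ρ t x ^ n) (fun t => ∫ x, n * ρ t x ^ (n - 1) * ρt t x) :=
  h.curve.lipCurve (contDiff_fst_pow n) (fderiv_fst_pow n)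

theorem lipCurve_velocity (h : RegularSolution γ T ρ v ρt vt) {q : ℝ} (hq : 1 < q) :
    LipCurve T (fun t => ∫ x, ρ t x * ‖v t x‖ ^ (q + 2)) (fun t => ∫ x,
      (ρt t x * ‖v t x‖ ^ (q + 2) +
        ∑ j, (q + 2) * (ρ t x * vt t x j * (‖v t x‖ ^ q * v t x j)))) :=
  h.curve.lipCurve (contDiff_fst_mul_norm_rpow (by linarith)) (fderiv_fst_mul_norm_rpow hq)

theorem lipCurve_energy (h : RegularSolution γ T ρ v ρt vt) (hγ : 1 < γ) :
    LipCurve T (fun t => ∫ x, (1 / 2 * (ρ t x * ‖v t x‖ ^ 2) + 1 / (γ - 1) * ρ t x ^ γ))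
      (fun t => ∫ x, (ρt t x * (1 / 2 * ‖v t x‖ ^ 2 + γ / (γ - 1) * ρ t x ^ (γ - 1)) +
        ∑ j, ρ t x * vt t x j * v t x j)) :=
  h.curve.lipCurve (contDiff_energy hγ) (fderiv_energy hγ)

theorem mass_le (h : RegularSolution γ T ρ v ρt vt) {t : ℝ} (ht : t ∈ Icc 0 T) :
    ∫ x, ρ t x ≤ ∫ x, ρ 0 x := by
  have h1 := (h.lipCurve_pow 1).le_add_mul (c := 0) (by
    filter_upwards [h.snap] with t ⟨r', w, w', hs, _⟩
    have := hs.mass _ _ (HasGrad.const 1)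
    simp at this
    simp [this]) ht
  simpa using h1

theorem velocity_le (h : RegularSolution γ T ρ v ρt vt) {q τ e p y M : ℝ} (hγ : 1 < γ) (hq : 1 < q)
    (hs : (γ - 1) * (q + 2) + 1 ≤ 5) (hTτ : T ≤ τ)
    (hE : ∫ x, (1 / 2 * (ρ 0 x * ‖v 0 x‖ ^ 2) + 1 / (γ - 1) * ρ 0 x ^ γ) ≤ e)
    (hP : ∫ x, ρ 0 x ^ 3 ≤ p) (hY : ∫ x, ρ 0 x * ‖v 0 x‖ ^ (q + 2) ≤ y)
    (hM : M = Real.exp (Real.log (1 + p) + 216 * e + τ)) {t : ℝ} (ht : t ∈ Icc 0 T) :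
    ∫ x, ρ t x * ‖v t x‖ ^ (q + 2) ≤
      Real.exp (Real.log (1 + y) + 72 * ((q + 2) * (q + 3) / 4) * M ^ 2 *
        (Real.log (1 + p) + 216 * e) +
        (q + 2) * (q + 3) / 4 * (1 + 2 * M ^ 2 + 72 * M ^ 2) * τ) := by
  have hγ1 : 0 < γ - 1 := by linarith
  refine LipCurve.bootstrap (W := fun t => ∫ x, ρ t x ^ 5) hTτ (by positivity)
    (h.lipCurve_energy hγ) (h.lipCurve_pow 3) (h.lipCurve_velocity hq)
    (fun t ht => integral_nonneg fun x => ?_) (fun t ht => integral_nonneg fun x => ?_)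
    (fun t ht => integral_nonneg fun x => ?_) (fun t ht => integral_nonneg fun x => ?_)
    hE hP hY ?_ hM ht
  · have := h.pos t ht x; positivity
  · have := h.pos t ht x; positivity
  · have := h.pos t ht x; positivity
  · have := h.pos t ht x; positivity
  filter_upwards [h.snap] with t ⟨r', w, w', hsn, hvw⟩
  have hr := fun x => (hsn.pos x).le
  have e1 : ∫ x, (ρt t x * (1 / 2 * ‖v t x‖ ^ 2 + γ / (γ - 1) * ρ t x ^ (γ - 1)) +
      ∑ j, ρ t x * vt t x j * v t x j) =
      ∫ x, (ρt t x * (1 / 2 * ‖w x‖ ^ 2 + γ / (γ - 1) * ρ t x ^ (γ - 1)) +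
      ∑ j, ρ t x * vt t x j * w x j) :=
    integral_congr_ae (by filter_upwards [hvw] with x hx; rw [hx])
  have e2 : ∫ x, (ρt t x * ‖v t x‖ ^ (q + 2) +
      ∑ j, (q + 2) * (ρ t x * vt t x j * (‖v t x‖ ^ q * v t x j))) =
      ∫ x, (ρt t x * ‖w x‖ ^ (q + 2) +
      ∑ j, (q + 2) * (ρ t x * vt t x j * (‖w x‖ ^ q * w x j))) :=
    integral_congr_ae (by filter_upwards [hvw] with x hx; rw [hx])
  have e3 : ∫ x, ρ t x * ‖v t x‖ ^ (q + 2) = ∫ x, ρ t x * ‖w x‖ ^ (q + 2) :=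
    integral_congr_ae (by filter_upwards [hvw] with x hx; rw [hx])
  rw [e1, e2, e3]
  refine ⟨_, _, hsn.energy_le hγ, Finset.sum_nonneg fun i _ => integral_nonneg fun x => ?_,
    ?_, hsn.integral_pow_five_le, hsn.velocity_rpow_le hγ hq hs⟩
  · exact mul_nonneg (hr x) (sq_nonneg _)
  · exact_mod_cast hsn.integral_cube_deriv_le

/-- The Moser iteration step along a solution. -/
theorem integral_pow_two_mul_le (h : RegularSolution γ T ρ v ρt vt) {q Y l a B : ℝ} {n : ℕ}
    (hn : 1 ≤ n) (hq : 1 < q) (hl : 1 ≤ l)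
    (hY : ∀ t ∈ Icc 0 T, ∫ x, ρ t x * ‖v t x‖ ^ (q + 2) ≤ Y)
    (hδ : (l ^ (1 - q) * Y) ^ (2 / 3 : ℝ) ≤ 1 / (384 * n ^ 2)) (ha : a = 3 * n ^ 2 * l ^ 2)
    (hB : ∀ t ∈ Icc 0 T, ∫ x, ρ t x ^ n ≤ B) {t : ℝ} (ht : t ∈ Icc 0 T) :
    ∫ x, ρ t x ^ (2 * n) ≤ (∫ x, ρ 0 x ^ (2 * n)) +
      (2 * n ^ 2 * (1 + Y) + a * (384 * a) ^ 6 / 4 * B ^ 2) * t := by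
  refine (h.lipCurve_pow (2 * n)).le_add_mul ?_ ht
  filter_upwards [h.snap, ae_restrict_mem measurableSet_Ioo] with t ⟨r', w, w', hsn, hvw⟩ ht
  have ht' := Ioo_subset_Icc_self ht
  have e3 : ∫ x, ρ t x * ‖v t x‖ ^ (q + 2) = ∫ x, ρ t x * ‖w x‖ ^ (q + 2) :=
    integral_congr_ae (by filter_upwards [hvw] with x hx; rw [hx])
  refine (hsn.moser_step hn hq hl (e3 ▸ hY t ht') hδ ha).trans ?_
  have h1 : 0 ≤ ∫ x, ρ t x ^ n := integral_nonneg fun x => pow_nonneg (hsn.pos x).le _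
  have h2 := hB t ht'
  have ha0 : 0 ≤ a := by rw [ha]; positivity
  gcongr

end RegularSolution

/-! ## The Moser iteration -/

/-- The cutoff `l` may be a fixed power of `n`, because the gain $l^{1-q}$ only has to beat
$n^{-3}$. All constants of the Moser step are then polynomial in `n`, with `K` and `m` depending on
`q` and `Y` alone. -/
theorem exists_moser_constants {q Y : ℝ} (hq : 1 < q) (hY : 0 ≤ Y) :
    ∃ (K : ℝ) (m : ℕ), 0 ≤ K ∧ ∀ n : ℕ, 1 ≤ n → ∃ l a : ℝ, 1 ≤ l ∧
      (l ^ (1 - q) * Y) ^ (2 / 3 : ℝ) ≤ 1 / (384 * n ^ 2) ∧ a = 3 * n ^ 2 * l ^ 2 ∧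
      2 * n ^ 2 * (1 + Y) ≤ K * n ^ m ∧ a * (384 * a) ^ 6 / 4 ≤ K * n ^ m := by
  obtain ⟨j, hj⟩ := exists_nat_ge (3 / (q - 1))
  rw [div_le_iff₀ (by linarith)] at hj
  -- With $l=(bn)^j$ and $j(q-1)\ge3$ one gets $l^{1-q}Y\le(20n)^{-3}$, whose power $2/3$ is
  -- $1/(400n^2)$. The exponent $14+14j$ comes from $a^7$ with $a=3n^2(bn)^{2j}$.
  set b : ℝ := 20 * (1 + Y) with hb
  have hb1 : 1 ≤ b := by linarith
  refine ⟨2 * (1 + Y) + 384 ^ 6 / 4 * (3 * b ^ (2 * j)) ^ 7, 14 + 14 * j, by positivity,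
    fun n hn => ⟨(b * n) ^ j, 3 * n ^ 2 * ((b * n) ^ j) ^ 2, ?_, ?_, rfl, ?_, ?_⟩⟩
  all_goals have hn1 : (1 : ℝ) ≤ n := by exact_mod_cast hn
  all_goals have hbn : 1 ≤ b * n := by nlinarith
  · exact one_le_pow₀ hbn
  · have h1 : ((b * n) ^ j) ^ (1 - q) ≤ (b * n) ^ (-3 : ℝ) := by
      rw [← Real.rpow_natCast, ← Real.rpow_mul (by linarith)]
      exact Real.rpow_le_rpow_of_exponent_le hbn (by linarith)
    have h2 : ((b * n) ^ j) ^ (1 - q) * Y ≤ (20 * n) ^ (-3 : ℝ) := by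
      refine (mul_le_mul_of_nonneg_right h1 hY).trans ?_
      rw [Real.rpow_neg (by linarith), Real.rpow_neg (by linarith), inv_mul_eq_div,
        div_le_iff₀ (by positivity), inv_mul_eq_div, le_div_iff₀ (by positivity), hb]
      rw [Real.rpow_ofNat, Real.rpow_ofNat]
      have h3 : Y ≤ (1 + Y) ^ 3 := by nlinarith [pow_nonneg hY 3, pow_nonneg hY 2]
      calc Y * (20 * n) ^ 3 ≤ (1 + Y) ^ 3 * (20 * n) ^ 3 := by gcongr
        _ = _ := by ring
    calc _ ≤ ((20 * n : ℝ) ^ (-3 : ℝ)) ^ (2 / 3 : ℝ) :=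
          Real.rpow_le_rpow (by positivity) h2 (by norm_num)
      _ = ((20 * n : ℝ) ^ 2)⁻¹ := by
          rw [← Real.rpow_mul (by positivity), ← Real.rpow_natCast, ← Real.rpow_neg (by positivity)]
          norm_num
      _ ≤ _ := by
          rw [inv_eq_one_div]
          apply one_div_le_one_div_of_le (by positivity)
          nlinarith
  · have h1 : (n : ℝ) ^ 2 ≤ n ^ (14 + 14 * j) := pow_le_pow_right₀ hn1 (by omega)
    have h2 : 0 ≤ 384 ^ 6 / 4 * (3 * b ^ (2 * j)) ^ 7 * (n : ℝ) ^ (14 + 14 * j) := by positivity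
    have h3 : 2 * (n : ℝ) ^ 2 * (1 + Y) ≤ 2 * n ^ (14 + 14 * j) * (1 + Y) := by gcongr
    linarith
  · have h1 : 0 ≤ 2 * (1 + Y) * (n : ℝ) ^ (14 + 14 * j) := by positivity
    have h2 : 3 * (n : ℝ) ^ 2 * ((b * n) ^ j) ^ 2 * (384 * (3 * n ^ 2 * ((b * n) ^ j) ^ 2)) ^ 6 / 4 =
        384 ^ 6 / 4 * (3 * b ^ (2 * j)) ^ 7 * (n : ℝ) ^ (14 + 14 * j) := by
      rw [mul_pow b]
      ring
    rw [h2, add_mul]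
    linarith

/-- If `f` exceeded `M` somewhere, it would exceed some $c>M$ on an open set of positive measure,
and Chebyshev would bound $(c/M)^{2^k}$ times that measure by 1 for every $k$. -/
theorem le_of_integral_pow_le {f : Torus3 → ℝ} (hf : Continuous f) (h0 : ∀ x, 0 ≤ f x) {M : ℝ}
    (hM : 0 < M) (h : ∀ k : ℕ, ∫ x, f x ^ 2 ^ k ≤ M ^ 2 ^ k) (x : Torus3) : f x ≤ M := by
  by_contra! hx
  obtain ⟨c, hMc, hcx⟩ := exists_between hx
  set U : Set Torus3 := {y | c < f y} with hU
  have hUo : IsOpen U := isOpen_lt continuous_const hf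
  have hUpos : 0 < (volume : Measure Torus3).real U := by
    rw [measureReal_def, ENNReal.toReal_pos_iff]
    exact ⟨hUo.measure_pos _ ⟨x, hcx⟩, measure_lt_top _ _⟩
  have hc0 : 0 < c := hM.trans hMc
  have h1 : ∀ k : ℕ, (c / M) ^ 2 ^ k * (volume : Measure Torus3).real U ≤ 1 := by
    intro k
    have h2 := mul_meas_ge_le_integral_of_nonneg (μ := (volume : Measure Torus3))
      (Filter.Eventually.of_forall fun x => pow_nonneg (h0 x) (2 ^ k))
      (hf.pow (2 ^ k)).integrable_torus (c ^ 2 ^ k)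
    have h3 : (volume : Measure Torus3).real U ≤
        (volume : Measure Torus3).real {y | c ^ 2 ^ k ≤ f y ^ 2 ^ k} :=
      measureReal_mono fun y hy => pow_le_pow_left₀ hc0.le (le_of_lt hy) _
    have h4 : c ^ 2 ^ k * (volume : Measure Torus3).real U ≤ M ^ 2 ^ k :=
      (mul_le_mul_of_nonneg_left h3 (by positivity)).trans (h2.trans (h k))
    rw [div_pow, div_mul_eq_mul_div, div_le_one (by positivity)]
    exact h4
  have hcM : 1 < c / M := (one_lt_div hM).2 hMc
  obtain ⟨k, hk⟩ := pow_unbounded_of_one_lt (1 / (volume : Measure Torus3).real U) hcM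
  have h5 : (c / M) ^ k ≤ (c / M) ^ 2 ^ k := pow_le_pow_right₀ hcM.le Nat.lt_two_pow_self.le
  rw [div_lt_iff₀ hUpos] at hk
  have h6 := h1 k
  have h7 := mul_le_mul_of_nonneg_right h5 hUpos.le
  linarith

namespace RegularSolution

variable {γ T : ℝ} {ρ ρt : ℝ → Torus3 → ℝ} {v vt : ℝ → Torus3 → EuclideanSpace ℝ (Fin 3)}

/-- The Moser iteration. -/
theorem integral_pow_two_pow_le (h : RegularSolution γ T ρ v ρt vt) {q Y K τ R : ℝ} {m : ℕ}
    (hq : 1 < q) (hTτ : T ≤ τ) (hτ : 0 ≤ τ) (hK : 0 ≤ K) (hR : 1 ≤ R)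
    (hY : ∀ t ∈ Icc 0 T, ∫ x, ρ t x * ‖v t x‖ ^ (q + 2) ≤ Y)
    (hm : ∀ n : ℕ, 1 ≤ n → ∃ l a : ℝ, 1 ≤ l ∧
      (l ^ (1 - q) * Y) ^ (2 / 3 : ℝ) ≤ 1 / (384 * n ^ 2) ∧ a = 3 * n ^ 2 * l ^ 2 ∧
      2 * n ^ 2 * (1 + Y) ≤ K * n ^ m ∧ a * (384 * a) ^ 6 / 4 ≤ K * n ^ m)
    (h0 : ∀ n : ℕ, ∫ x, ρ 0 x ^ n ≤ R ^ n) (k : ℕ) :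
    ∀ t ∈ Icc 0 T, (1 + 2 * τ * K) * 2 ^ (m * (k + 1)) * ∫ x, ρ t x ^ 2 ^ k ≤
      ((1 + 2 * τ * K) * 2 ^ m * R) ^ 2 ^ k := by
  -- The Moser step reads $I_{k+1}\le L\,2^{mk}B_k^2$, where $B_k$ bounds $I_k=\int\varrho^{2^k}$.
  -- The prefactor $L2^{m(k+1)}$ in the claim turns this into plain squaring.
  set L : ℝ := 1 + 2 * τ * K with hL
  have hL1 : 1 ≤ L := by have : 0 ≤ 2 * τ * K := by positivity
                         linarith
  have hL0 : 0 < L := by linarith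
  induction k with
  | zero =>
    intro t ht
    have h1 := h.mass_le ht
    have h2 := h0 1
    simp only [pow_one] at h2
    simp only [pow_zero, pow_one, zero_add, mul_one]
    have := h1.trans h2
    gcongr
  | succ k ih =>
    intro t ht
    set B : ℝ := (L * 2 ^ m * R) ^ 2 ^ k / (L * 2 ^ (m * (k + 1))) with hB
    have hBb : ∀ t ∈ Icc 0 T, ∫ x, ρ t x ^ 2 ^ k ≤ B := fun t ht => by
      rw [hB, le_div_iff₀ (by positivity), mul_comm]
      exact ih t ht
    -- The inductive bound dominates the initial data, so the initial integral and the additive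
    -- constant are both absorbed into a multiple of $B^2$.
    have hBR : R ^ 2 ^ k ≤ B := by
      rw [hB, le_div_iff₀ (by positivity), mul_pow _ R, mul_comm]
      refine mul_le_mul_of_nonneg_right ?_ (by positivity)
      rw [mul_pow, ← pow_mul]
      refine mul_le_mul (le_self_pow₀ hL1 (by positivity)) ?_ (by positivity) (by positivity)
      exact pow_le_pow_right₀ one_le_two (Nat.mul_le_mul_left _ Nat.lt_two_pow_self)
    have hR1 : 1 ≤ R ^ 2 ^ k := one_le_pow₀ hR
    have hB1 : 1 ≤ B := hR1.trans hBR
    have hn : 1 ≤ 2 ^ k := Nat.one_le_two_pow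
    obtain ⟨l, a, hl, hδ, ha, h1, h2⟩ := hm (2 ^ k) hn
    have h3 := h.integral_pow_two_mul_le hn hq hl hY hδ ha hBb ht
    set N : ℝ := ((2 ^ k : ℕ) : ℝ) ^ m with hN
    have hN1 : 1 ≤ N := one_le_pow₀ (by exact_mod_cast hn)
    have hBsq : 1 ≤ B ^ 2 := one_le_pow₀ hB1
    have h4 : ∫ x, ρ 0 x ^ (2 * 2 ^ k) ≤ N * B ^ 2 := by
      calc _ ≤ R ^ (2 * 2 ^ k) := h0 _
        _ = (R ^ 2 ^ k) ^ 2 := by rw [mul_comm, pow_mul]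
        _ ≤ B ^ 2 := by gcongr
        _ ≤ N * B ^ 2 := le_mul_of_one_le_left (by positivity) hN1
    have h5 : (2 * ((2 ^ k : ℕ) : ℝ) ^ 2 * (1 + Y) + a * (384 * a) ^ 6 / 4 * B ^ 2) * t ≤
        2 * τ * K * (N * B ^ 2) := by
      have h6 : 2 * ((2 ^ k : ℕ) : ℝ) ^ 2 * (1 + Y) ≤ K * N * B ^ 2 :=
        h1.trans (le_mul_of_one_le_right (by positivity) hBsq)
      have h7 : a * (384 * a) ^ 6 / 4 * B ^ 2 ≤ K * N * B ^ 2 := by gcongr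
      calc _ ≤ (K * N * B ^ 2 + K * N * B ^ 2) * t :=
            mul_le_mul_of_nonneg_right (add_le_add h6 h7) ht.1
        _ ≤ (K * N * B ^ 2 + K * N * B ^ 2) * τ :=
            mul_le_mul_of_nonneg_left (ht.2.trans hTτ) (by positivity)
        _ = _ := by ring
    have h8 : ∫ x, ρ t x ^ (2 * 2 ^ k) ≤ L * (N * B ^ 2) := by rw [hL]; linarith
    rw [pow_succ' 2 k]
    calc _ ≤ L * 2 ^ (m * (k + 1 + 1)) * (L * (N * B ^ 2)) := by gcongr
      _ = _ := by
        have e : (2 : ℝ) ^ (m * (k + 1 + 1)) * N = (2 ^ (m * (k + 1))) ^ 2 := by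
          rw [hN, Nat.cast_pow, ← pow_mul, ← pow_mul, Nat.cast_ofNat, ← pow_add]
          congr 1; ring
        have e2 : L * 2 ^ (m * (k + 1 + 1)) * (L * (N * B ^ 2)) =
            (2 ^ (m * (k + 1 + 1)) * N) * (L ^ 2 * B ^ 2) := by ring
        rw [e2, e, hB, pow_mul' _ 2]
        field_simp

end RegularSolution

/-! ## The density bound -/

theorem IsStrongSolutionWith.regularSolution {γ Tstar : ℝ} {ρ ρt : ℝ → Torus3 → ℝ}
    {v vt : ℝ → Torus3 → EuclideanSpace ℝ (Fin 3)}
    (h : IsStrongSolutionWith γ Tstar ρ v ρt vt) {T : ℝ} (hT : T ∈ Ioo 0 Tstar) :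
    RegularSolution γ T ρ v ρt vt := by
  have hsub : Icc 0 T ⊆ Ico 0 Tstar := fun t ht => ⟨ht.1, ht.2.trans_lt hT.2⟩
  obtain ⟨hρ, -⟩ := h.density_regular T hT
  obtain ⟨hρt, hρt1, -⟩ := h.density_time_regular T hT
  have hv := fun j => h.velocity_regular T hT j
  have hvt := fun j => h.velocity_time_regular T hT j
  obtain ⟨M, hM⟩ := hρt1.1.exists_bound
  have hN := fun j => LpL2.exists_bound (hvt j).2.1
  choose N hN using hN
  refine ⟨fun t ht => h.density_pos t (hsub ht), fun t ht => h.continuous_density t (hsub ht),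
    (regularCurve_of_contSobolev hT.1 hρ.mono hρt hM).assemble fun j =>
      regularCurve_of_contSobolev hT.1 (hv j).1 (hvt j).1 (hN j), ?_⟩
  have hres : Ioo 0 T ⊆ Ioo 0 Tstar := Ioo_subset_Ioo_right hT.2.le
  filter_upwards [ae_restrict_mem measurableSet_Ioo, hM, ae_all_iff.2 hN,
    ae_all_iff.2 fun j => (hv j).2.isSobolev,
    ae_restrict_of_ae_restrict_of_subset hres h.mass_equation,
    ae_restrict_of_ae_restrict_of_subset hres h.momentum_equation] with t ht h1 h2 h3 h4 h5
  have ht' := Ioo_subset_Icc_self ht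
  exact exists_snapshot (h.continuous_density t (hsub ht')) (h.density_pos t (hsub ht'))
    (hρ.isSobolev ht') h3 (h1.1.integrable one_le_two) (fun j => (h2 j).1.integrable one_le_two)
    h4 h5

theorem ae_le_of_eLpNorm_top_eq {f : Torus3 → ℝ} {R : ℝ≥0}
    (hR : eLpNorm f ∞ volume = R) : ∀ᵐ x, f x ≤ R := by
  rw [eLpNorm_exponent_top] at hR
  filter_upwards [ae_le_eLpNormEssSup (f := f) (μ := volume)] with x hx
  rw [hR] at hx
  have hx' : ‖f x‖₊ ≤ R := by exact_mod_cast hx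
  exact (le_abs_self _).trans (by exact_mod_cast hx')

namespace RegularSolution

variable {γ T : ℝ} {ρ ρt : ℝ → Torus3 → ℝ} {v vt : ℝ → Torus3 → EuclideanSpace ℝ (Fin 3)}

theorem integral_velocity_eq (h : RegularSolution γ T ρ v ρt vt) (hT : 0 ≤ T) {q : ℝ} (hq : 0 < q)
    {A : ℝ≥0} (hA : eLpNorm (fun x => (ρ 0 x ^ (1 / (q + 2))) • v 0 x) (ENNReal.ofReal (q + 2))
      volume = A) : ∫ x, ρ 0 x * ‖v 0 x‖ ^ (q + 2) = A ^ (q + 2) := by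
  have h0 : (0 : ℝ) ∈ Icc 0 T := ⟨le_rfl, hT⟩
  have hvm : AEStronglyMeasurable (v 0) volume :=
    continuous_snd.comp_aestronglyMeasurable (h.curve.aesm 0 h0)
  have hρc : Continuous fun x => ρ 0 x ^ (1 / (q + 2)) :=
    (h.cont 0 h0).rpow_const fun x => Or.inl (h.pos 0 h0 x).ne'
  have hmem : MemLp (fun x => (ρ 0 x ^ (1 / (q + 2))) • v 0 x) (ENNReal.ofReal (q + 2)) volume :=
    ⟨hρc.aestronglyMeasurable.smul hvm, by rw [hA]; exact ENNReal.coe_lt_top⟩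
  have h1 := hmem.eLpNorm_eq_integral_rpow_norm (by simp; linarith) ENNReal.ofReal_ne_top
  rw [hA, ENNReal.toReal_ofReal (by linarith)] at h1
  have e : ∀ x, ‖(ρ 0 x ^ (1 / (q + 2))) • v 0 x‖ ^ (q + 2) = ρ 0 x * ‖v 0 x‖ ^ (q + 2) := by
    intro x
    have hx := (h.pos 0 h0 x).le
    rw [norm_smul, Real.norm_of_nonneg (by positivity), Real.mul_rpow (by positivity)
      (norm_nonneg _), ← Real.rpow_mul hx, one_div_mul_cancel (by linarith), Real.rpow_one]
  simp only [e] at h1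
  have hI : 0 ≤ ∫ x, ρ 0 x * ‖v 0 x‖ ^ (q + 2) := integral_nonneg fun x => by
    have := h.pos 0 h0 x; positivity
  have h2 := congrArg ENNReal.toReal h1
  rw [ENNReal.toReal_ofReal (by positivity), ENNReal.coe_toReal] at h2
  rw [h2, ← Real.rpow_mul hI, inv_mul_cancel₀ (by linarith), Real.rpow_one]

theorem integral_initial_pow_le (h : RegularSolution γ T ρ v ρt vt) (hT : 0 ≤ T) {R : ℝ}
    (hR : ∀ᵐ x, ρ 0 x ≤ R) (n : ℕ) : ∫ x, ρ 0 x ^ n ≤ R ^ n := by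
  have h0 : (0 : ℝ) ∈ Icc 0 T := ⟨le_rfl, hT⟩
  calc _ ≤ ∫ _ : Torus3, R ^ n := by
        refine integral_mono_ae ((h.cont 0 h0).pow n).integrable_torus (integrable_const _) ?_
        filter_upwards [hR] with x hx
        exact pow_le_pow_left₀ (h.pos 0 h0 x).le hx n
    _ = _ := by simp

/-- Since $|v|^2\le1+|v|^{q+2}$, the energy written in `v` is controlled initially by the sup of the
density and the weighted velocity norm. -/
theorem initial_energy_le (h : RegularSolution γ T ρ v ρt vt) (hT : 0 ≤ T) {q R y : ℝ} (hγ : 1 < γ)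
    (hq : 0 < q) (hR : ∀ᵐ x, ρ 0 x ≤ R) (hy : ∫ x, ρ 0 x * ‖v 0 x‖ ^ (q + 2) = y) :
    ∫ x, (1 / 2 * (ρ 0 x * ‖v 0 x‖ ^ 2) + 1 / (γ - 1) * ρ 0 x ^ γ) ≤
      1 / 2 * (R + y) + 1 / (γ - 1) * R ^ γ := by
  have h0 : (0 : ℝ) ∈ Icc 0 T := ⟨le_rfl, hT⟩
  have hγ1 : 0 < γ - 1 := by linarith
  have i1 : Integrable fun x => ρ 0 x * ‖v 0 x‖ ^ (q + 2) := h.curve.integrable_comp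
    (contDiff_fst_mul_norm_rpow (p := q + 2) (by linarith)).continuous h0
  have i2 := h.curve.integrable_comp (contDiff_energy hγ).continuous h0
  have i3 : Integrable fun x => 1 / 2 * (R + ρ 0 x * ‖v 0 x‖ ^ (q + 2)) :=
    ((integrable_const R).add i1).const_mul _
  have i4 : Integrable fun _ : Torus3 => 1 / (γ - 1) * R ^ γ := integrable_const _
  calc _ ≤ ∫ x, (1 / 2 * (R + ρ 0 x * ‖v 0 x‖ ^ (q + 2)) + 1 / (γ - 1) * R ^ γ) := by
        refine integral_mono_ae i2 (i3.add i4) ?_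
        filter_upwards [hR] with x hx
        have hr := h.pos 0 h0 x
        have hz := sq_le_one_add_rpow (norm_nonneg (v 0 x)) hq.le
        have h2 : ρ 0 x * ‖v 0 x‖ ^ 2 ≤ R + ρ 0 x * ‖v 0 x‖ ^ (q + 2) := by
          have := mul_le_mul_of_nonneg_left hz hr.le
          linarith
        have h3 : ρ 0 x ^ γ ≤ R ^ γ := Real.rpow_le_rpow hr.le hx (by linarith)
        gcongr
    _ = _ := by
        rw [integral_add i3 i4, integral_const_mul, integral_add (integrable_const _) i1, hy]
        simp

end RegularSolution

end NSK

end

/-! ### The theorem: assembling the constants -/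

theorem mainTheorem4 (γ q Tstar : ℝ) (hγ : 1 < γ) (hγ' : γ < 7 / 3)
    (hq : 1 < q) (hq' : q < 4) (hγq : γ < 1 + 4 / (q + 2)) (hT : 0 < Tstar)
    (E₀ : ℝ) (A R : ℝ≥0) :
    ∃ C : ℝ, 0 < C ∧
      ∀ (ρ : ℝ → NSK.Torus3 → ℝ) (v : ℝ → NSK.Torus3 → EuclideanSpace ℝ (Fin 3)),
        NSK.IsStrongSolution γ Tstar ρ v →
        NSK.initialEnergy γ (ρ 0) (v 0) = E₀ →
        eLpNorm (fun x => (ρ 0 x ^ (1 / (q + 2))) • v 0 x) (ENNReal.ofReal (q + 2)) volume = A →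
        eLpNorm (ρ 0) ∞ volume = R →
        ∀ T : ℝ, 0 < T → T < Tstar →
          (⨆ t ∈ Icc 0 T, eLpNorm (ρ t) ∞ volume) ≤ ENNReal.ofReal C := by
  have hs : (γ - 1) * (q + 2) + 1 ≤ 5 := by
    have h1 : γ - 1 < 4 / (q + 2) := by linarith
    rw [lt_div_iff₀ (by linarith)] at h1
    linarith
  set y : ℝ := (A : ℝ) ^ (q + 2) with hy
  set e : ℝ := 1 / 2 * (R + y) + 1 / (γ - 1) * (R : ℝ) ^ γ with he
  set p : ℝ := (R : ℝ) ^ 3 with hp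
  set M : ℝ := Real.exp (Real.log (1 + p) + 216 * e + Tstar) with hM
  set Y : ℝ := Real.exp (Real.log (1 + y) + 72 * ((q + 2) * (q + 3) / 4) * M ^ 2 *
    (Real.log (1 + p) + 216 * e) +
    (q + 2) * (q + 3) / 4 * (1 + 2 * M ^ 2 + 72 * M ^ 2) * Tstar) with hYdef
  obtain ⟨K, m, hK, hm⟩ := NSK.exists_moser_constants hq (Real.exp_pos _).le (Y := Y)
  have hR1 : 1 ≤ max 1 (R : ℝ) := le_max_left _ _
  have hL : 1 ≤ 1 + 2 * Tstar * K := by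
    have : 0 ≤ 2 * Tstar * K := by positivity
    linarith
  -- Every constant is built with `Tstar` in place of `T`, which makes the bound uniform in `T`; the
  -- maximum with 1 meets the normalisation $1\le R$ of the iteration.
  set C : ℝ := (1 + 2 * Tstar * K) * 2 ^ m * max 1 (R : ℝ) with hC
  have hC0 : 0 < C := by positivity
  refine ⟨C, hC0, fun ρ v hsol _ hA hR T hT0 hT1 => iSup₂_le fun t ht => ?_⟩
  obtain ⟨ρt, vt, hsol⟩ := hsol
  have h := hsol.regularSolution ⟨hT0, hT1⟩
  have hRae := NSK.ae_le_of_eLpNorm_top_eq hR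
  have hy0 := h.integral_velocity_eq hT0.le (by linarith) hA
  have hYb : ∀ t ∈ Icc 0 T, ∫ x, ρ t x * ‖v t x‖ ^ (q + 2) ≤ Y := fun t ht =>
    h.velocity_le hγ hq hs hT1.le (h.initial_energy_le hT0.le hγ (by linarith) hRae hy0)
      (h.integral_initial_pow_le hT0.le hRae 3) hy0.le hM ht
  have hpow := fun k => h.integral_pow_two_pow_le hq hT1.le hT.le hK hR1 hYb hm
    (h.integral_initial_pow_le hT0.le (hRae.mono fun x hx => hx.trans (le_max_right _ _))) k t ht
  have hρ0 := fun x => (h.pos t ht x).le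
  have hle := NSK.le_of_integral_pow_le (h.cont t ht) hρ0 hC0 fun k =>
    (le_mul_of_one_le_left (integral_nonneg fun x => pow_nonneg (hρ0 x) _)
      (one_le_mul_of_one_le_of_one_le hL (one_le_pow₀ one_le_two))).trans (hpow k)
  rw [eLpNorm_exponent_top]
  refine eLpNormEssSup_le_of_ae_bound (Filter.Eventually.of_forall fun x => ?_)
  rw [Real.norm_of_nonneg (hρ0 x)]
  exact hle x
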